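/- Let $F$ be a local field of characteristic $\neq 2$ (a field with a nontrivial absolute value for which it is locally compact), and let $(K,\sigma)$ be one of the following: $K=F$ with a continuous involutive automorphism $\sigma$ (possibly $\sigma=\mathrm{id}$); or $K$ a quaternion division algebra over $F$ with its standard involution $\sigma$; or $F=\mathbb R$, $K=\mathbb H$ and $\sigma$, up to an automorphism of $\mathbb H$, the involution $i\mapsto i,\ j\mapsto -j,\ k\mapsto k$. Let $V$ be a finite-dimensional right $K$-vector space with $\dim V\ge 5$, and let $\varphi$ be a nondegenerate $\sigma$-Hermitian form on $V$ ($\varphi(vx,wy)=\sigma(x)\varphi(v,w)y$, $\varphi(w,v)=\sigma(\varphi(v,w))$) of Witt index $2$, i.e. all maximal totally isotropic subspaces have dimension $2$. Put $q(v)=\varphi(v,v)$. Let $\mathcal I$ be the flag complex of the nonzero totally isotropic subspaces of $V$; its vertices are the isotropic lines (line-type) and the totally isotropic planes (plane-type), and its chambers (edges) are the flags (line $\subset$ plane), topologised as a subset of $\mathbb P(V)\times \mathrm{Gr}_2(V)$. Fix vectors $e_1,\dots,e_4$ with $\varphi(e_i,e_i)=0$, $\varphi(e_i,e_{i+1})=0$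 (indices mod $4$) and $\varphi(e_1,e_3)=\varphi(e_2,e_4)=1$, and let $\mathcal A$ be the apartment with vertices $\langle e_i\rangle$ and $\langle e_i,e_{i+1}\rangle$. Let $\mathrm{Mor}(\mathcal A,\mathcal I)$ be the set of type-preserving simplicial maps $\mathcal A\to\mathcal I$, with the topology induced by the product topology on families of chambers, let $\mathrm{Mor}_{inj}$ be the subset of injective ones (marked apartments), and let $\overline{\mathrm{Mor}_{inj}}$ be its closure in $\mathrm{Mor}(\mathcal A,\mathcal I)$. Let $V'=\langle e_1,e_2,e_3,e_4\rangle^{\perp}$. A morphism $f$ is a quadripod if its image consists of four distinct edges any two of which share a vertex; it is of line-type or plane-type according to the type of the common vertex. For a line-type quadripod $f$ with central line $\ell$ and planes $p_i=f(\langle e_i,e_{i+1}\rangle)$, say that $f$ is symmetric if there are $v_i\in p_i\setminus \ell$ ($1\le i\le 4$) with $v_1+v_2+v_3+v_4=0$ and $\varphi(v_2,v_3)=\varphi(v_1,v_4)$. If $\sigma=\mathrm{id}$ (so that $K$ is commutative) and $f$ is a plane-type quadripod, its cross-ratio is the $c\in K$ such that, for some basis $(u,w)$ of the central plane, $f(\langle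 e_1\rangle)=\langle u\rangle$, $f(\langle e_2\rangle)=\langle w\rangle$, $f(\langle e_3\rangle)=\langle u+w\rangle$, $f(\langle e_4\rangle)=\langle uc+w\rangle$. Let $f\in \mathrm{Mor}(\mathcal A,\mathcal I)$. 1. If $f$ is not a quadripod, then $f\in\overline{\mathrm{Mor}_{inj}}$. 2. If $f$ is a line-type quadripod, then $f\in\overline{\mathrm{Mor}_{inj}}$ if and only if $f$ is symmetric. If moreover $K$ is commutative, this holds if and only if $\dim(p_1+p_2+p_3+p_4)\le 4$ and there is a $\sigma$-semilinear involution $s$ of $V$ with $\varphi(s(v),s(w))=\sigma(\varphi(v,w))$ for all $v,w$, $s(\ell)=\ell$, and $s(p_i)=p_{i+2}$ for all $i$ (indices mod $4$). 3. If $f$ is a plane-type quadripod, then $f\in\overline{\mathrm{Mor}_{inj}}$ if and only if $\sigma\neq\mathrm{id}$, or $\sigma=\mathrm{id}$ and $1-c\in\{q(v)q(v')^{-1}: v,v'\in V'\setminus\{0\}\}$, where $c$ is the cross-ratio of $f$. 4. Assume $\sigma=\mathrm{id}$ and $\dim V=5$. Then every line-type quadripod belongs to $\overline{\mathrm{Mor}_{inj}}$,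 and a plane-type quadripod with cross-ratio $c$ belongs to it if and only if $1-c$ is a square in $K$. If $K=\mathbb R$, the latter condition is $c\le 1$. If $K=\mathbb C$, then $\overline{\mathrm{Mor}_{inj}}=\mathrm{Mor}(\mathcal A,\mathcal I)$. -/

import Mathlib

/-! Classical buildings of type `C₂`, marked apartments and their limits. Vector spaces over the
division ring `K` are right vector spaces, i.e. modules over `Kᵐᵒᵖ`: the product of the vector
`v` by the scalar `x` is `MulOpposite.op x • v`. -/

noncomputable section

namespace ClassicalC2

/-! ### Scalars -/

/-- An involutive (possibly trivial) antiautomorphism of `K`. -/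
structure AntiInvolution (K : Type*) [DivisionRing K] where
  toFun : K → K
  map_add' : ∀ x y, toFun (x + y) = toFun x + toFun y
  map_mul' : ∀ x y, toFun (x * y) = toFun y * toFun x
  involutive' : ∀ x, toFun (toFun x) = x

instance {K : Type*} [DivisionRing K] : CoeFun (AntiInvolution K) (fun _ => K → K) :=
  ⟨AntiInvolution.toFun⟩

/-- `σ = id`. -/
def AntiInvolution.IsTrivial {K : Type*} [DivisionRing K] (σ : AntiInvolution K) : Prop :=
  ∀ x, σ x = x

/-- The map `i ↦ i`, `j ↦ -j`, `k ↦ k` of the Hamilton quaternion algebra over `F`. -/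
def hamiltonTau {F : Type*} [Field F] (x : QuaternionAlgebra F (-1) 0 (-1)) :
    QuaternionAlgebra F (-1) 0 (-1) :=
  ⟨x.re, x.imI, -x.imJ, x.imK⟩

/-- The pairs `(K, σ)` that are considered, over the local field `F`:
* `K = F`, and `σ` is any continuous involutive automorphism (or the identity);
* `K` is a quaternion division algebra over `F`, and `σ` is its standard involution;
* `F = ℝ`, `K` is the algebra of Hamilton quaternions, and `σ` is, up to an automorphism of `K`,
  the involution that fixes `i` and `k` and sends `j` to `-j`. -/
def IsClassicalPair (F : Type*) [NontriviallyNormedField F] {K : Type*} [DivisionRing K]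
    [Algebra F K] [TopologicalSpace K] (σ : AntiInvolution K) : Prop :=
  (Function.Bijective (algebraMap F K) ∧ Continuous σ) ∨
  (∃ (a b : F) (ψ : K ≃ₐ[F] QuaternionAlgebra F a 0 b), ∀ x, ψ (σ x) = star (ψ x)) ∨
  ((∃ r : F ≃+* ℝ, IsHomeomorph r) ∧
    ∃ ψ : K ≃ₐ[F] QuaternionAlgebra F (-1) 0 (-1), ∀ x, ψ (σ x) = hamiltonTau (ψ x))

/-! ### Hermitian forms -/

/-- A `σ`-Hermitian form on the right vector space `V`. -/
structure HermitianForm {K : Type*} [DivisionRing K] (σ : AntiInvolution K)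
    (V : Type*) [AddCommGroup V] [Module Kᵐᵒᵖ V] where
  toFun : V → V → K
  add_left : ∀ v v' w, toFun (v + v') w = toFun v w + toFun v' w
  add_right : ∀ v w w', toFun v (w + w') = toFun v w + toFun v w'
  smul_smul : ∀ (v w : V) (x y : K),
    toFun (MulOpposite.op x • v) (MulOpposite.op y • w) = σ x * toFun v w * y
  hermitian : ∀ v w, toFun w v = σ (toFun v w)

section Form

variable {K : Type*} [DivisionRing K] {σ : AntiInvolution K}
  {V : Type*} [AddCommGroup V] [Module Kᵐᵒᵖ V]

instance : CoeFun (HermitianForm σ V) (fun _ => V → V → K) := ⟨HermitianForm.toFun⟩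

namespace HermitianForm

variable (q : HermitianForm σ V)

def Nondegenerate : Prop := ∀ v, (∀ w, q v w = 0) → v = 0

def IsTotallyIsotropic (W : Submodule Kᵐᵒᵖ V) : Prop := ∀ v ∈ W, ∀ w ∈ W, q v w = 0

/-- The Witt index is `2`: all maximal totally isotropic subspaces have dimension `2`. -/
def HasWittIndexTwo : Prop :=
  ∀ W : Submodule Kᵐᵒᵖ V, Maximal q.IsTotallyIsotropic W → Module.finrank Kᵐᵒᵖ W = 2

/-- The vertices of the building: the nonzero totally isotropic subspaces, ordered by
inclusion. The building is the flag complex of this ordered set; the type of a vertex is its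
dimension (`1` for line-type, `2` for plane-type). -/
def Vertex : Type _ := {W : Submodule Kᵐᵒᵖ V // W ≠ ⊥ ∧ q.IsTotallyIsotropic W}

end HermitianForm

/-- A free family `(e 0, e 1, e 2, e 3)` of isotropic vectors such that `⟨e 0, e 2⟩` and
`⟨e 1, e 3⟩` are orthogonal hyperbolic planes, with `q (e 0) (e 2) = q (e 1) (e 3) = 1`. -/
structure Frame (q : HermitianForm σ V) where
  e : Fin 4 → V
  isotropic : ∀ i, q (e i) (e i) = 0
  orthogonal : ∀ i, q (e i) (e (i + 1)) = 0
  pairing_zero_two : q (e 0) (e 2) = 1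
  pairing_one_three : q (e 1) (e 3) = 1

namespace HermitianForm

variable (q : HermitianForm σ V)

theorem zero_left (w : V) : q 0 w = 0 := by
  have h := q.add_left 0 0 w
  simpa using h

theorem smul_right (v w : V) (y : K) : q v (MulOpposite.op y • w) = q v w * y := by
  have h1 : σ 1 = 1 := by
    have hmul := σ.map_mul' (σ 1) 1
    rw [mul_one, σ.involutive'] at hmul
    simpa using hmul.symm
  simpa [h1] using q.smul_smul v w 1 y

theorem smul_left (v w : V) (x : K) : q (MulOpposite.op x • v) w = σ x * q v w := by
  simpa using q.smul_smul v w x 1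

theorem swap_eq_zero {v w : V} (h : q v w = 0) : q w v = 0 := by
  have h0 : σ 0 = 0 := by simpa using σ.map_add' 0 0
  rw [q.hermitian, h, h0]

theorem isTotallyIsotropic_span {s : Set V} (h : ∀ v ∈ s, ∀ w ∈ s, q v w = 0) :
    q.IsTotallyIsotropic (Submodule.span Kᵐᵒᵖ s) := by
  have right : ∀ v, (∀ w ∈ s, q v w = 0) → ∀ w ∈ Submodule.span Kᵐᵒᵖ s, q v w = 0 := by
    intro v hv w hw
    induction hw using Submodule.span_induction with
    | mem x hx => exact hv x hx
    | zero => exact q.swap_eq_zero (q.zero_left v)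
    | add x y _ _ hx hy => rw [q.add_right, hx, hy, add_zero]
    | smul a x _ hx =>
      rw [← MulOpposite.op_unop a, q.smul_right, hx, zero_mul]
  intro v hv
  refine right v fun w hw => q.swap_eq_zero ?_
  exact right w (fun x hx => h w hw x hx) v hv

end HermitianForm

/-! ### The standard apartment -/

namespace Frame

variable {q : HermitianForm σ V} (E : Frame q)

theorem e_ne_zero (i : Fin 4) : E.e i ≠ 0 := by
  have key : ∀ i j, q (E.e i) (E.e j) = 1 → E.e i ≠ 0 ∧ E.e j ≠ 0 := by
    intro i j h
    constructor <;> intro h0 <;> rw [h0] at h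
    · rw [q.zero_left] at h
      exact zero_ne_one h
    · rw [q.swap_eq_zero (q.zero_left _)] at h
      exact zero_ne_one h
  have h02 := key 0 2 E.pairing_zero_two
  have h13 := key 1 3 E.pairing_one_three
  fin_cases i
  exacts [h02.1, h13.1, h02.2, h13.2]

/-- The isotropic line `⟨e i⟩`. -/
def lineVertex (i : Fin 4) : q.Vertex :=
  ⟨Submodule.span Kᵐᵒᵖ {E.e i}, by simpa using E.e_ne_zero i,
    q.isTotallyIsotropic_span (by simpa using E.isotropic i)⟩

/-- The isotropic plane `⟨e i, e (i + 1)⟩`, with indices modulo `4`. -/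
def planeVertex (i : Fin 4) : q.Vertex :=
  ⟨Submodule.span Kᵐᵒᵖ {E.e i, E.e (i + 1)},
    fun h => E.e_ne_zero i ((Submodule.eq_bot_iff _).1 h _ (Submodule.subset_span (by simp))),
    q.isTotallyIsotropic_span (by
      have h := E.orthogonal i
      have h' := q.swap_eq_zero h
      have h1 := E.isotropic i
      have h2 := E.isotropic (i + 1)
      simp [h, h', h1, h2])⟩

/-- The vertices of the apartment `𝒜` of the frame; its simplices are the flags of such
vertices. -/
def apartment : Set q.Vertex := Set.range E.lineVertex ∪ Set.range E.planeVertex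

/-- `⟨e i⟩`, as a vertex of `𝒜`. -/
def line (i : Fin 4) : E.apartment := ⟨E.lineVertex i, Or.inl ⟨i, rfl⟩⟩

/-- `⟨e i, e (i + 1)⟩`, as a vertex of `𝒜`. -/
def plane (i : Fin 4) : E.apartment := ⟨E.planeVertex i, Or.inr ⟨i, rfl⟩⟩

/-- The Weyl chambers of `𝒜`: the flags that consist of a line and a plane of `𝒜`. -/
structure Chamber where
  line : E.apartment
  plane : E.apartment
  finrank_line : Module.finrank Kᵐᵒᵖ line.1.1 = 1
  finrank_plane : Module.finrank Kᵐᵒᵖ plane.1.1 = 2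
  le : line.1.1 ≤ plane.1.1

/-- The vectors of `V' = ⟨e 0, e 1, e 2, e 3⟩^⊥`. -/
def perp : Set V := {v | ∀ i, q (E.e i) v = 0}

end Frame

/-! ### Grassmannians -/

variable (K V) in
/-- The Grassmannian of `k`-dimensional subspaces of `V`. -/
def Gr (k : ℕ) : Type _ := {W : Submodule Kᵐᵒᵖ V // Module.finrank Kᵐᵒᵖ W = k}

variable (K V) in
/-- The subspace spanned by a free family of `k` vectors. -/
def Gr.ofFree (k : ℕ) (v : {v : Fin k → V // LinearIndependent Kᵐᵒᵖ v}) : Gr K V k :=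
  ⟨Submodule.span Kᵐᵒᵖ (Set.range v.1), by simpa using finrank_span_eq_card v.2⟩

/-- The Grassmannian carries the quotient topology of the space of free families. -/
instance [TopologicalSpace V] (k : ℕ) : TopologicalSpace (Gr K V k) :=
  TopologicalSpace.coinduced (Gr.ofFree K V k) inferInstance

/-! ### Morphisms from the apartment to the building -/

/-- The type-preserving simplicial maps from the apartment `𝒜` to the building, as maps
on vertices: the dimension is preserved, and flags are mapped to flags. -/
structure Mor {q : HermitianForm σ V} (E : Frame q) where
  toFun : E.apartment → q.Vertex
  finrank_eq : ∀ x, Module.finrank Kᵐᵒᵖ (toFun x).1 = Module.finrank Kᵐᵒᵖ x.1.1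
  map_le : ∀ x y, x.1.1 ≤ y.1.1 → (toFun x).1 ≤ (toFun y).1

namespace Mor

variable {q : HermitianForm σ V} {E : Frame q}

/-- The image of a chamber of `𝒜`, as an element of `ℙ(V) × Gr₂(V)`. -/
def chamber (f : Mor E) (C : E.Chamber) : Gr K V 1 × Gr K V 2 :=
  (⟨(f.toFun C.line).1, (f.finrank_eq _).trans C.finrank_line⟩,
   ⟨(f.toFun C.plane).1, (f.finrank_eq _).trans C.finrank_plane⟩)

/-- The topology of `Mor(𝒜, ℐ)` is induced by the product topology on families of chambers,
the space of chambers having the topology induced by `ℙ(V) × Gr₂(V)`. -/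
instance [TopologicalSpace V] : TopologicalSpace (Mor E) :=
  TopologicalSpace.induced Mor.chamber inferInstance

variable (E) in
/-- The injective morphisms, i.e. the marked apartments. -/
def inj : Set (Mor E) := {f | Function.Injective f.toFun}

/-- The image of `f` consists of four distinct edges, any two of which share a vertex. -/
def IsQuadripod (f : Mor E) : Prop :=
  (Set.range f.chamber).ncard = 4 ∧
    ∀ C D, (f.chamber C).1 = (f.chamber D).1 ∨ (f.chamber C).2 = (f.chamber D).2

/-- A quadripod whose edges have a line in common. -/
def IsLineTypeQuadripod (f : Mor E) : Prop :=
  f.IsQuadripod ∧ ∀ C D, (f.chamber C).1 = (f.chamber D).1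

/-- A quadripod whose edges have a plane in common. -/
def IsPlaneTypeQuadripod (f : Mor E) : Prop :=
  f.IsQuadripod ∧ ∀ C D, (f.chamber C).2 = (f.chamber D).2

/-- The image of `⟨e i⟩`. -/
def line (f : Mor E) (i : Fin 4) : Submodule Kᵐᵒᵖ V := (f.toFun (E.line i)).1

/-- The image of `⟨e i, e (i + 1)⟩`. -/
def plane (f : Mor E) (i : Fin 4) : Submodule Kᵐᵒᵖ V := (f.toFun (E.plane i)).1

/-- Symmetry of a line-type quadripod with central line `ℓ` and cyclically ordered planes
`p 0, p 1, p 2, p 3`, in the form that makes sense for every `K`: there are vectors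
`v i ∈ p i ∖ ℓ` with `v 0 + v 1 + v 2 + v 3 = 0` and `q (v 1) (v 2) = q (v 0) (v 3)`. -/
def IsSymmetric (f : Mor E) : Prop :=
  ∃ v : Fin 4 → V, (∀ i, v i ∈ f.plane i ∧ v i ∉ f.line 0) ∧
    v 0 + v 1 + v 2 + v 3 = 0 ∧ q (v 1) (v 2) = q (v 0) (v 3)

/-- Symmetry of a line-type quadripod through an involution of `V` (for commutative `K`): the
four planes span a space of dimension at most `4`, and a `σ`-semilinear semiisometric
involution `s` of `V` stabilises `ℓ` and exchanges `p i` and `p (i + 2)` for every `i`. -/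
def IsSymmetricByInvolution (f : Mor E) : Prop :=
  Module.finrank Kᵐᵒᵖ (⨆ i, f.plane i : Submodule Kᵐᵒᵖ V) ≤ 4 ∧
    ∃ s : V →+ V,
      (∀ (v : V) (x : K), s (MulOpposite.op x • v) = MulOpposite.op (σ x) • s v) ∧
      (∀ v w, q (s v) (s w) = σ (q v w)) ∧
      (∀ v, s (s v) = v) ∧
      s '' (f.line 0 : Set V) = f.line 0 ∧
      ∀ i, s '' (f.plane i : Set V) = f.plane (i + 2)

end Mor

/-! ### Cross-ratios -/

/-- `c` is the cross-ratio of four lines `L i`: in the affine coordinate `t ↦ ⟨u t + w⟩` in which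
`L 0, L 1, L 2` are `∞, 0, 1`, the line `L 3` is `c`. -/
def IsCrossRatio (L : Fin 4 → Submodule Kᵐᵒᵖ V) (c : K) : Prop :=
  ∃ u w : V, LinearIndependent Kᵐᵒᵖ ![u, w] ∧
    L 0 = Submodule.span Kᵐᵒᵖ {u} ∧ L 1 = Submodule.span Kᵐᵒᵖ {w} ∧
    L 2 = Submodule.span Kᵐᵒᵖ {u + w} ∧
    L 3 = Submodule.span Kᵐᵒᵖ {MulOpposite.op c • u + w}

/-- If `K` is commutative, there is at most one cross-ratio. -/
theorem IsCrossRatio.eq (hK : ∀ x y : K, x * y = y * x) {L : Fin 4 → Submodule Kᵐᵒᵖ V} {c c' : K}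
    (h : IsCrossRatio L c) (h' : IsCrossRatio L c') : c = c' := by
  obtain ⟨u, w, hi, h0, h1, h2, h3⟩ := h
  obtain ⟨u', w', hi', h0', h1', h2', h3'⟩ := h'
  have hu : u' ∈ Submodule.span Kᵐᵒᵖ {u} := by
    rw [← h0, h0']
    exact Submodule.mem_span_singleton_self u'
  have hw : w' ∈ Submodule.span Kᵐᵒᵖ {w} := by
    rw [← h1, h1']
    exact Submodule.mem_span_singleton_self w'
  have hs : u' + w' ∈ Submodule.span Kᵐᵒᵖ {u + w} := by
    rw [← h2, h2']
    exact Submodule.mem_span_singleton_self _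
  have ht : MulOpposite.op c' • u' + w' ∈ Submodule.span Kᵐᵒᵖ {MulOpposite.op c • u + w} := by
    rw [← h3, h3']
    exact Submodule.mem_span_singleton_self _
  obtain ⟨α, rfl⟩ := Submodule.mem_span_singleton.1 hu
  obtain ⟨β, rfl⟩ := Submodule.mem_span_singleton.1 hw
  obtain ⟨γ, hγ⟩ := Submodule.mem_span_singleton.1 hs
  obtain ⟨δ, hδ⟩ := Submodule.mem_span_singleton.1 ht
  have key := LinearIndependent.pair_iff.1 hi
  have e1 := key (γ - α) (γ - β) (by
    rw [sub_smul, sub_smul, ← sub_eq_zero.2 hγ, smul_add]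
    abel)
  have e2 := key (δ * MulOpposite.op c - MulOpposite.op c' * α) (δ - β) (by
    rw [← sub_eq_zero.2 hδ, sub_smul, sub_smul, mul_smul, mul_smul, smul_add]
    abel)
  have hα : α ≠ 0 := by
    rintro rfl
    exact hi'.ne_zero 0 (by simp)
  have e3 : γ = α := sub_eq_zero.1 e1.1
  have e4 : γ = β := sub_eq_zero.1 e1.2
  have e5 : δ = β := sub_eq_zero.1 e2.2
  have e6 := sub_eq_zero.1 e2.1
  rw [e5, ← e4, e3] at e6
  have e7 := congrArg MulOpposite.unop e6
  simp only [MulOpposite.unop_mul, MulOpposite.unop_op] at e7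
  rw [hK] at e7
  exact mul_left_cancel₀ (fun h => hα (MulOpposite.unop_injective h)) e7

/-- Four pairwise distinct lines in a plane have a cross-ratio. -/
theorem exists_isCrossRatio (L : Fin 4 → Submodule Kᵐᵒᵖ V) (hL : Function.Injective L)
    (hL1 : ∀ i, Module.finrank Kᵐᵒᵖ (L i) = 1) (P : Submodule Kᵐᵒᵖ V)
    (hP : Module.finrank Kᵐᵒᵖ P = 2) (hLP : ∀ i, L i ≤ P) : ∃ c : K, IsCrossRatio L c := by
  have hspan : ∀ i, ∀ v ∈ L i, v ≠ 0 → L i = Submodule.span Kᵐᵒᵖ {v} := by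
    intro i v hv hv0
    have : FiniteDimensional Kᵐᵒᵖ (L i) := .of_finrank_pos (by rw [hL1 i]; norm_num)
    symm
    apply Submodule.eq_of_le_of_finrank_eq
    · simpa using hv
    · rw [finrank_span_singleton hv0, hL1 i]
  have hex : ∀ i, ∃ v ∈ L i, v ≠ 0 := by
    intro i
    apply Submodule.exists_mem_ne_zero_of_ne_bot
    intro h
    have := hL1 i
    rw [h, finrank_bot] at this
    exact zero_ne_one this
  obtain ⟨u₀, hu, hu0⟩ := hex 0
  obtain ⟨w₀, hw, hw0⟩ := hex 1
  have hind : LinearIndependent Kᵐᵒᵖ ![u₀, w₀] := by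
    rw [LinearIndependent.pair_iff' hu0]
    intro a ha
    apply absurd (hL (a₁ := 0) (a₂ := 1) _) (by decide)
    rw [hspan 1 w₀ hw hw0]
    refine hspan 0 w₀ ?_ hw0
    rw [← ha]
    exact (L 0).smul_mem a hu
  have : FiniteDimensional Kᵐᵒᵖ P := .of_finrank_pos (by rw [hP]; norm_num)
  have hPs : Submodule.span Kᵐᵒᵖ {u₀, w₀} = P := by
    apply Submodule.eq_of_le_of_finrank_eq
    · rw [Submodule.span_le]
      rintro x (rfl | rfl)
      exacts [hLP 0 hu, hLP 1 hw]
    · have h := finrank_span_eq_card hind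
      rw [Matrix.range_cons_cons_empty, Fintype.card_fin] at h
      rw [h, hP]
  have hcoef : ∀ i, i ≠ 0 → ∀ v ∈ L i, v ≠ 0 →
      ∃ a b : Kᵐᵒᵖ, b ≠ 0 ∧ a • u₀ + b • w₀ = v := by
    intro i hi v hv hv0
    have hvP := hLP i hv
    rw [← hPs, Submodule.mem_span_pair] at hvP
    obtain ⟨a, b, hab⟩ := hvP
    refine ⟨a, b, ?_, hab⟩
    rintro rfl
    rw [zero_smul, add_zero] at hab
    apply hi
    apply hL
    rw [hspan i v hv hv0]
    refine (hspan 0 v ?_ hv0).symm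
    rw [← hab]
    exact (L 0).smul_mem a hu
  obtain ⟨x, hx, hx0⟩ := hex 2
  obtain ⟨a, b, hb, hab⟩ := hcoef 2 (by decide) x hx hx0
  obtain ⟨y, hy, hy0⟩ := hex 3
  obtain ⟨a', b', hb', hab'⟩ := hcoef 3 (by decide) y hy hy0
  have ha : a ≠ 0 := by
    rintro rfl
    rw [zero_smul, zero_add] at hab
    apply absurd (hL (a₁ := 2) (a₂ := 1) _) (by decide)
    rw [hspan 2 x hx hx0]
    refine (hspan 1 x ?_ hx0).symm
    rw [← hab]
    exact (L 1).smul_mem b hw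
  have hu1 : a • u₀ ≠ 0 := smul_ne_zero ha hu0
  have hw1 : b • w₀ ≠ 0 := smul_ne_zero hb hw0
  refine ⟨(b * b'⁻¹ * a' * a⁻¹).unop, a • u₀, b • w₀, ?_, ?_, ?_, ?_, ?_⟩
  · rw [LinearIndependent.pair_iff] at hind ⊢
    intro s t hst
    rw [smul_smul, smul_smul] at hst
    have h := hind _ _ hst
    exact ⟨(mul_eq_zero.1 h.1).resolve_right ha, (mul_eq_zero.1 h.2).resolve_right hb⟩
  · exact hspan 0 _ ((L 0).smul_mem a hu) hu1
  · exact hspan 1 _ ((L 1).smul_mem b hw) hw1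
  · rw [hab]
    exact hspan 2 x hx hx0
  · have hz : MulOpposite.op (b * b'⁻¹ * a' * a⁻¹).unop • a • u₀ + b • w₀ = (b * b'⁻¹) • y := by
      rw [MulOpposite.op_unop, ← hab', smul_add, smul_smul, smul_smul, smul_smul,
        mul_assoc _ a⁻¹ a, inv_mul_cancel₀ ha, mul_one, mul_assoc b b'⁻¹ b',
        inv_mul_cancel₀ hb', mul_one]
    rw [hz]
    exact hspan 3 _ ((L 3).smul_mem _ hy)
      (smul_ne_zero (mul_ne_zero hb (inv_ne_zero hb')) hy0)

open Classical in
/-- The cross-ratio of four lines (in a plane, pairwise distinct, with `K` commutative). -/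
def crossRatio (L : Fin 4 → Submodule Kᵐᵒᵖ V) : K :=
  if h : ∃ c, IsCrossRatio L c then h.choose else 0

end Form

end ClassicalC2

end

/-! # Limits of marked apartments in classical buildings of type `C₂`

A type-preserving simplicial map from the apartment to the building is the same as a closed gallery
`L₀ ⊂ P₀ ⊃ L₁ ⊂ P₁ ⊃ L₂ ⊂ P₂ ⊃ L₃ ⊂ P₃ ⊃ L₀` of isotropic lines and planes (`Config`, `IsWalk`,
`Mor.mem_closure_iff`), and the marked apartments are the galleries without repetitions. These are
given by isotropic vectors `a₀, a₁, a₂, a₃` with consecutive ones orthogonal and with `q a₀ a₂ ≠ 0`,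
`q a₁ a₃ ≠ 0` (`IsMarked`). Everything is decided by explicit families of such vectors and by
relations between them that survive in the limit. The product of the vector `v` by the scalar `x` is
written `v <• x`.

*Limits by curves.* To show that a gallery is a limit, one writes down isotropic vectors that are
polynomials in a small central scalar `t` fixed by `σ`, form a marked apartment for `t ≠ 0`, and whose
lines and planes tend to the given ones (`mem_closure_of_four_curves`). In Witt index two, the building
has no triangles and no digons, so a gallery that is neither an apartment nor a quadripod has equal
opposite lines or planes. After a perturbation it is one of a few degenerate shapes, each of which is
unfolded by a curve that leaves the span of a frame in the direction of an anisotropic vector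
(`IsAmbient.mem_closure_of_not_star`).

*Line-type quadripods.* Normalise the generators `a i` of the lines of an apartment near the central
line by `q b (a i) = 1`. The differences `u i = a (i + 1) - a i` lie in the planes, their sum is `0`, and
`q u₁ u₂ = q u₀ u₃`. This is a projective condition on the coefficients of the `u i`, so by local
compactness it persists in the limit (`IsAmbient.isSymmetricStar_of_mem_closure`), and the geometry of
planes through a line shows that no coefficient vanishes (`IsWalk.isSymmetricStar_of_relation`).
Conversely a closed polygon `v₀ + v₁ + v₂ + v₃ = 0` with the quadratic relation integrates to a curve of
apartments (`IsAmbient.mem_closure_of_isSymmetricStar`). For commutative `K`, an involution exchanging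
opposite planes turns a linear relation into a symmetric polygon, and a symmetric polygon consists of
vectors that are exchanged by the conjugation of a basis in which `q` has coefficients fixed by `σ`
(`exists_spanning_fixed`, `exists_conjugation`), or by the opposite of a reflection if `σ = id`.

*Plane-type quadripods.* A frame can be adapted to the central plane without changing the values of
`q` on its orthogonal complement (`Frame.exists_adapted`). A star with cross-ratio `c` is a limit of
apartments if a system of equations in the frame and its complement can be solved
(`IsAmbient.mem_closure_of_equations`). If `σ` is not trivial, it can be solved because there are enough
scalars with `σ y = -y` (`IsClassicalPair.exists_skew`); if `σ = id`, it amounts to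
`1 - c = q v v / q v' v'`. In that case two vectors of the complement computed from an apartment have
values whose ratio tends to `1 - c`, and squares are a neighbourhood of `1`
(`IsAmbient.exists_ratio_of_mem_closure`).

In dimension `5` with `σ = id`, the planes through a line lie in a space of dimension `4`, which makes
every star of planes symmetric, and the complement of a frame is a line, on which the ratios of values
of `q` are the squares. -/

noncomputable section

namespace ClassicalC2

open scoped RightActions Topology
open Module Filter

/-! ### Hermitian forms of Witt index two -/

namespace AntiInvolution

variable {K : Type*} [DivisionRing K] (σ : AntiInvolution K)

@[simp] theorem map_add (x y : K) : σ (x + y) = σ x + σ y := σ.map_add' x y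

@[simp] theorem map_mul (x y : K) : σ (x * y) = σ y * σ x := σ.map_mul' x y

@[simp] theorem involutive (x : K) : σ (σ x) = x := σ.involutive' x

@[simp] theorem map_zero : σ 0 = 0 := by simpa using σ.map_add' 0 0

@[simp] theorem map_one : σ 1 = 1 := by
  have hmul := σ.map_mul' (σ 1) 1
  rw [mul_one, σ.involutive'] at hmul
  simpa using hmul.symm

@[simp] theorem map_neg (x : K) : σ (-x) = -σ x := by
  have := σ.map_add' x (-x)
  rw [add_neg_cancel] at this
  exact (neg_eq_of_add_eq_zero_right (this.symm.trans σ.map_zero)).symm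

@[simp] theorem map_sub (x y : K) : σ (x - y) = σ x - σ y := by
  rw [sub_eq_add_neg, map_add, map_neg, sub_eq_add_neg]

@[simp] theorem map_eq_zero {x : K} : σ x = 0 ↔ x = 0 :=
  ⟨fun h => by rw [← σ.involutive x, h, map_zero], fun h => by rw [h, map_zero]⟩

@[simp] theorem map_inv (x : K) : σ x⁻¹ = (σ x)⁻¹ := by
  by_cases hx : x = 0
  · simp [hx]
  · apply eq_inv_of_mul_eq_one_left
    rw [← map_mul, mul_inv_cancel₀ hx, map_one]

@[simp] theorem map_two : σ 2 = 2 := by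
  rw [← one_add_one_eq_two, map_add, map_one]

/-- If `σ` is the identity, then it is both an automorphism and an antiautomorphism, so `K` is
commutative. -/
theorem IsTrivial.mul_comm {σ : AntiInvolution K} (h : σ.IsTrivial) (x y : K) :
    x * y = y * x := by
  rw [← h (x * y), σ.map_mul, h, h]

end AntiInvolution

section Form

variable {K : Type*} [DivisionRing K] {σ : AntiInvolution K}
  {V : Type*} [AddCommGroup V] [Module Kᵐᵒᵖ V]

namespace HermitianForm

variable (q : HermitianForm σ V)

@[simp] theorem map_zero_left (w : V) : q 0 w = 0 := q.zero_left w

@[simp] theorem map_add_left (v v' w : V) : q (v + v') w = q v w + q v' w := q.add_left v v' w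

@[simp] theorem map_add_right (v w w' : V) : q v (w + w') = q v w + q v w' := q.add_right v w w'

@[simp] theorem map_smul_right (v w : V) (c : Kᵐᵒᵖ) : q v (c • w) = q v w * c.unop :=
  q.smul_right v w c.unop

@[simp] theorem map_smul_left (v w : V) (c : Kᵐᵒᵖ) : q (c • v) w = σ c.unop * q v w :=
  q.smul_left v w c.unop

@[simp] theorem map_zero_right (w : V) : q w 0 = 0 := q.swap_eq_zero (q.zero_left w)

@[simp] theorem map_neg_left (v w : V) : q (-v) w = -q v w := by
  rw [eq_neg_iff_add_eq_zero, ← q.add_left, neg_add_cancel, map_zero_left]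

@[simp] theorem map_neg_right (v w : V) : q v (-w) = -q v w := by
  rw [eq_neg_iff_add_eq_zero, ← q.add_right, neg_add_cancel, map_zero_right]

@[simp] theorem map_sub_left (v v' w : V) : q (v - v') w = q v w - q v' w := by
  rw [sub_eq_add_neg, map_add_left, map_neg_left, sub_eq_add_neg]

@[simp] theorem map_sub_right (v w w' : V) : q v (w - w') = q v w - q v w' := by
  rw [sub_eq_add_neg, map_add_right, map_neg_right, sub_eq_add_neg]

theorem map_self (v : V) : σ (q v v) = q v v := (q.hermitian v v).symm

/-- The linear form `v ↦ q w v`. -/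
@[simps] def toLinear (w : V) : V →ₗ[Kᵐᵒᵖ] K where
  toFun v := q w v
  map_add' := q.add_right w
  map_smul' c v := by
    rw [← MulOpposite.op_unop c]
    exact q.smul_right w v c.unop

theorem isTotallyIsotropic_span_pair {v w : V} (hv : q v v = 0) (hw : q w w = 0)
    (hvw : q v w = 0) : q.IsTotallyIsotropic (Submodule.span Kᵐᵒᵖ {v, w}) :=
  q.isTotallyIsotropic_span (by simp [hv, hw, hvw, q.swap_eq_zero hvw])

/-- The functional `q v` vanishes on a span as soon as it vanishes on the generators. -/
theorem eq_zero_of_mem_span {s : Set V} {v w : V} (h : ∀ x ∈ s, q v x = 0)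
    (hw : w ∈ Submodule.span Kᵐᵒᵖ s) : q v w = 0 := by
  have : Submodule.span Kᵐᵒᵖ s ≤ LinearMap.ker (q.toLinear v) :=
    Submodule.span_le.2 fun x hx => by simpa using h x hx
  simpa using this hw

variable {q}

/-- In Witt index `2`, a totally isotropic plane contains every isotropic vector orthogonal to
it. -/
theorem HasWittIndexTwo.mem_of_isotropic [FiniteDimensional Kᵐᵒᵖ V] (hW : q.HasWittIndexTwo)
    {P : Submodule Kᵐᵒᵖ V} (hP : q.IsTotallyIsotropic P) (h2 : finrank Kᵐᵒᵖ P = 2) {v : V}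
    (hv : q v v = 0) (hvP : ∀ w ∈ P, q w v = 0) : v ∈ P := by
  have hM : q.IsTotallyIsotropic (P ⊔ Submodule.span Kᵐᵒᵖ {v}) := by
    have : P ⊔ Submodule.span Kᵐᵒᵖ {v} = Submodule.span Kᵐᵒᵖ ((P : Set V) ∪ {v}) := by
      rw [Submodule.span_union, Submodule.span_eq]
    rw [this]
    apply q.isTotallyIsotropic_span
    rintro x (hx | rfl) y (hy | rfl)
    exacts [hP x hx y hy, hvP x hx, q.swap_eq_zero (hvP y hy), hv]
  obtain ⟨M, ⟨hMi, hle⟩, hmax⟩ := (wellFounded_gt (α := Submodule Kᵐᵒᵖ V)).has_min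
    {M | q.IsTotallyIsotropic M ∧ P ⊔ Submodule.span Kᵐᵒᵖ {v} ≤ M} ⟨_, hM, le_rfl⟩
  have hMmax : Maximal q.IsTotallyIsotropic M := by
    refine ⟨hMi, fun N hN hMN => ?_⟩
    by_contra hlt
    exact hmax N ⟨hN, hle.trans hMN⟩ (lt_of_le_not_ge hMN hlt)
  have hPM : P = M :=
    Submodule.eq_of_le_of_finrank_eq (le_sup_left.trans hle) (h2.trans (hW M hMmax).symm)
  rw [hPM]
  exact hle (Submodule.mem_sup_right (Submodule.mem_span_singleton_self v))

end HermitianForm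

theorem mem_span_singleton_iff {v w : V} :
    v ∈ Submodule.span Kᵐᵒᵖ {w} ↔ ∃ x : K, w <• x = v := by
  rw [Submodule.mem_span_singleton]
  exact ⟨fun ⟨a, h⟩ => ⟨a.unop, by simpa using h⟩, fun ⟨x, h⟩ => ⟨MulOpposite.op x, h⟩⟩

theorem mem_span_pair_iff {v u w : V} :
    v ∈ Submodule.span Kᵐᵒᵖ {u, w} ↔ ∃ x y : K, u <• x + w <• y = v := by
  rw [Submodule.mem_span_pair]
  exact ⟨fun ⟨a, b, h⟩ => ⟨a.unop, b.unop, by simpa using h⟩,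
    fun ⟨x, y, h⟩ => ⟨MulOpposite.op x, MulOpposite.op y, h⟩⟩

theorem smul_inv_cancel_right {x : K} (hx : x ≠ 0) (v : V) : (v <• x) <• x⁻¹ = v := by
  rw [op_smul_op_smul, mul_inv_cancel₀ hx, MulOpposite.op_one, one_smul]

theorem op_smul_ne_zero {x : K} {v : V} (hx : x ≠ 0) (hv : v ≠ 0) : v <• x ≠ 0 :=
  smul_ne_zero (by simpa using hx) hv

theorem span_singleton_smul {x : K} (hx : x ≠ 0) (v : V) :
    Submodule.span Kᵐᵒᵖ {v <• x} = Submodule.span Kᵐᵒᵖ {v} :=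
  Submodule.span_singleton_smul_eq (by simpa using hx) v

theorem finrank_span_pair {v w : V} (hv : v ≠ 0) (hw : w ∉ Submodule.span Kᵐᵒᵖ {v}) :
    finrank Kᵐᵒᵖ (Submodule.span Kᵐᵒᵖ {v, w}) = 2 := by
  have hind : LinearIndependent Kᵐᵒᵖ ![v, w] := by
    rw [LinearIndependent.pair_iff' hv]
    exact fun a ha => hw (Submodule.mem_span_singleton.2 ⟨a, ha⟩)
  have h := finrank_span_eq_card hind
  rwa [Matrix.range_cons_cons_empty, Fintype.card_fin] at h

/-- A plane is spanned by any nonzero vector `v` and any other vector that is not a multiple of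
`v`. -/
theorem eq_span_pair {P : Submodule Kᵐᵒᵖ V} (h2 : finrank Kᵐᵒᵖ P = 2) {v w : V} (hv : v ∈ P)
    (hw : w ∈ P) (hv0 : v ≠ 0) (hwv : w ∉ Submodule.span Kᵐᵒᵖ {v}) :
    P = Submodule.span Kᵐᵒᵖ {v, w} := by
  have : FiniteDimensional Kᵐᵒᵖ P := .of_finrank_pos (by rw [h2]; norm_num)
  refine (Submodule.eq_of_le_of_finrank_eq ?_ ?_).symm
  · rw [Submodule.span_le]
    rintro x (rfl | rfl)
    exacts [hv, hw]
  · rw [finrank_span_pair hv0 hwv, h2]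

theorem eq_span_singleton {L : Submodule Kᵐᵒᵖ V} (h1 : finrank Kᵐᵒᵖ L = 1) {v : V} (hv : v ∈ L)
    (hv0 : v ≠ 0) : L = Submodule.span Kᵐᵒᵖ {v} := by
  have : FiniteDimensional Kᵐᵒᵖ L := .of_finrank_pos (by rw [h1]; norm_num)
  refine (Submodule.eq_of_le_of_finrank_eq ?_ ?_).symm
  · simpa using hv
  · rw [finrank_span_singleton hv0, h1]

theorem span_singleton_eq_of_mem {v w : V} (h : w ∈ Submodule.span Kᵐᵒᵖ {v}) (hw : w ≠ 0) :
    Submodule.span Kᵐᵒᵖ {v} = Submodule.span Kᵐᵒᵖ {w} := by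
  obtain ⟨x, rfl⟩ := mem_span_singleton_iff.1 h
  rw [span_singleton_smul]
  rintro rfl
  simp at hw

theorem exists_eq_span_singleton {L : Submodule Kᵐᵒᵖ V} (h1 : finrank Kᵐᵒᵖ L = 1) :
    ∃ v, v ≠ 0 ∧ L = Submodule.span Kᵐᵒᵖ {v} := by
  obtain ⟨v, hv, hv0⟩ := L.exists_mem_ne_zero_of_ne_bot (by
    rintro rfl
    simp at h1)
  exact ⟨v, hv0, eq_span_singleton h1 hv hv0⟩

/-- In a plane there is a vector outside any given line. -/
theorem exists_mem_notMem {L P : Submodule Kᵐᵒᵖ V} (h1 : finrank Kᵐᵒᵖ L = 1)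
    (h2 : finrank Kᵐᵒᵖ P = 2) : ∃ v ∈ P, v ∉ L := by
  by_contra! h
  have : FiniteDimensional Kᵐᵒᵖ L := .of_finrank_pos (by rw [h1]; norm_num)
  have := Submodule.finrank_mono (show P ≤ L from h)
  omega

namespace HermitianForm

variable {q : HermitianForm σ V}

theorem Nondegenerate.exists_eq_one (hq : q.Nondegenerate) {v : V} (hv : v ≠ 0) :
    ∃ w, q v w = 1 := by
  by_contra h
  rw [not_exists] at h
  refine hv (hq v fun w => ?_)
  by_contra hw
  exact h (w <• (q v w)⁻¹) (by rw [map_smul_right, MulOpposite.unop_op, mul_inv_cancel₀ hw])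

/-- Subtracting half of `q v v` makes a vector isotropic. -/
theorem isotropic_sub_half (h2 : (2 : K) ≠ 0) {a w : V} (ha : q a a = 0) (haw : q a w = 1) :
    q (w - a <• (2⁻¹ * q w w)) (w - a <• (2⁻¹ * q w w)) = 0 := by
  have hwa : q w a = 1 := by rw [q.hermitian a w, haw, σ.map_one]
  have hc : q w w * 2⁻¹ = 2⁻¹ * q w w := ((Commute.ofNat_right _ 2).inv_right₀).eq
  have h2' : (2⁻¹ : K) * q w w + 2⁻¹ * q w w = q w w := by
    rw [← two_mul, mul_inv_cancel_left₀ h2]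
  simp only [map_sub_left, map_sub_right, map_smul_left, map_smul_right, ha, haw, hwa, MulOpposite.unop_op,
    AntiInvolution.map_mul, AntiInvolution.map_inv, AntiInvolution.map_two, q.map_self, hc]
  simp only [mul_zero, mul_one, one_mul, sub_zero]
  nth_rewrite 1 [← h2']
  abel

/-- An isotropic vector belongs to a hyperbolic pair. -/
theorem Nondegenerate.exists_partner (hq : q.Nondegenerate) (h2 : (2 : K) ≠ 0) {a : V}
    (ha0 : a ≠ 0) (ha : q a a = 0) : ∃ b, q b b = 0 ∧ q a b = 1 := by
  obtain ⟨w, hw⟩ := hq.exists_eq_one ha0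
  exact ⟨_, isotropic_sub_half h2 ha hw, by simp [ha, hw]⟩

/-- A hyperbolic pair `(e₁, e₃)` and an isotropic vector `e₀` orthogonal to it lie in a frame. -/
theorem Nondegenerate.exists_fourth (hq : q.Nondegenerate) (h2 : (2 : K) ≠ 0) {e₀ e₁ e₃ : V}
    (h0 : e₀ ≠ 0) (h00 : q e₀ e₀ = 0) (h01 : q e₀ e₁ = 0) (h03 : q e₀ e₃ = 0) (h11 : q e₁ e₁ = 0)
    (h33 : q e₃ e₃ = 0) (h13 : q e₁ e₃ = 1) :
    ∃ e₂, q e₂ e₂ = 0 ∧ q e₀ e₂ = 1 ∧ q e₁ e₂ = 0 ∧ q e₃ e₂ = 0 := by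
  obtain ⟨w, hw⟩ := hq.exists_eq_one h0
  have h31 : q e₃ e₁ = 1 := by rw [q.hermitian e₁ e₃, h13, σ.map_one]
  have h10 := q.swap_eq_zero h01
  have h30 := q.swap_eq_zero h03
  have key : q e₀ (w - e₁ <• q e₃ w - e₃ <• q e₁ w) = 1 := by simp [hw, h01, h03]
  exact ⟨_, isotropic_sub_half h2 h00 key, by simp [hw, h01, h03, h00], by simp [h11, h13, h10],
    by simp [h33, h31, h30]⟩

/-- A basis `(e₀, e₁)` of a totally isotropic plane extends to a frame. -/
theorem Nondegenerate.exists_third (hq : q.Nondegenerate) (h2 : (2 : K) ≠ 0) {e₀ e₁ : V}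
    (h0 : e₀ ≠ 0) (hi : e₁ ∉ Submodule.span Kᵐᵒᵖ {e₀}) (h00 : q e₀ e₀ = 0) (h01 : q e₀ e₁ = 0)
    (h11 : q e₁ e₁ = 0) : ∃ e₃, q e₃ e₃ = 0 ∧ q e₀ e₃ = 0 ∧ q e₁ e₃ = 1 := by
  obtain ⟨b, hb, hab⟩ := hq.exists_partner h2 h0 h00
  have hba : q b e₀ = 1 := by rw [q.hermitian e₀ b, hab, σ.map_one]
  have hne : e₁ - e₀ <• q b e₁ ≠ 0 := fun h =>
    hi (mem_span_singleton_iff.2 ⟨_, (sub_eq_zero.1 h).symm⟩)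
  obtain ⟨w, hw⟩ := hq.exists_eq_one hne
  have h10 := q.swap_eq_zero h01
  have hw' : q e₁ (w - b <• q e₀ w) = 1 := by
    rw [← hw]
    simp only [map_sub_right, map_smul_right, map_sub_left, map_smul_left,
      MulOpposite.unop_op]
    rw [q.hermitian e₁ b, σ.involutive]
  exact ⟨_, isotropic_sub_half h2 h11 hw', by simp [hab, h01], by simp [h11, hw']⟩

end HermitianForm

namespace Frame

variable {q : HermitianForm σ V}

/-- The frame made of four vectors with the right pairings. -/
def mk' {e₀ e₁ e₂ e₃ : V} (h00 : q e₀ e₀ = 0) (h11 : q e₁ e₁ = 0) (h22 : q e₂ e₂ = 0)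
    (h33 : q e₃ e₃ = 0) (h01 : q e₀ e₁ = 0) (h03 : q e₀ e₃ = 0) (h12 : q e₁ e₂ = 0)
    (h32 : q e₃ e₂ = 0) (h02 : q e₀ e₂ = 1) (h13 : q e₁ e₃ = 1) : Frame q where
  e := ![e₀, e₁, e₂, e₃]
  isotropic i := by fin_cases i <;> assumption
  orthogonal i := by
    fin_cases i
    exacts [h01, h12, q.swap_eq_zero h32, q.swap_eq_zero h03]
  pairing_zero_two := h02
  pairing_one_three := h13

variable (E : Frame q)

theorem pairing (i : Fin 4) : q (E.e i) (E.e (i + 2)) = 1 := by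
  fin_cases i
  · exact E.pairing_zero_two
  · exact E.pairing_one_three
  · exact (q.hermitian _ _).trans ((congrArg σ E.pairing_zero_two).trans σ.map_one)
  · exact (q.hermitian _ _).trans ((congrArg σ E.pairing_one_three).trans σ.map_one)

theorem gram (i j : Fin 4) : q (E.e i) (E.e j) = if j = i + 2 then 1 else 0 := by
  have h : j = i ∨ j = i + 1 ∨ j = i + 2 ∨ i = j + 1 := by
    revert i j
    decide
  rcases h with rfl | rfl | rfl | rfl
  · simpa using E.isotropic j
  · simpa using E.orthogonal i
  · simpa using E.pairing i
  · rw [q.swap_eq_zero (E.orthogonal j), if_neg]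
    revert j
    decide

/-- The orthogonal projection to the orthogonal complement of the frame. -/
def proj (v : V) : V := v - ∑ i, E.e i <• q (E.e (i + 2)) v

theorem proj_mem (v : V) : E.proj v ∈ E.perp := by
  intro i
  fin_cases i <;> simp [proj, Fin.sum_univ_four, E.gram]

theorem proj_eq_zero_of_forall_perp (h : ∀ v ∈ E.perp, v = 0) :
    (⊤ : Submodule Kᵐᵒᵖ V) = Submodule.span Kᵐᵒᵖ (Set.range E.e) := by
  symm
  rw [eq_top_iff]
  intro v _
  have := h _ (E.proj_mem v)
  rw [proj, sub_eq_zero] at this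
  rw [this]
  exact Submodule.sum_mem _ fun i _ =>
    Submodule.smul_mem _ _ (Submodule.subset_span (Set.mem_range_self i))

/-- In dimension at least `5` a frame does not span. -/
theorem exists_perp_ne_zero (hV : 5 ≤ finrank Kᵐᵒᵖ V) : ∃ v ∈ E.perp, v ≠ 0 := by
  by_contra! h
  have h1 := E.proj_eq_zero_of_forall_perp h
  have h2 := finrank_range_le_card (R := Kᵐᵒᵖ) E.e
  rw [Set.finrank, ← h1, finrank_top, Fintype.card_fin] at h2
  omega

theorem e_one_notMem : E.e 1 ∉ Submodule.span Kᵐᵒᵖ {E.e 0} := by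
  intro h
  obtain ⟨x, hx⟩ := mem_span_singleton_iff.1 h
  have := E.pairing_one_three
  rw [← hx] at this
  simp [E.gram] at this

/-- In Witt index `2`, the orthogonal complement of a frame is anisotropic. -/
theorem perp_anisotropic [FiniteDimensional Kᵐᵒᵖ V] (hW : q.HasWittIndexTwo) {v : V}
    (hv : v ∈ E.perp) (h : q v v = 0) : v = 0 := by
  have h2 := finrank_span_pair (E.e_ne_zero 0) E.e_one_notMem
  have hP := q.isTotallyIsotropic_span_pair (E.isotropic 0) (E.isotropic 1) (E.orthogonal 0)
  have hmem : v ∈ Submodule.span Kᵐᵒᵖ {E.e 0, E.e 1} := by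
    refine hW.mem_of_isotropic hP h2 h fun w hw => q.swap_eq_zero ?_
    refine q.eq_zero_of_mem_span ?_ hw
    rintro x (rfl | rfl)
    exacts [q.swap_eq_zero (hv 0), q.swap_eq_zero (hv 1)]
  obtain ⟨x, y, rfl⟩ := mem_span_pair_iff.1 hmem
  have hx := hv 2
  have hy := hv 3
  simp [E.gram] at hx hy
  simp [hx, hy]

end Frame

end Form

section Form

variable {K : Type*} [DivisionRing K] {σ : AntiInvolution K}
  {V : Type*} [AddCommGroup V] [Module Kᵐᵒᵖ V]

/-! ### The space of closed galleries -/

variable (K V) in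
/-- Families of four lines and four planes. The `8`-periodic sequence of vertices is
`L 0, P 0, L 1, P 1, L 2, P 2, L 3, P 3`. -/
abbrev Config : Type _ := (Fin 4 → Gr K V 1) × (Fin 4 → Gr K V 2)

/-- The configuration is a closed gallery of the building, i.e. the image of a morphism. -/
structure IsWalk (q : HermitianForm σ V) (x : Config K V) : Prop where
  isotropic : ∀ i, q.IsTotallyIsotropic (x.2 i).1
  le : ∀ i, (x.1 i).1 ≤ (x.2 i).1
  succ_le : ∀ i, (x.1 (i + 1)).1 ≤ (x.2 i).1

/-- The closed galleries without repetition: the images of the marked apartments. -/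
def apartments (q : HermitianForm σ V) : Set (Config K V) :=
  {x | IsWalk q x ∧ Function.Injective x.1 ∧ Function.Injective x.2}

namespace Frame

variable {q : HermitianForm σ V} (E : Frame q)

theorem finrank_line (i : Fin 4) : finrank Kᵐᵒᵖ (E.line i).1.1 = 1 :=
  finrank_span_singleton (E.e_ne_zero i)

theorem e_mem_plane (i : Fin 4) : E.e i ∈ (E.plane i).1.1 :=
  Submodule.subset_span (by simp)

theorem e_succ_mem_plane (i : Fin 4) : E.e (i + 1) ∈ (E.plane i).1.1 :=
  Submodule.subset_span (by simp)

theorem line_le_iff {i : Fin 4} {W : Submodule Kᵐᵒᵖ V} : (E.line i).1.1 ≤ W ↔ E.e i ∈ W :=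
  Submodule.span_singleton_le_iff_mem _ _

/-- A totally isotropic subspace does not contain opposite vectors of a frame. -/
theorem notMem_of_mem {W : Submodule Kᵐᵒᵖ V} (hW : q.IsTotallyIsotropic W) {i j : Fin 4}
    (hi : E.e i ∈ W) (hj : j = i + 2) : E.e j ∉ W := fun h => by
  have := hW _ hi _ h
  rw [hj, E.pairing] at this
  exact one_ne_zero this

theorem finrank_plane (i : Fin 4) : finrank Kᵐᵒᵖ (E.plane i).1.1 = 2 := by
  refine finrank_span_pair (E.e_ne_zero i) fun h => ?_
  obtain ⟨x, hx⟩ := mem_span_singleton_iff.1 h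
  have := E.pairing (i + 1)
  rw [← hx] at this
  simp only [HermitianForm.map_smul_left, E.gram] at this
  rw [if_neg, mul_zero] at this
  · exact zero_ne_one this
  · clear * -
    revert i
    decide

theorem line_le_plane_iff {i j : Fin 4} :
    (E.line i).1.1 ≤ (E.plane j).1.1 ↔ i = j ∨ i = j + 1 := by
  constructor
  · intro h
    have hi := E.line_le_iff.1 h
    have hij : i = j ∨ i = j + 1 ∨ i = j + 2 ∨ i = j + 1 + 2 := by
      clear * -
      revert i j
      decide
    rcases hij with h | h | h | h
    · exact Or.inl h
    · exact Or.inr h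
    · exact absurd hi (E.notMem_of_mem (E.plane j).1.2.2 (E.e_mem_plane j) h)
    · exact absurd hi (E.notMem_of_mem (E.plane j).1.2.2 (E.e_succ_mem_plane j) h)
  · rintro (rfl | rfl)
    exacts [E.line_le_iff.2 (E.e_mem_plane _), E.line_le_iff.2 (E.e_succ_mem_plane _)]

theorem line_injective : Function.Injective fun i => (E.line i).1.1 := by
  intro i j h
  have h1 : (E.line i).1.1 ≤ (E.plane j).1.1 := by
    rw [show (E.line i).1.1 = (E.line j).1.1 from h]
    exact E.line_le_plane_iff.2 (Or.inl rfl)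
  have h2 : (E.line i).1.1 ≤ (E.plane (j - 1)).1.1 := by
    rw [show (E.line i).1.1 = (E.line j).1.1 from h]
    exact E.line_le_plane_iff.2 (Or.inr (by simp))
  have h3 := E.line_le_plane_iff.1 h1
  have h4 := E.line_le_plane_iff.1 h2
  clear h h1 h2
  revert i j
  decide

theorem plane_injective : Function.Injective fun i => (E.plane i).1.1 := by
  intro i j h
  have h1 : (E.line i).1.1 ≤ (E.plane j).1.1 := by
    rw [← show (E.plane i).1.1 = (E.plane j).1.1 from h]
    exact E.line_le_plane_iff.2 (Or.inl rfl)
  have h2 : (E.line (i + 1)).1.1 ≤ (E.plane j).1.1 := by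
    rw [← show (E.plane i).1.1 = (E.plane j).1.1 from h]
    exact E.line_le_plane_iff.2 (Or.inr rfl)
  have h3 := E.line_le_plane_iff.1 h1
  have h4 := E.line_le_plane_iff.1 h2
  clear h h1 h2
  revert i j
  decide

/-- The chamber `⟨e i⟩ ⊂ ⟨e i, e (i + 1)⟩`. -/
def chamber (i : Fin 4) : E.Chamber :=
  ⟨E.line i, E.plane i, E.finrank_line i, E.finrank_plane i,
    E.line_le_plane_iff.2 (Or.inl rfl)⟩

theorem vertex_cases (y : E.apartment) : (∃ i, y = E.line i) ∨ ∃ i, y = E.plane i := by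
  obtain ⟨y, ⟨i, rfl⟩ | ⟨i, rfl⟩⟩ := y
  exacts [Or.inl ⟨i, rfl⟩, Or.inr ⟨i, rfl⟩]

theorem line_ne_plane (i j : Fin 4) : E.line i ≠ E.plane j := fun h => by
  have := E.finrank_line i
  rw [h, E.finrank_plane] at this
  omega

theorem Chamber.exists_line (C : E.Chamber) : ∃ i, C.line = E.line i := by
  refine (E.vertex_cases C.line).resolve_right ?_
  rintro ⟨i, hi⟩
  have := C.finrank_line
  rw [hi, E.finrank_plane] at this
  omega

theorem Chamber.exists_plane (C : E.Chamber) : ∃ i, C.plane = E.plane i := by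
  refine (E.vertex_cases C.plane).resolve_left ?_
  rintro ⟨i, hi⟩
  have := C.finrank_plane
  rw [hi, E.finrank_line] at this
  omega

end Frame

namespace Mor

variable {q : HermitianForm σ V} {E : Frame q}

/-- The images of the vertices of the apartment, in cyclic order. -/
def config (f : Mor E) : Config K V :=
  (fun i => ⟨f.line i, (f.finrank_eq _).trans (E.finrank_line i)⟩,
    fun i => ⟨f.plane i, (f.finrank_eq _).trans (E.finrank_plane i)⟩)

theorem isWalk_config (f : Mor E) : IsWalk q f.config where
  isotropic i := (f.toFun (E.plane i)).2.2
  le _ := f.map_le _ _ (E.line_le_plane_iff.2 (Or.inl rfl))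
  succ_le _ := f.map_le _ _ (E.line_le_plane_iff.2 (Or.inr rfl))

theorem chamber_eq (f : Mor E) {C : E.Chamber} {i j : Fin 4} (hi : C.line = E.line i)
    (hj : C.plane = E.plane j) : f.chamber C = (f.config.1 i, f.config.2 j) := by
  obtain ⟨l, p, h1, h2, h3⟩ := C
  dsimp only at hi hj
  subst hi hj
  rfl

open Classical in
/-- Every closed gallery comes from a morphism. -/
theorem exists_config_eq {x : Config K V} (hx : IsWalk q x) : ∃ f : Mor E, f.config = x := by
  have hb : ∀ {k : ℕ} {W : Submodule Kᵐᵒᵖ V}, finrank Kᵐᵒᵖ W = k + 1 → W ≠ ⊥ := by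
    rintro k W h rfl
    simp at h
  let vl : Fin 4 → q.Vertex := fun i => ⟨(x.1 i).1, hb (x.1 i).2,
    fun v hv w hw => hx.isotropic i v (hx.le i hv) w (hx.le i hw)⟩
  let vp : Fin 4 → q.Vertex := fun i => ⟨(x.2 i).1, hb (x.2 i).2, hx.isotropic i⟩
  let φ : E.apartment → q.Vertex := fun y =>
    if h : ∃ i, y = E.line i then vl h.choose
    else if h : ∃ i, y = E.plane i then vp h.choose else vl 0
  have hl : ∀ i, φ (E.line i) = vl i := by
    intro i
    have h : ∃ j, E.line i = E.line j := ⟨i, rfl⟩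
    simp only [φ, dif_pos h]
    congr 1
    apply E.line_injective
    exact congrArg (fun y => y.1.1) h.choose_spec.symm
  have hp : ∀ i, φ (E.plane i) = vp i := by
    intro i
    have h0 : ¬ ∃ j, E.plane i = E.line j := fun ⟨j, hj⟩ => E.line_ne_plane j i hj.symm
    have h : ∃ j, E.plane i = E.plane j := ⟨i, rfl⟩
    simp only [φ, dif_pos h, dif_neg h0]
    congr 1
    apply E.plane_injective
    exact congrArg (fun y => y.1.1) h.choose_spec.symm
  have heq : ∀ {W W' : Submodule Kᵐᵒᵖ V} {k : ℕ}, W ≤ W' → finrank Kᵐᵒᵖ W = k + 1 →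
      finrank Kᵐᵒᵖ W' = k + 1 → W = W' := by
    intro W W' k h h1 h2
    have : FiniteDimensional Kᵐᵒᵖ W' := .of_finrank_pos (by rw [h2]; omega)
    exact Submodule.eq_of_le_of_finrank_eq h (h1.trans h2.symm)
  let f : Mor E :=
    { toFun := φ
      finrank_eq := by
        intro y
        rcases E.vertex_cases y with ⟨i, rfl⟩ | ⟨i, rfl⟩
        · rw [hl, E.finrank_line]
          exact (x.1 i).2
        · rw [hp, E.finrank_plane]
          exact (x.2 i).2
      map_le := by
        intro y z h
        rcases E.vertex_cases y with ⟨i, rfl⟩ | ⟨i, rfl⟩ <;>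
        rcases E.vertex_cases z with ⟨j, rfl⟩ | ⟨j, rfl⟩
        · obtain rfl := E.line_injective (heq h (E.finrank_line i) (E.finrank_line j))
          exact le_rfl
        · rw [hl, hp]
          rcases E.line_le_plane_iff.1 h with rfl | rfl
          exacts [hx.le _, hx.succ_le _]
        · have : FiniteDimensional Kᵐᵒᵖ (E.line j).1.1 :=
            .of_finrank_pos (by rw [E.finrank_line]; omega)
          have := Submodule.finrank_mono h
          rw [E.finrank_line, E.finrank_plane] at this
          omega
        · obtain rfl := E.plane_injective (heq h (E.finrank_plane i) (E.finrank_plane j))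
          exact le_rfl }
  refine ⟨f, Prod.ext (funext fun i => Subtype.ext ?_) (funext fun i => Subtype.ext ?_)⟩
  · exact congrArg (fun W : q.Vertex => W.1) (hl i)
  · exact congrArg (fun W : q.Vertex => W.1) (hp i)

theorem injective_iff (f : Mor E) : Function.Injective f.toFun ↔
    Function.Injective f.config.1 ∧ Function.Injective f.config.2 := by
  constructor
  · intro h
    refine ⟨fun i j hij => E.line_injective ?_, fun i j hij => E.plane_injective ?_⟩
    · have : f.line i = f.line j := congrArg (fun W : Gr K V 1 => W.1) hij
      exact congrArg (fun y => y.1.1) (h (Subtype.ext this))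
    · have : f.plane i = f.plane j := congrArg (fun W : Gr K V 2 => W.1) hij
      exact congrArg (fun y => y.1.1) (h (Subtype.ext this))
  · rintro ⟨h1, h2⟩ y z h
    have hr := (f.finrank_eq y).symm.trans
      ((congrArg (fun W : q.Vertex => finrank Kᵐᵒᵖ W.1) h).trans (f.finrank_eq z))
    rcases E.vertex_cases y with ⟨i, rfl⟩ | ⟨i, rfl⟩ <;>
    rcases E.vertex_cases z with ⟨j, rfl⟩ | ⟨j, rfl⟩
    · rw [h1 (a₁ := i) (a₂ := j) (Subtype.ext (congrArg (fun W : q.Vertex => W.1) h))]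
    · rw [E.finrank_line, E.finrank_plane] at hr
      omega
    · rw [E.finrank_line, E.finrank_plane] at hr
      omega
    · rw [h2 (a₁ := i) (a₂ := j) (Subtype.ext (congrArg (fun W : q.Vertex => W.1) h))]

theorem image_inj : config '' inj E = apartments q := by
  ext x
  constructor
  · rintro ⟨f, hf, rfl⟩
    exact ⟨f.isWalk_config, f.injective_iff.1 hf⟩
  · rintro ⟨hx, hi⟩
    obtain ⟨f, rfl⟩ := exists_config_eq (E := E) hx
    exact ⟨f, f.injective_iff.2 hi, rfl⟩

theorem isInducing_config [TopologicalSpace V] :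
    Topology.IsInducing (config : Mor E → Config K V) := by
  choose i hi using fun C : E.Chamber => C.exists_line
  choose j hj using fun C : E.Chamber => C.exists_plane
  let Φ : Config K V → E.Chamber → Gr K V 1 × Gr K V 2 := fun x C => (x.1 (i C), x.2 (j C))
  let Ψ : (E.Chamber → Gr K V 1 × Gr K V 2) → Config K V :=
    fun y => (fun k => (y (E.chamber k)).1, fun k => (y (E.chamber k)).2)
  have hΦ : Continuous Φ := by fun_prop
  have hΨ : Continuous Ψ := by fun_prop
  have h1 : Mor.chamber (E := E) = Φ ∘ config :=
    funext fun f => funext fun C => f.chamber_eq (hi C) (hj C)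
  have h2 : config (E := E) = Ψ ∘ Mor.chamber := by
    funext f
    have := fun k => f.chamber_eq (C := E.chamber k) rfl rfl
    simp only [Ψ, Function.comp_apply, this]
  have hc : Topology.IsInducing (Mor.chamber : Mor E → _) := ⟨rfl⟩
  refine ⟨le_antisymm ?_ ?_⟩
  · rw [← continuous_iff_le_induced, h2]
    exact hΨ.comp hc.continuous
  · rw [hc.eq_induced, h1, ← induced_compose]
    exact induced_mono hΦ.le_induced

theorem mem_closure_iff [TopologicalSpace V] (f : Mor E) :
    f ∈ closure (inj E) ↔ f.config ∈ closure (apartments q) := by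
  rw [isInducing_config.closure_eq_preimage_closure_image, Set.mem_preimage, image_inj]

end Mor

/-! ### Limits in Grassmannians -/

theorem linearIndependent_of_span_eq {k : ℕ} {v : Fin k → V} (W : Gr K V k)
    (h : W.1 = Submodule.span Kᵐᵒᵖ (Set.range v)) : LinearIndependent Kᵐᵒᵖ v := by
  rw [linearIndependent_iff_card_eq_finrank_span, Fintype.card_fin, Set.finrank, ← h]
  exact W.2.symm

section Topology

variable [TopologicalSpace V]

theorem Gr.tendsto {ι : Type*} {l : Filter ι} {k : ℕ} {W : ι → Gr K V k} {W₀ : Gr K V k}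
    {v : ι → Fin k → V} {v₀ : Fin k → V} (hv : Tendsto v l (𝓝 v₀))
    (hW : ∀ i, (W i).1 = Submodule.span Kᵐᵒᵖ (Set.range (v i)))
    (hW₀ : W₀.1 = Submodule.span Kᵐᵒᵖ (Set.range v₀)) : Tendsto W l (𝓝 W₀) := by
  have hc : Continuous (Gr.ofFree K V k) := continuous_coinduced_rng
  have h1 : Tendsto (fun i => (⟨v i, linearIndependent_of_span_eq (W i) (hW i)⟩ :
      {v : Fin k → V // LinearIndependent Kᵐᵒᵖ v})) l
      (𝓝 ⟨v₀, linearIndependent_of_span_eq W₀ hW₀⟩) := tendsto_subtype_rng.2 hv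
  have h2 := (hc.tendsto _).comp h1
  have e1 : Gr.ofFree K V k ⟨v₀, linearIndependent_of_span_eq W₀ hW₀⟩ = W₀ :=
    Subtype.ext hW₀.symm
  rw [e1] at h2
  exact h2.congr fun i => Subtype.ext (hW i).symm

/-- A configuration is a limit of elements of `S` as soon as it is the value at `0` of a family
of configurations spanned by vectors that depend continuously on a parameter `t`, and that
belong to `S` for a set of parameters `t` that accumulates at `0`. -/
theorem mem_closure_of_curves [TopologicalSpace K] {S : Set (Config K V)} {T : Set K}
    (hT : 0 ∈ closure T) {x : Config K V} (a b c : Fin 4 → K → V) (ha : ∀ i, Continuous (a i))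
    (hb : ∀ i, Continuous (b i)) (hc : ∀ i, Continuous (c i))
    (hx1 : ∀ i, (x.1 i).1 = Submodule.span Kᵐᵒᵖ {a i 0})
    (hx2 : ∀ i, (x.2 i).1 = Submodule.span Kᵐᵒᵖ {b i 0, c i 0})
    (h : ∀ t ∈ T, ∃ y ∈ S, (∀ i, (y.1 i).1 = Submodule.span Kᵐᵒᵖ {a i t}) ∧
      ∀ i, (y.2 i).1 = Submodule.span Kᵐᵒᵖ {b i t, c i t}) : x ∈ closure S := by
  choose y hyS hy1 hy2 using h
  have hne : (𝓝[T] (0 : K)).NeBot := mem_closure_iff_nhdsWithin_neBot.1 hT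
  have hl : (comap ((↑) : T → K) (𝓝 0)).NeBot := by
    rw [comap_neBot_iff_frequently]
    refine (mem_closure_iff_frequently.1 hT).mono fun t ht => ⟨⟨t, ht⟩, rfl⟩
  have hid : Tendsto ((↑) : T → K) (comap ((↑) : T → K) (𝓝 0)) (𝓝 0) := tendsto_comap
  refine mem_closure_of_tendsto (f := fun t : T => y t t.2) (b := comap ((↑) : T → K) (𝓝 0)) ?_
    (Eventually.of_forall fun t => hyS t.1 t.2)
  refine Tendsto.prodMk_nhds (tendsto_pi_nhds.2 fun i => ?_) (tendsto_pi_nhds.2 fun i => ?_)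
  · refine Gr.tendsto (v := fun t _ => a i t) (v₀ := fun _ => a i 0) ?_ ?_ ?_
    · exact tendsto_pi_nhds.2 fun _ => ((ha i).tendsto 0).comp hid
    · intro t
      simp [hy1 t.1 t.2 i]
    · simp [hx1 i]
  · refine Gr.tendsto (v := fun t => ![b i t, c i t]) (v₀ := ![b i 0, c i 0]) ?_ ?_ ?_
    · refine tendsto_pi_nhds.2 fun j => ?_
      fin_cases j
      exacts [((hb i).tendsto 0).comp hid, ((hc i).tendsto 0).comp hid]
    · intro t
      rw [hy2 t.1 t.2 i, Matrix.range_cons_cons_empty]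
    · rw [hx2 i, Matrix.range_cons_cons_empty]

variable [TopologicalSpace K] [IsTopologicalAddGroup V]
  [ContinuousSMul Kᵐᵒᵖ V]

/-- The projection from free families to the Grassmannian is open, because it is the quotient by
a group that acts by homeomorphisms. -/
theorem Gr.isOpenMap_ofFree (k : ℕ) : IsOpenMap (Gr.ofFree K V k) := by
  intro U hU
  rw [isOpen_coinduced]
  obtain ⟨U', hU', rfl⟩ := isOpen_induced_iff.1 hU
  rw [isOpen_iff_mem_nhds]
  rintro v ⟨u, hu, huv⟩
  have hspan : Submodule.span Kᵐᵒᵖ (Set.range u.1) = Submodule.span Kᵐᵒᵖ (Set.range v.1) :=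
    congrArg Subtype.val huv
  have hM : ∀ i, ∃ c : Fin k → Kᵐᵒᵖ, ∑ j, c j • v.1 j = u.1 i := fun i => by
    rw [← Submodule.mem_span_range_iff_exists_fun, ← hspan]
    exact Submodule.subset_span (Set.mem_range_self i)
  have hN : ∀ i, ∃ c : Fin k → Kᵐᵒᵖ, ∑ j, c j • u.1 j = v.1 i := fun i => by
    rw [← Submodule.mem_span_range_iff_exists_fun, hspan]
    exact Submodule.subset_span (Set.mem_range_self i)
  choose M hM using hM
  choose N hN using hN
  have hNM : ∀ (w : Fin k → V) (i), ∑ j, N i j • ∑ l, M j l • w l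
      = ∑ l, (∑ j, N i j * M j l) • w l := by
    intro w i
    simp only [Finset.smul_sum, Finset.sum_smul, mul_smul]
    exact Finset.sum_comm
  have hone : ∀ i l, ∑ j, N i j * M j l = if l = i then 1 else 0 := by
    intro i l
    have h1 : ∑ l, (∑ j, N i j * M j l) • v.1 l = ∑ l, (if l = i then (1 : Kᵐᵒᵖ) else 0) • v.1 l := by
      rw [← hNM]
      simp only [hM, hN]
      simp
    rw [← sub_eq_zero, ← Finset.sum_sub_distrib] at h1
    simp only [← sub_smul] at h1
    exact sub_eq_zero.1 (Fintype.linearIndependent_iff.1 v.2 _ h1 l)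
  let φ : (Fin k → V) → Fin k → V := fun w j => ∑ l, M j l • w l
  have hφ : Continuous φ := by fun_prop
  have hφv : φ v.1 = u.1 := funext hM
  have hφspan : ∀ w, Submodule.span Kᵐᵒᵖ (Set.range (φ w)) = Submodule.span Kᵐᵒᵖ (Set.range w) := by
    intro w
    apply le_antisymm <;> rw [Submodule.span_le] <;> rintro _ ⟨i, rfl⟩
    · exact Submodule.mem_span_range_iff_exists_fun _ |>.2 ⟨M i, rfl⟩
    · refine Submodule.mem_span_range_iff_exists_fun _ |>.2 ⟨N i, ?_⟩
      change ∑ j, N i j • ∑ l, M j l • w l = w i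
      rw [hNM]
      simp [hone]
  have hmem : {w : {v : Fin k → V // LinearIndependent Kᵐᵒᵖ v} | φ w.1 ∈ U'} ∈ 𝓝 v := by
    refine (hφ.comp continuous_subtype_val).continuousAt.preimage_mem_nhds (hU'.mem_nhds ?_)
    change φ v.1 ∈ U'
    rw [hφv]
    exact hu
  filter_upwards [hmem] with w hw
  refine ⟨⟨φ w.1, linearIndependent_of_span_eq (Gr.ofFree K V k w) (hφspan w.1).symm⟩, hw, ?_⟩
  exact Subtype.ext (hφspan w.1)

/-- Bases of the members of a limit configuration are limits of bases of the members of
approximating configurations. -/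
theorem mem_closure_lifts {S : Set (Config K V)} {x : Config K V} (hx : x ∈ closure S)
    {a : Fin 4 → V} {b : Fin 4 → Fin 2 → V} (ha : ∀ i, (x.1 i).1 = Submodule.span Kᵐᵒᵖ {a i})
    (hb : ∀ i, (x.2 i).1 = Submodule.span Kᵐᵒᵖ {b i 0, b i 1}) :
    (a, b) ∈ closure {p : (Fin 4 → V) × (Fin 4 → Fin 2 → V) | ∃ y ∈ S,
      (∀ i, (y.1 i).1 = Submodule.span Kᵐᵒᵖ {p.1 i}) ∧
        ∀ i, (y.2 i).1 = Submodule.span Kᵐᵒᵖ {p.2 i 0, p.2 i 1}} := by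
  have hr2 : ∀ b : Fin 2 → V, Set.range b = {b 0, b 1} := fun b => by
    ext
    simp [Fin.exists_fin_two, eq_comm]
  let Φ : (Fin 4 → {v : Fin 1 → V // LinearIndependent Kᵐᵒᵖ v}) ×
      (Fin 4 → {v : Fin 2 → V // LinearIndependent Kᵐᵒᵖ v}) → Config K V :=
    fun p => (fun i => Gr.ofFree K V 1 (p.1 i), fun i => Gr.ofFree K V 2 (p.2 i))
  have hΦ : IsOpenMap Φ := by
    refine IsOpenMap.prodMap
      (f := fun (v : Fin 4 → {v : Fin 1 → V // LinearIndependent Kᵐᵒᵖ v}) i => Gr.ofFree K V 1 (v i))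
      (g := fun (v : Fin 4 → {v : Fin 2 → V // LinearIndependent Kᵐᵒᵖ v}) i => Gr.ofFree K V 2 (v i))
      ?_ ?_
    · exact IsOpenMap.piMap (fun _ => Gr.isOpenMap_ofFree 1) (Set.toFinite _)
    · exact IsOpenMap.piMap (fun _ => Gr.isOpenMap_ofFree 2) (Set.toFinite _)
  let a' : Fin 4 → {v : Fin 1 → V // LinearIndependent Kᵐᵒᵖ v} := fun i =>
    ⟨fun _ => a i, linearIndependent_of_span_eq (x.1 i) (by simp [ha])⟩
  let b' : Fin 4 → {v : Fin 2 → V // LinearIndependent Kᵐᵒᵖ v} := fun i =>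
    ⟨b i, linearIndependent_of_span_eq (x.2 i) (by rw [hb, hr2])⟩
  have hab : Φ (a', b') = x := by
    refine Prod.ext (funext fun i => Subtype.ext ?_) (funext fun i => Subtype.ext ?_)
    · simp [Φ, Gr.ofFree, a', ha]
    · simp only [Φ, Gr.ofFree, b', hb, hr2]
  have hmem : (a', b') ∈ closure (Φ ⁻¹' S) := by
    apply hΦ.preimage_closure_subset_closure_preimage
    rwa [Set.mem_preimage, hab]
  let ψ : (Fin 4 → {v : Fin 1 → V // LinearIndependent Kᵐᵒᵖ v}) ×
      (Fin 4 → {v : Fin 2 → V // LinearIndependent Kᵐᵒᵖ v}) → (Fin 4 → V) × (Fin 4 → Fin 2 → V) :=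
    fun p => (fun i => (p.1 i).1 0, fun i => (p.2 i).1)
  have hψ : Continuous ψ := by
    refine Continuous.prodMk (continuous_pi fun i => ?_) (continuous_pi fun i => ?_)
    · exact (continuous_apply 0).comp
        (continuous_subtype_val.comp ((continuous_apply i).comp continuous_fst))
    · exact continuous_subtype_val.comp ((continuous_apply i).comp continuous_snd)
  have := image_closure_subset_closure_image hψ (Set.mem_image_of_mem ψ hmem)
  refine closure_mono ?_ this
  rintro _ ⟨p, hp, rfl⟩
  refine ⟨Φ p, hp, fun i => ?_, fun i => ?_⟩
  · have : Set.range (p.1 i).1 = {(p.1 i).1 0} := by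
      ext
      simp [eq_comm]
    simp only [Φ, Gr.ofFree, ψ, this]
  · simp only [Φ, Gr.ofFree, ψ, hr2]

end Topology

end Form

section Form

variable {K : Type*} [DivisionRing K] {σ : AntiInvolution K}
  {V : Type*} [AddCommGroup V] [Module Kᵐᵒᵖ V]

/-! ### Marked quadrangles of isotropic vectors -/

/-- The nonzero central scalars that are fixed by `σ`. They serve as parameters of deformations,
since for them `q (v <• t) (w <• t) = q v w * (t * t)`. -/
def centralScalars (σ : AntiInvolution K) : Set K :=
  {t | t ≠ 0 ∧ σ t = t ∧ ∀ x, t * x = x * t}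

/-- Generators of the lines of a marked apartment. -/
structure IsMarked (q : HermitianForm σ V) (a : Fin 4 → V) : Prop where
  isotropic : ∀ i, q (a i) (a i) = 0
  orthogonal : ∀ i, q (a i) (a (i + 1)) = 0
  zero_two : q (a 0) (a 2) ≠ 0
  one_three : q (a 1) (a 3) ≠ 0

theorem span_pair_smul {x y : K} (hx : x ≠ 0) (hy : y ≠ 0) (v w : V) :
    Submodule.span Kᵐᵒᵖ {v <• x, w <• y} = Submodule.span Kᵐᵒᵖ {v, w} := by
  rw [Submodule.span_insert, Submodule.span_insert, span_singleton_smul hx, span_singleton_smul hy]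

/-- Two pairs of vectors have the same span if the first vectors agree and the second ones are
congruent, up to a nonzero scalar, modulo the first. -/
theorem span_pair_eq {u v w : V} {x y : K} (hy : y ≠ 0) (h : w = u <• x + v <• y) :
    Submodule.span Kᵐᵒᵖ {u, v} = Submodule.span Kᵐᵒᵖ {u, w} := by
  have hu : ∀ z : V, u ∈ Submodule.span Kᵐᵒᵖ {u, z} := fun z => Submodule.subset_span (by simp)
  have hz : ∀ z : V, z ∈ Submodule.span Kᵐᵒᵖ {u, z} := fun z => Submodule.subset_span (by simp)
  apply le_antisymm <;> rw [Submodule.span_le] <;> rintro z (rfl | rfl)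
  · exact hu _
  · have : z = (w - u <• x) <• y⁻¹ := by
      rw [h, add_sub_cancel_left, smul_inv_cancel_right hy]
    rw [this]
    exact Submodule.smul_mem _ _ (Submodule.sub_mem _ (hz w) (Submodule.smul_mem _ _ (hu w)))
  · exact hu _
  · rw [h]
    exact Submodule.add_mem _ (Submodule.smul_mem _ _ (hu v)) (Submodule.smul_mem _ _ (hz v))

theorem IsMarked.exists_apartment {q : HermitianForm σ V} {a : Fin 4 → V} (ha : IsMarked q a) :
    ∃ y ∈ apartments q, (∀ i, (y.1 i).1 = Submodule.span Kᵐᵒᵖ {a i}) ∧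
      ∀ i, (y.2 i).1 = Submodule.span Kᵐᵒᵖ {a i, a (i + 1)} := by
  let c : Fin 4 → K := ![1, 1, (q (a 0) (a 2))⁻¹, (q (a 1) (a 3))⁻¹]
  have hc : ∀ i, c i ≠ 0 := by
    intro i
    fin_cases i
    exacts [one_ne_zero, one_ne_zero, inv_ne_zero ha.zero_two, inv_ne_zero ha.one_three]
  let E : Frame q :=
    { e := fun i => a i <• c i
      isotropic := fun i => by simp [ha.isotropic]
      orthogonal := fun i => by simp [ha.orthogonal]
      pairing_zero_two := by simp [c, mul_inv_cancel₀ ha.zero_two]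
      pairing_one_three := by simp [c, mul_inv_cancel₀ ha.one_three] }
  refine ⟨(fun i => ⟨(E.line i).1.1, E.finrank_line i⟩,
    fun i => ⟨(E.plane i).1.1, E.finrank_plane i⟩), ⟨⟨?_, ?_, ?_⟩, ?_, ?_⟩, ?_, ?_⟩
  · exact fun i => (E.plane i).1.2.2
  · exact fun i => E.line_le_plane_iff.2 (Or.inl rfl)
  · exact fun i => E.line_le_plane_iff.2 (Or.inr rfl)
  · exact fun i j h => E.line_injective (congrArg (fun W : Gr K V 1 => W.1) h)
  · exact fun i j h => E.plane_injective (congrArg (fun W : Gr K V 2 => W.1) h)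
  · exact fun i => span_singleton_smul (hc i) _
  · exact fun i => span_pair_smul (hc i) (hc (i + 1)) _ _

/-- Two totally isotropic planes through a line are not orthogonal to each other, unless they
coincide: the generalized quadrangle has no triangles. -/
theorem HermitianForm.HasWittIndexTwo.ne_zero_of_planes_ne [FiniteDimensional Kᵐᵒᵖ V]
    {q : HermitianForm σ V} (hW : q.HasWittIndexTwo) {P P' : Submodule Kᵐᵒᵖ V}
    (hP : q.IsTotallyIsotropic P) (hP' : q.IsTotallyIsotropic P') (h2 : finrank Kᵐᵒᵖ P = 2)
    (h2' : finrank Kᵐᵒᵖ P' = 2) (hne : P ≠ P') {v u w : V} (hv : v ≠ 0) (hvP : v ∈ P)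
    (hvP' : v ∈ P') (hu : u ∈ P) (hw : w ∈ P') (hu' : u ∉ Submodule.span Kᵐᵒᵖ {v})
    (hw' : w ∉ Submodule.span Kᵐᵒᵖ {v}) : q u w ≠ 0 := by
  intro h
  have e1 := eq_span_pair h2 hvP hu hv hu'
  have hwP : w ∈ P := by
    refine hW.mem_of_isotropic hP h2 (hP' w hw w hw) fun z hz => q.swap_eq_zero ?_
    rw [e1] at hz
    refine q.eq_zero_of_mem_span ?_ hz
    rintro x (rfl | rfl)
    exacts [hP' w hw _ hvP', q.swap_eq_zero h]
  exact hne ((eq_span_pair h2 hvP hwP hv hw').trans (eq_span_pair h2' hvP' hw hv hw').symm)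

/-! ### Closures of sets of configurations -/

/-- The shift of a configuration by one index. -/
def rotate (x : Config K V) : Config K V := (fun i => x.1 (i + 1), fun i => x.2 (i + 1))

theorem rotate_rotate_rotate_rotate (x : Config K V) :
    rotate (rotate (rotate (rotate x))) = x := by
  have h : ∀ i : Fin 4, i + 1 + 1 + 1 + 1 = i := by decide
  simp only [rotate, h]

theorem IsWalk.rotate {q : HermitianForm σ V} {x : Config K V} (hx : IsWalk q x) :
    IsWalk q (rotate x) :=
  ⟨fun _ => hx.isotropic _, fun _ => hx.le _, fun _ => hx.succ_le _⟩

variable [TopologicalSpace V]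

theorem mem_closure_of_rotate {q : HermitianForm σ V} {x : Config K V}
    (hx : rotate x ∈ closure (apartments q)) : x ∈ closure (apartments q) := by
  have hc : Continuous (rotate : Config K V → Config K V) := by
    unfold rotate
    fun_prop
  have hm : ∀ y : Config K V, y ∈ closure (apartments q) →
      rotate y ∈ closure (apartments q) := fun y hy => by
    refine map_mem_closure hc hy ?_
    rintro z ⟨hz, h1, h2⟩
    exact ⟨hz.rotate, h1.comp (add_left_injective 1), h2.comp (add_left_injective 1)⟩
  rw [← rotate_rotate_rotate_rotate x]
  exact hm _ (hm _ (hm _ hx))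

theorem mem_closure_apartments [TopologicalSpace K] {q : HermitianForm σ V} {T : Set K}
    (hT : 0 ∈ closure T) {x : Config K V} (a b c : Fin 4 → K → V) (ha : ∀ i, Continuous (a i))
    (hb : ∀ i, Continuous (b i)) (hc : ∀ i, Continuous (c i))
    (hx1 : ∀ i, (x.1 i).1 = Submodule.span Kᵐᵒᵖ {a i 0})
    (hx2 : ∀ i, (x.2 i).1 = Submodule.span Kᵐᵒᵖ {b i 0, c i 0})
    (hm : ∀ t ∈ T, IsMarked q fun i => a i t)
    (hs : ∀ t ∈ T, ∀ i, Submodule.span Kᵐᵒᵖ {b i t, c i t}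
      = Submodule.span Kᵐᵒᵖ {a i t, a (i + 1) t}) : x ∈ closure (apartments q) := by
  refine mem_closure_of_curves hT a b c ha hb hc hx1 hx2 fun t ht => ?_
  obtain ⟨y, hy, h1, h2⟩ := (hm t ht).exists_apartment
  exact ⟨y, hy, h1, fun i => (h2 i).trans (hs t ht i).symm⟩

variable [TopologicalSpace K]

theorem Gr.mem_closure_flag {N : Set (Gr K V 1 × Gr K V 2)} {T : Set K} (hT : 0 ∈ closure T)
    {L : Gr K V 1} {P : Gr K V 2} {a b c : K → V} (ha : Continuous a) (hb : Continuous b)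
    (hc : Continuous c) (hL : L.1 = Submodule.span Kᵐᵒᵖ {a 0})
    (hP : P.1 = Submodule.span Kᵐᵒᵖ {b 0, c 0})
    (h : ∀ t ∈ T, ∃ y ∈ N, y.1.1 = Submodule.span Kᵐᵒᵖ {a t} ∧
      y.2.1 = Submodule.span Kᵐᵒᵖ {b t, c t}) : (L, P) ∈ closure N := by
  have hx := mem_closure_of_curves (S := {x : Config K V | (x.1 0, x.2 0) ∈ N}) hT
    (x := (fun _ => L, fun _ => P)) (fun _ => a) (fun _ => b) (fun _ => c) (fun _ => ha)
    (fun _ => hb) (fun _ => hc) (fun _ => hL) (fun _ => hP) fun t ht => by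
      obtain ⟨y, hy, h1, h2⟩ := h t ht
      exact ⟨(fun _ => y.1, fun _ => y.2), hy, fun _ => h1, fun _ => h2⟩
  have hc : Continuous fun x : Config K V => (x.1 0, x.2 0) := by fun_prop
  exact map_mem_closure (f := fun x : Config K V => (x.1 0, x.2 0)) hc hx fun x hx => hx

variable [IsTopologicalAddGroup V] [ContinuousSMul Kᵐᵒᵖ V]

/-- A line of a plane is a limit of other lines of the plane, which may be taken different
from a given line `M` as well. -/
theorem Gr.mem_closure_lines (hT : 0 ∈ closure (centralScalars σ)) {L M : Gr K V 1} {P : Gr K V 2}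
    (hL : L.1 ≤ P.1) (hM : M.1 ≤ P.1) : L ∈ closure {L' | L'.1 ≤ P.1 ∧ L' ≠ L ∧ L' ≠ M} := by
  obtain ⟨l, hl0, hl⟩ := exists_eq_span_singleton L.2
  have hlP : l ∈ P.1 := hL (hl ▸ Submodule.mem_span_singleton_self l)
  obtain ⟨m, hmP, hmL, hmM⟩ : ∃ m ∈ P.1, m ∉ Submodule.span Kᵐᵒᵖ {l} ∧ (M ≠ L → m ∈ M.1) := by
    by_cases h : M = L
    · obtain ⟨m, hm, hmL⟩ := exists_mem_notMem L.2 P.2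
      exact ⟨m, hm, hl ▸ hmL, fun h' => absurd h h'⟩
    · obtain ⟨m, hm0, hm⟩ := exists_eq_span_singleton M.2
      have hmM : m ∈ M.1 := hm ▸ Submodule.mem_span_singleton_self m
      refine ⟨m, hM hmM, fun h' => h (Subtype.ext ?_), fun _ => hmM⟩
      rw [hm, hl, span_singleton_eq_of_mem h' hm0]
  have key := Gr.mem_closure_flag (N := {y : Gr K V 1 × Gr K V 2 | y.1.1 ≤ P.1 ∧ y.1 ≠ L ∧ y.1 ≠ M})
    hT (L := L) (P := P) (a := fun t => l + m <• t) (b := fun _ => l) (c := fun _ => m)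
    (by fun_prop) (by fun_prop) (by fun_prop) (by simpa using hl)
    (eq_span_pair P.2 hlP hmP hl0 hmL) fun t ht => by
      have hne : l + m <• t ≠ 0 := fun h => hmL (mem_span_singleton_iff.2 ⟨-t⁻¹, by
        have : l = - (m <• t) := eq_neg_of_add_eq_zero_left h
        rw [this, MulOpposite.op_neg, neg_smul, smul_neg, neg_neg, smul_inv_cancel_right ht.1]⟩)
      have hnL : l + m <• t ∉ Submodule.span Kᵐᵒᵖ {l} := fun h => hmL (by
        have h1 := Submodule.sub_mem _ h (Submodule.mem_span_singleton_self l)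
        rw [add_sub_cancel_left] at h1
        have h2 := Submodule.smul_mem _ (MulOpposite.op t⁻¹) h1
        rwa [smul_inv_cancel_right ht.1] at h2)
      refine ⟨(⟨Submodule.span Kᵐᵒᵖ {l + m <• t}, finrank_span_singleton hne⟩, P),
        ⟨?_, fun h => ?_, fun h => ?_⟩, rfl, eq_span_pair P.2 hlP hmP hl0 hmL⟩
      · rw [Submodule.span_singleton_le_iff_mem]
        exact P.1.add_mem hlP (P.1.smul_mem _ hmP)
      · apply hnL
        rw [← hl, ← h]
        exact Submodule.mem_span_singleton_self _
      · by_cases hML : M = L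
        · apply hnL
          rw [← hl, ← hML, ← h]
          exact Submodule.mem_span_singleton_self _
        · have h1 : l + m <• t ∈ M.1 := h ▸ Submodule.mem_span_singleton_self _
          have h2 := M.1.sub_mem h1 (M.1.smul_mem (MulOpposite.op t) (hmM hML))
          rw [add_sub_cancel_right] at h2
          exact hML (Subtype.ext ((eq_span_singleton M.2 h2 hl0).trans hl.symm))
  exact map_mem_closure continuous_fst key fun y hy => hy

variable [FiniteDimensional Kᵐᵒᵖ V] {q : HermitianForm σ V}

variable [IsTopologicalRing K] in
/-- A flag `c ⊂ P` with a further vector `n ∈ P ∖ c` deforms to flags `c ⊂ P'` with `P' ≠ P`.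
The plane `P'` differs also from a given plane `M` through `c`. -/
theorem Gr.mem_closure_planes_through (hT : 0 ∈ closure (centralScalars σ)) (hq : q.Nondegenerate)
    (hW : q.HasWittIndexTwo) (h2 : (2 : K) ≠ 0) (hV : 5 ≤ finrank Kᵐᵒᵖ V) {c L : Gr K V 1}
    {P M : Gr K V 2} (hP : q.IsTotallyIsotropic P.1) (hM : q.IsTotallyIsotropic M.1)
    (hcP : c.1 ≤ P.1) (hcM : c.1 ≤ M.1) (hLP : L.1 ≤ P.1) (hLc : L ≠ c) :
    (L, P) ∈ closure {y : Gr K V 1 × Gr K V 2 | q.IsTotallyIsotropic y.2.1 ∧ c.1 ≤ y.2.1 ∧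
      y.1.1 ≤ y.2.1 ∧ y.1 ≠ c ∧ y.2 ≠ P ∧ y.2 ≠ M} := by
  obtain ⟨e₀, h0, hc⟩ := exists_eq_span_singleton c.2
  obtain ⟨e₁, h1, hL⟩ := exists_eq_span_singleton L.2
  have m0 : e₀ ∈ c.1 := hc ▸ Submodule.mem_span_singleton_self e₀
  have m1 : e₁ ∈ L.1 := hL ▸ Submodule.mem_span_singleton_self e₁
  have hi : e₁ ∉ Submodule.span Kᵐᵒᵖ {e₀} := fun h => hLc (Subtype.ext (by
    rw [hL, hc, span_singleton_eq_of_mem h h1]))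
  have hPs := eq_span_pair P.2 (hcP m0) (hLP m1) h0 hi
  have h00 := hP _ (hcP m0) _ (hcP m0)
  have h01 := hP _ (hcP m0) _ (hLP m1)
  have h11 := hP _ (hLP m1) _ (hLP m1)
  obtain ⟨e₃, h33, h03, h13, h3M⟩ : ∃ e₃, q e₃ e₃ = 0 ∧ q e₀ e₃ = 0 ∧ q e₁ e₃ = 1 ∧
      (M ≠ P → e₃ ∈ M.1) := by
    by_cases h : M = P
    · obtain ⟨e₃, h33, h03, h13⟩ := hq.exists_third h2 h0 hi h00 h01 h11
      exact ⟨e₃, h33, h03, h13, fun h' => absurd h h'⟩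
    · obtain ⟨w, hw, hwc⟩ := exists_mem_notMem c.2 M.2
      have hne := hW.ne_zero_of_planes_ne hP hM P.2 M.2 (fun h' => h (Subtype.ext h'.symm)) h0
        (hcP m0) (hcM m0) (hLP m1) hw hi (hc ▸ hwc)
      have hM' := M.1.smul_mem (MulOpposite.op (q e₁ w)⁻¹) hw
      exact ⟨_, hM _ hM' _ hM', hM _ (hcM m0) _ hM', by simp [mul_inv_cancel₀ hne],
        fun _ => hM'⟩
  obtain ⟨e₂, h22, h02, h12, h32⟩ := hq.exists_fourth h2 h0 h00 h01 h03 h11 h33 h13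
  let E : Frame q := Frame.mk' h00 h11 h22 h33 h01 h03 h12 h32 h02 h13
  obtain ⟨v, hv, hv0⟩ := E.exists_perp_ne_zero hV
  have hvv : q v v ≠ 0 := fun h => hv0 (E.perp_anisotropic hW hv h)
  have v0 : q e₀ v = 0 := hv 0
  have v1 : q e₁ v = 0 := hv 1
  have v3 : q e₃ v = 0 := hv 3
  have v1' := q.swap_eq_zero v1
  have v3' := q.swap_eq_zero v3
  have h31 : q e₃ e₁ = 1 := by rw [q.hermitian e₁ e₃, h13, σ.map_one]
  set k : K := 2⁻¹ * q v v with hk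
  have hk0 : k ≠ 0 := mul_ne_zero (inv_ne_zero h2) hvv
  have hσk : σ k = k := by
    rw [hk, σ.map_mul, q.map_self, σ.map_inv, σ.map_two]
    exact ((Commute.ofNat_right _ 2).inv_right₀).eq
  have hkk : q v v = k + k := by rw [hk, ← two_mul, mul_inv_cancel_left₀ h2]
  refine Gr.mem_closure_flag hT (a := fun t => e₁ + v <• t - e₃ <• (k * (t * t)))
    (b := fun _ => e₀) (c := fun t => e₁ + v <• t - e₃ <• (k * (t * t))) (by fun_prop)
    (by fun_prop) (by fun_prop) (by simpa using hL) (by simpa using hPs) fun t ht => ?_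
  obtain ⟨ht0, hσt, htc⟩ := ht
  set n := e₁ + v <• t - e₃ <• (k * (t * t)) with hn
  have hn1 : q e₁ n = - (k * (t * t)) := by simp [hn, h11, v1, h13]
  have hn3 : q e₃ n = 1 := by simp [hn, h31, v3, h33]
  have hn0 : q e₀ n = 0 := by simp [hn, h01, v0, h03]
  have c1 : t * (k * t) = k * (t * t) := by rw [← mul_assoc, htc, mul_assoc]
  have c2 : t * (t * k) = k * (t * t) := by rw [htc k, c1]
  have hnn : q n n = 0 := by
    simp only [hn, HermitianForm.map_sub_left, HermitianForm.map_add_left,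
      HermitianForm.map_sub_right, HermitianForm.map_add_right, HermitianForm.map_smul_left,
      HermitianForm.map_smul_right, h11, v1, h13, v1', v3', h31, v3, h33, MulOpposite.unop_op,
      AntiInvolution.map_mul, hσt, hσk, hkk, mul_assoc,
      mul_add, add_mul, sub_mul, c1, c2, mul_zero, zero_mul, mul_one, one_mul]
    abel
  have hnz : n ≠ 0 := fun h => by
    rw [h, q.map_zero_right] at hn3
    exact zero_ne_one hn3
  have hns : n ∉ Submodule.span Kᵐᵒᵖ {e₀} := fun h => by
    rw [q.eq_zero_of_mem_span (by simpa using q.swap_eq_zero h03) h] at hn3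
    exact zero_ne_one hn3
  have hnm : n ∈ Submodule.span Kᵐᵒᵖ {e₀, n} := Submodule.subset_span (by simp)
  refine ⟨(⟨Submodule.span Kᵐᵒᵖ {n}, finrank_span_singleton hnz⟩,
    ⟨Submodule.span Kᵐᵒᵖ {e₀, n}, finrank_span_pair h0 hns⟩),
    ⟨q.isTotallyIsotropic_span_pair h00 hnn hn0, ?_, ?_, fun h => ?_, fun h => ?_, fun h => ?_⟩,
    rfl, rfl⟩
  · rw [hc]
    exact Submodule.span_mono (by simp)
  · exact Submodule.span_mono (by simp)
  · apply hns
    rw [← hc, ← h]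
    exact Submodule.mem_span_singleton_self n
  · have : n ∈ P.1 := h ▸ hnm
    have := hP _ (hLP m1) _ this
    rw [hn1, neg_eq_zero] at this
    exact mul_ne_zero hk0 (mul_ne_zero ht0 ht0) this
  · have hnM : n ∈ M.1 := h ▸ hnm
    by_cases hMP : M = P
    · rw [hMP] at hnM
      have := hP _ (hLP m1) _ hnM
      rw [hn1, neg_eq_zero] at this
      exact mul_ne_zero hk0 (mul_ne_zero ht0 ht0) this
    · have := hM _ (h3M hMP) _ hnM
      rw [hn3] at this
      exact one_ne_zero this

variable [IsTopologicalRing K] in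
theorem Gr.mem_closure_planes (hT : 0 ∈ closure (centralScalars σ)) (hq : q.Nondegenerate)
    (hW : q.HasWittIndexTwo) (h2 : (2 : K) ≠ 0) (hV : 5 ≤ finrank Kᵐᵒᵖ V) {c : Gr K V 1}
    {P M : Gr K V 2} (hP : q.IsTotallyIsotropic P.1) (hM : q.IsTotallyIsotropic M.1)
    (hcP : c.1 ≤ P.1) (hcM : c.1 ≤ M.1) :
    P ∈ closure {P' : Gr K V 2 | q.IsTotallyIsotropic P'.1 ∧ c.1 ≤ P'.1 ∧ P' ≠ P ∧ P' ≠ M} := by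
  obtain ⟨w, hw, hwc⟩ := exists_mem_notMem c.2 P.2
  have hw0 : w ≠ 0 := fun h => hwc (h ▸ c.1.zero_mem)
  have h := Gr.mem_closure_planes_through hT hq hW h2 hV
    (L := ⟨Submodule.span Kᵐᵒᵖ {w}, finrank_span_singleton hw0⟩) hP hM hcP hcM
    (by simpa using hw) (fun h => hwc (by rw [← h]; exact Submodule.mem_span_singleton_self w))
  exact map_mem_closure continuous_snd h fun y hy => ⟨hy.1, hy.2.1, hy.2.2.2.2⟩

/-- If `L` is a line in two distinct totally isotropic planes `c` and `P`, then the flag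
`L ⊂ P` deforms to flags `L' ⊂ P'` with `L' ⊂ c` and `L' ≠ L`. -/
theorem Gr.mem_closure_flags_along (hT : 0 ∈ closure (centralScalars σ)) (hq : q.Nondegenerate)
    (hW : q.HasWittIndexTwo) (h2 : (2 : K) ≠ 0) {L : Gr K V 1} {c P : Gr K V 2}
    (hc : q.IsTotallyIsotropic c.1) (hP : q.IsTotallyIsotropic P.1) (hLc : L.1 ≤ c.1)
    (hLP : L.1 ≤ P.1) (hne : P ≠ c) :
    (L, P) ∈ closure {y : Gr K V 1 × Gr K V 2 | q.IsTotallyIsotropic y.2.1 ∧ y.1.1 ≤ c.1 ∧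
      y.1.1 ≤ y.2.1 ∧ y.1 ≠ L ∧ y.2 ≠ c} := by
  obtain ⟨e₀, h0, hL⟩ := exists_eq_span_singleton L.2
  have m0 : e₀ ∈ L.1 := hL ▸ Submodule.mem_span_singleton_self e₀
  obtain ⟨e₁, m1, hi⟩ := exists_mem_notMem L.2 c.2
  obtain ⟨w, hw, hwL⟩ := exists_mem_notMem L.2 P.2
  rw [hL] at hi hwL
  have hnz := hW.ne_zero_of_planes_ne hc hP c.2 P.2 (fun h => hne (Subtype.ext h.symm)) h0
    (hLc m0) (hLP m0) m1 hw hi hwL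
  obtain ⟨e₃, m3, h13, h3L⟩ : ∃ e₃ ∈ P.1, q e₁ e₃ = 1 ∧ e₃ ∉ Submodule.span Kᵐᵒᵖ {e₀} := by
    refine ⟨w <• (q e₁ w)⁻¹, P.1.smul_mem _ hw, by simp [mul_inv_cancel₀ hnz], fun h => hwL ?_⟩
    have := Submodule.smul_mem _ (MulOpposite.op (q e₁ w)) h
    rwa [op_smul_op_smul, inv_mul_cancel₀ hnz, MulOpposite.op_one, one_smul] at this
  have h00 := hc _ (hLc m0) _ (hLc m0)
  have h01 := hc _ (hLc m0) _ m1
  have h11 := hc _ m1 _ m1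
  have h03 := hP _ (hLP m0) _ m3
  have h33 := hP _ m3 _ m3
  obtain ⟨e₂, h22, h02, h12, h32⟩ := hq.exists_fourth h2 h0 h00 h01 h03 h11 h33 h13
  refine Gr.mem_closure_flag hT (a := fun t => e₀ + e₁ <• t) (b := fun t => e₀ + e₁ <• t)
    (c := fun t => e₃ - e₂ <• t) (by fun_prop) (by fun_prop) (by fun_prop) (by simpa using hL)
    (by simpa using eq_span_pair P.2 (hLP m0) m3 h0 h3L) fun t ht => ?_
  obtain ⟨ht0, hσt, -⟩ := ht
  have h23 := q.swap_eq_zero h32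
  have h10 := q.swap_eq_zero h01
  have hne0 : e₀ + e₁ <• t ≠ 0 := fun h => by
    have : q (e₀ + e₁ <• t) e₂ = 1 := by simp [h02, h12]
    rw [h, q.map_zero_left] at this
    exact zero_ne_one this
  have hns : e₃ - e₂ <• t ∉ Submodule.span Kᵐᵒᵖ {e₀ + e₁ <• t} := fun h => by
    have h1 : q e₁ (e₃ - e₂ <• t) = 1 := by simp [h13, h12]
    rw [q.eq_zero_of_mem_span (by simp [h10, h11]) h] at h1
    exact zero_ne_one h1
  refine ⟨(⟨Submodule.span Kᵐᵒᵖ {e₀ + e₁ <• t}, finrank_span_singleton hne0⟩,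
    ⟨Submodule.span Kᵐᵒᵖ {e₀ + e₁ <• t, e₃ - e₂ <• t}, finrank_span_pair hne0 hns⟩),
    ⟨q.isTotallyIsotropic_span_pair ?_ ?_ ?_, ?_, ?_, fun h => ?_, fun h => ?_⟩, rfl, rfl⟩
  · simp [h00, h01, h10, h11]
  · simp [h33, h32, h23, h22]
  · simp [h03, h02, h13, h12, hσt]
  · rw [Submodule.span_singleton_le_iff_mem]
    exact c.1.add_mem (hLc m0) (c.1.smul_mem _ m1)
  · exact Submodule.span_mono (by simp)
  · have h1 : e₀ + e₁ <• t ∈ L.1 := h ▸ Submodule.mem_span_singleton_self _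
    have h2 := L.1.smul_mem (MulOpposite.op t⁻¹) (L.1.sub_mem h1 m0)
    rw [add_sub_cancel_left, smul_inv_cancel_right ht0, hL] at h2
    exact hi h2
  · have h1 : e₃ - e₂ <• t ∈ c.1 := h ▸ Submodule.subset_span (by simp)
    have h2 := hc _ m1 _ h1
    simp [h13, h12] at h2

end Form

section Form

variable {K : Type*} [DivisionRing K] {σ : AntiInvolution K}
  {V : Type*} [AddCommGroup V] [Module Kᵐᵒᵖ V]

/-! ### Closed galleries that are not quadripods -/

/-- The standing assumptions: a nondegenerate form of Witt index two in dimension at least five,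
in characteristic different from two, such that central `σ`-fixed scalars accumulate at `0`. -/
structure IsAmbient [TopologicalSpace K] (q : HermitianForm σ V) : Prop where
  nondegenerate : q.Nondegenerate
  witt : q.HasWittIndexTwo
  two_ne_zero : (2 : K) ≠ 0
  five_le : 5 ≤ finrank Kᵐᵒᵖ V
  accumulates : 0 ∈ closure (centralScalars σ)

/-- Half of the value `q v v`, which is again fixed by `σ`. -/
theorem HermitianForm.exists_half (q : HermitianForm σ V) (h2 : (2 : K) ≠ 0) (v : V) :
    ∃ k, σ k = k ∧ q v v = k + k := by
  refine ⟨2⁻¹ * q v v, ?_, by rw [← two_mul, mul_inv_cancel_left₀ h2]⟩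
  rw [σ.map_mul, q.map_self, σ.map_inv, σ.map_two]
  exact ((Commute.ofNat_right _ 2).inv_right₀).eq

theorem IsMarked.of_vectors {q : HermitianForm σ V} {a₀ a₁ a₂ a₃ : V} (h00 : q a₀ a₀ = 0)
    (h11 : q a₁ a₁ = 0) (h22 : q a₂ a₂ = 0) (h33 : q a₃ a₃ = 0) (h01 : q a₀ a₁ = 0)
    (h12 : q a₁ a₂ = 0) (h23 : q a₂ a₃ = 0) (h03 : q a₀ a₃ = 0) (h02 : q a₀ a₂ ≠ 0)
    (h13 : q a₁ a₃ ≠ 0) : IsMarked q ![a₀, a₁, a₂, a₃] where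
  isotropic i := by fin_cases i <;> assumption
  orthogonal i := by
    fin_cases i
    exacts [h01, h12, h23, q.swap_eq_zero h03]
  zero_two := h02
  one_three := h13

variable [TopologicalSpace V] [TopologicalSpace K]

theorem mem_closure_of_four_curves {q : HermitianForm σ V} {T : Set K} (hT : 0 ∈ closure T)
    {x : Config K V} (a₀ a₁ a₂ a₃ b₀ c₀ b₁ c₁ b₂ c₂ b₃ c₃ : K → V)
    (h0 : (x.1 0).1 = Submodule.span Kᵐᵒᵖ {a₀ 0}) (h1 : (x.1 1).1 = Submodule.span Kᵐᵒᵖ {a₁ 0})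
    (h2 : (x.1 2).1 = Submodule.span Kᵐᵒᵖ {a₂ 0}) (h3 : (x.1 3).1 = Submodule.span Kᵐᵒᵖ {a₃ 0})
    (k0 : (x.2 0).1 = Submodule.span Kᵐᵒᵖ {b₀ 0, c₀ 0})
    (k1 : (x.2 1).1 = Submodule.span Kᵐᵒᵖ {b₁ 0, c₁ 0})
    (k2 : (x.2 2).1 = Submodule.span Kᵐᵒᵖ {b₂ 0, c₂ 0})
    (k3 : (x.2 3).1 = Submodule.span Kᵐᵒᵖ {b₃ 0, c₃ 0})
    (hm : ∀ t ∈ T, IsMarked q ![a₀ t, a₁ t, a₂ t, a₃ t])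
    (s0 : ∀ t ∈ T, Submodule.span Kᵐᵒᵖ {b₀ t, c₀ t} = Submodule.span Kᵐᵒᵖ {a₀ t, a₁ t})
    (s1 : ∀ t ∈ T, Submodule.span Kᵐᵒᵖ {b₁ t, c₁ t} = Submodule.span Kᵐᵒᵖ {a₁ t, a₂ t})
    (s2 : ∀ t ∈ T, Submodule.span Kᵐᵒᵖ {b₂ t, c₂ t} = Submodule.span Kᵐᵒᵖ {a₂ t, a₃ t})
    (s3 : ∀ t ∈ T, Submodule.span Kᵐᵒᵖ {b₃ t, c₃ t} = Submodule.span Kᵐᵒᵖ {a₃ t, a₀ t})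
    (ha₀ : Continuous a₀ := by fun_prop) (ha₁ : Continuous a₁ := by fun_prop)
    (ha₂ : Continuous a₂ := by fun_prop) (ha₃ : Continuous a₃ := by fun_prop)
    (hb₀ : Continuous b₀ := by fun_prop) (hb₁ : Continuous b₁ := by fun_prop)
    (hb₂ : Continuous b₂ := by fun_prop) (hb₃ : Continuous b₃ := by fun_prop)
    (hc₀ : Continuous c₀ := by fun_prop) (hc₁ : Continuous c₁ := by fun_prop)
    (hc₂ : Continuous c₂ := by fun_prop) (hc₃ : Continuous c₃ := by fun_prop) :
    x ∈ closure (apartments q) := by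
  refine mem_closure_apartments hT (fun i t => ![a₀ t, a₁ t, a₂ t, a₃ t] i)
    (fun i t => ![b₀ t, b₁ t, b₂ t, b₃ t] i) (fun i t => ![c₀ t, c₁ t, c₂ t, c₃ t] i)
    ?_ ?_ ?_ ?_ ?_ hm ?_
  · intro i
    fin_cases i <;> assumption
  · intro i
    fin_cases i <;> assumption
  · intro i
    fin_cases i <;> assumption
  · intro i
    fin_cases i <;> assumption
  · intro i
    fin_cases i <;> assumption
  · intro t ht i
    fin_cases i
    exacts [s0 t ht, s1 t ht, s2 t ht, s3 t ht]

variable [IsTopologicalRing K] [IsTopologicalAddGroup V] [ContinuousSMul Kᵐᵒᵖ V]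
  [FiniteDimensional Kᵐᵒᵖ V] {q : HermitianForm σ V}

omit [TopologicalSpace V] [IsTopologicalRing K] [IsTopologicalAddGroup V]
  [ContinuousSMul Kᵐᵒᵖ V] in
theorem IsAmbient.exists_perp (hA : IsAmbient q) (E : Frame q) :
    ∃ v ∈ E.perp, v ≠ 0 ∧ q v v ≠ 0 := by
  obtain ⟨v, hv, hv0⟩ := E.exists_perp_ne_zero hA.five_le
  exact ⟨v, hv, hv0, fun h => hv0 (E.perp_anisotropic hA.witt hv h)⟩

/-- A nondegenerate gallery folded at two opposite lines: the second of these lines moves off the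
first one, orthogonally to the two other lines. -/
theorem IsAmbient.fold_line_of_frame (hA : IsAmbient q) (E : Frame q) {x : Config K V}
    (h0 : (x.1 0).1 = Submodule.span Kᵐᵒᵖ {E.e 0}) (h1 : (x.1 1).1 = Submodule.span Kᵐᵒᵖ {E.e 1})
    (h2 : (x.1 2).1 = Submodule.span Kᵐᵒᵖ {E.e 0}) (h3 : (x.1 3).1 = Submodule.span Kᵐᵒᵖ {E.e 3})
    (k0 : (x.2 0).1 = Submodule.span Kᵐᵒᵖ {E.e 0, E.e 1})
    (k1 : (x.2 1).1 = Submodule.span Kᵐᵒᵖ {E.e 0, E.e 1})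
    (k2 : (x.2 2).1 = Submodule.span Kᵐᵒᵖ {E.e 0, E.e 3})
    (k3 : (x.2 3).1 = Submodule.span Kᵐᵒᵖ {E.e 0, E.e 3}) : x ∈ closure (apartments q) := by
  obtain ⟨v, hv, -, hvv⟩ := hA.exists_perp E
  obtain ⟨k, hσk, hk⟩ := q.exists_half hA.two_ne_zero v
  have hk0 : k ≠ 0 := by
    rintro rfl
    exact hvv (by simpa using hk)
  have hv' := fun i => q.swap_eq_zero (hv i)
  refine mem_closure_of_four_curves hA.accumulates (fun _ => E.e 0) (fun _ => E.e 1)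
    (fun t => E.e 0 + v <• t - E.e 2 <• (k * (t * t))) (fun _ => E.e 3)
    (fun _ => E.e 0) (fun _ => E.e 1)
    (fun _ => E.e 1) (fun t => E.e 0 + v <• t - E.e 2 <• (k * (t * t)))
    (fun t => E.e 0 + v <• t - E.e 2 <• (k * (t * t))) (fun _ => E.e 3)
    (fun _ => E.e 3) (fun _ => E.e 0)
    (by simpa using h0) (by simpa using h1) (by simpa using h2) (by simpa using h3)
    (by simpa using k0) (by simpa [Set.pair_comm] using k1) (by simpa using k2)
    (by simpa [Set.pair_comm] using k3) ?_ (fun _ _ => rfl) (fun _ _ => rfl) (fun _ _ => rfl)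
    (fun _ _ => rfl)
  rintro t ⟨ht0, hσt, htc⟩
  have c1 : t * (k * t) = k * (t * t) := by rw [← mul_assoc, htc, mul_assoc]
  have c2 : t * (t * k) = k * (t * t) := by rw [htc k, c1]
  have hn : k * (t * t) ≠ 0 := mul_ne_zero hk0 (mul_ne_zero ht0 ht0)
  apply IsMarked.of_vectors
  · simp [E.gram]
  · simp [E.gram]
  · simp [E.gram, hv _, hv' _, hσt, hσk, hk, mul_assoc, mul_add, add_mul, c1, c2]
  · simp [E.gram]
  · simp [E.gram]
  · simp [E.gram, hv _]
  · simp [E.gram, hv' _]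
  · simp [E.gram]
  · simpa [E.gram, hv _] using hn
  · simp [E.gram]

omit [FiniteDimensional Kᵐᵒᵖ V] [IsTopologicalRing K] in
/-- A nondegenerate gallery folded at two opposite planes. -/
theorem IsAmbient.fold_plane_of_frame (hA : IsAmbient q) (E : Frame q) {x : Config K V}
    (h0 : (x.1 0).1 = Submodule.span Kᵐᵒᵖ {E.e 1}) (h1 : (x.1 1).1 = Submodule.span Kᵐᵒᵖ {E.e 0})
    (h2 : (x.1 2).1 = Submodule.span Kᵐᵒᵖ {E.e 0}) (h3 : (x.1 3).1 = Submodule.span Kᵐᵒᵖ {E.e 1})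
    (k0 : (x.2 0).1 = Submodule.span Kᵐᵒᵖ {E.e 0, E.e 1})
    (k1 : (x.2 1).1 = Submodule.span Kᵐᵒᵖ {E.e 0, E.e 3})
    (k2 : (x.2 2).1 = Submodule.span Kᵐᵒᵖ {E.e 0, E.e 1})
    (k3 : (x.2 3).1 = Submodule.span Kᵐᵒᵖ {E.e 1, E.e 2}) : x ∈ closure (apartments q) := by
  refine mem_closure_of_four_curves hA.accumulates (fun _ => E.e 1) (fun _ => E.e 0)
    (fun t => E.e 0 + E.e 3 <• t) (fun t => E.e 1 - E.e 2 <• t)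
    (fun _ => E.e 1) (fun _ => E.e 0)
    (fun _ => E.e 0) (fun _ => E.e 3)
    (fun t => E.e 0 + E.e 3 <• t) (fun t => E.e 1 - E.e 2 <• t)
    (fun _ => E.e 1) (fun _ => E.e 2)
    (by simpa using h0) (by simpa using h1) (by simpa using h2) (by simpa using h3)
    (by simpa [Set.pair_comm] using k0) (by simpa using k1) (by simpa using k2)
    (by simpa using k3) ?_ (fun _ _ => rfl) ?_ (fun _ _ => rfl) ?_
  · rintro t ⟨ht0, hσt, -⟩
    apply IsMarked.of_vectors <;> simp [E.gram, hσt, ht0]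
  · intro t ht
    exact span_pair_eq (x := 1) ht.1 (by simp)
  · intro t ht
    rw [Set.pair_comm (E.e 1 - _)]
    exact span_pair_eq (x := 1) (y := -t) (neg_ne_zero.2 ht.1) (by simp [sub_eq_add_neg])

omit [FiniteDimensional Kᵐᵒᵖ V] in
/-- A nondegenerate gallery that visits a line three times. The two new lines are chosen in such a
way that the plane `⟨e 0, w⟩` is reached as the limit of the span of their difference. -/
theorem IsAmbient.fork_line_of_frame (hA : IsAmbient q) (E : Frame q) {w : V} (hww : q w w = 0)
    (w0 : q (E.e 0) w = 0) (w1 : q (E.e 1) w = 1) (w2 : q (E.e 2) w = 0)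
    (w3 : q (E.e 3) w ≠ 0) {x : Config K V}
    (h0 : (x.1 0).1 = Submodule.span Kᵐᵒᵖ {E.e 0}) (h1 : (x.1 1).1 = Submodule.span Kᵐᵒᵖ {E.e 1})
    (h2 : (x.1 2).1 = Submodule.span Kᵐᵒᵖ {E.e 0}) (h3 : (x.1 3).1 = Submodule.span Kᵐᵒᵖ {E.e 0})
    (k0 : (x.2 0).1 = Submodule.span Kᵐᵒᵖ {E.e 0, E.e 1})
    (k1 : (x.2 1).1 = Submodule.span Kᵐᵒᵖ {E.e 0, E.e 1})
    (k2 : (x.2 2).1 = Submodule.span Kᵐᵒᵖ {E.e 0, w})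
    (k3 : (x.2 3).1 = Submodule.span Kᵐᵒᵖ {E.e 0, E.e 3}) : x ∈ closure (apartments q) := by
  set κ := q (E.e 3) w with hκ
  have w0' := q.swap_eq_zero w0
  have w1' : q w (E.e 1) = 1 := by rw [q.hermitian _ w, w1, σ.map_one]
  have w2' := q.swap_eq_zero w2
  have w3' : q w (E.e 3) = σ κ := q.hermitian _ w
  refine mem_closure_of_four_curves hA.accumulates (fun _ => E.e 0) (fun _ => E.e 1)
    (fun t => E.e 0 + (E.e 3 - w) <• t + E.e 2 <• (κ * (t * t))) (fun t => E.e 0 + E.e 3 <• t)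
    (fun _ => E.e 0) (fun _ => E.e 1)
    (fun _ => E.e 1) (fun t => E.e 0 + (E.e 3 - w) <• t + E.e 2 <• (κ * (t * t)))
    (fun t => E.e 0 + E.e 3 <• t) (fun t => w - E.e 2 <• (κ * t))
    (fun _ => E.e 0) (fun _ => E.e 3)
    (by simpa using h0) (by simpa using h1) (by simpa using h2) (by simpa using h3)
    (by simpa using k0) (by simpa [Set.pair_comm] using k1) (by simpa using k2)
    (by simpa using k3) ?_ (fun _ _ => rfl) (fun _ _ => rfl) ?_ ?_
  · rintro t ⟨ht0, hσt, htc⟩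
    have c1 : ∀ y, t * (y * t) = y * (t * t) := fun y => by rw [← mul_assoc, htc, mul_assoc]
    have c2 : ∀ y, t * (t * y) = y * (t * t) := fun y => by rw [htc y, c1]
    have hn : κ * (t * t) ≠ 0 := mul_ne_zero w3 (mul_ne_zero ht0 ht0)
    apply IsMarked.of_vectors
    · simp [E.gram]
    · simp [E.gram]
    · simp only [HermitianForm.map_add_left, HermitianForm.map_add_right,
        HermitianForm.map_sub_left, HermitianForm.map_sub_right, HermitianForm.map_smul_left,
        HermitianForm.map_smul_right, MulOpposite.unop_op, E.gram, hww, w0, w2, w0', w2', w3', ← hκ,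
        σ.map_mul, hσt, mul_assoc, sub_mul, mul_sub, add_mul, c1 κ, c1 (σ κ), c2 (σ κ)]
      simp
      abel
    · simp [E.gram]
    · simp [E.gram]
    · simp [E.gram, w1]
    · simp [E.gram, w0', w3', hσt, mul_assoc, c1, c2]
    · simp [E.gram]
    · simpa [E.gram, w0] using hn
    · simpa [E.gram] using ht0
  · intro t ht
    rw [Set.pair_comm (_ + _ + _)]
    refine span_pair_eq (x := 1) (y := -t) (neg_ne_zero.2 ht.1) ?_
    simp only [MulOpposite.op_one, one_smul, MulOpposite.op_neg, smul_sub, neg_smul,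
      op_smul_op_smul, mul_assoc]
    abel
  · intro t ht
    rw [Set.pair_comm (_ + _)]
    exact span_pair_eq (x := 1) ht.1 (by simp)

/-- A nondegenerate gallery that visits a plane three times. -/
theorem IsAmbient.fork_plane_of_frame (hA : IsAmbient q) (E : Frame q) {x : Config K V}
    (h0 : (x.1 0).1 = Submodule.span Kᵐᵒᵖ {E.e 1 + E.e 0})
    (h1 : (x.1 1).1 = Submodule.span Kᵐᵒᵖ {E.e 0})
    (h2 : (x.1 2).1 = Submodule.span Kᵐᵒᵖ {E.e 0}) (h3 : (x.1 3).1 = Submodule.span Kᵐᵒᵖ {E.e 1})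
    (k0 : (x.2 0).1 = Submodule.span Kᵐᵒᵖ {E.e 0, E.e 1})
    (k1 : (x.2 1).1 = Submodule.span Kᵐᵒᵖ {E.e 0, E.e 3})
    (k2 : (x.2 2).1 = Submodule.span Kᵐᵒᵖ {E.e 0, E.e 1})
    (k3 : (x.2 3).1 = Submodule.span Kᵐᵒᵖ {E.e 0, E.e 1}) : x ∈ closure (apartments q) := by
  obtain ⟨v, hv, -, hvv⟩ := hA.exists_perp E
  obtain ⟨k, hσk, hk⟩ := q.exists_half hA.two_ne_zero v
  have hk0 : k ≠ 0 := by
    rintro rfl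
    exact hvv (by simpa using hk)
  have hv' := fun i => q.swap_eq_zero (hv i)
  have k3' : Submodule.span Kᵐᵒᵖ {E.e 0, E.e 1} = Submodule.span Kᵐᵒᵖ {E.e 1, E.e 1 + E.e 0} := by
    rw [Set.pair_comm]
    exact span_pair_eq (x := 1) one_ne_zero (by simp)
  have k0' : Submodule.span Kᵐᵒᵖ {E.e 0, E.e 1} = Submodule.span Kᵐᵒᵖ {E.e 0, E.e 1 + E.e 0} :=
    span_pair_eq (x := 1) one_ne_zero (by simp [add_comm])
  refine mem_closure_of_four_curves hA.accumulates (fun _ => E.e 1 + E.e 0) (fun _ => E.e 0)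
    (fun t => E.e 0 - E.e 3 <• (k * (t * t)))
    (fun t => E.e 1 + E.e 2 <• (k * (t * t)) - E.e 3 <• (k * (t * t)) + v <• t)
    (fun _ => E.e 1 + E.e 0) (fun _ => E.e 0)
    (fun _ => E.e 0) (fun _ => E.e 3)
    (fun t => E.e 0 - E.e 3 <• (k * (t * t)))
    (fun t => E.e 1 + E.e 2 <• (k * (t * t)) - E.e 3 <• (k * (t * t)) + v <• t)
    (fun t => E.e 1 + E.e 2 <• (k * (t * t)) - E.e 3 <• (k * (t * t)) + v <• t)
    (fun _ => E.e 1 + E.e 0)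
    (by simpa using h0) (by simpa using h1) (by simpa using h2) (by simpa using h3)
    ((k0.trans k0').trans (by rw [Set.pair_comm])) (by simpa using k1) (by simpa using k2)
    (by simpa using k3.trans k3') ?_ (fun _ _ => rfl) ?_ (fun _ _ => rfl) (fun _ _ => rfl)
  · rintro t ⟨ht0, hσt, htc⟩
    have c1 : t * (k * t) = k * (t * t) := by rw [← mul_assoc, htc, mul_assoc]
    have c2 : t * (t * k) = k * (t * t) := by rw [htc k, c1]
    have hn : k * (t * t) ≠ 0 := mul_ne_zero hk0 (mul_ne_zero ht0 ht0)
    apply IsMarked.of_vectors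
    · simp [E.gram]
    · simp [E.gram]
    · simp [E.gram]
    · simp [E.gram, hv _, hv' _, hσt, hσk, hk, mul_assoc, mul_add, add_mul, c1, c2]
    · simp [E.gram]
    · simp [E.gram]
    · simp [E.gram, hv _, hσt, hσk, mul_assoc, c2]
    · simp [E.gram, hv _]
    · simpa [E.gram] using hn
    · simpa [E.gram, hv _] using hn
  · intro t ht
    refine span_pair_eq (x := 1) (y := -(k * (t * t)))
      (neg_ne_zero.2 (mul_ne_zero hk0 (mul_ne_zero ht.1 ht.1))) ?_
    rw [MulOpposite.op_neg, neg_smul, MulOpposite.op_one, one_smul, sub_eq_add_neg]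

end Form

section Form

variable {K : Type*} [DivisionRing K] {σ : AntiInvolution K}
  {V : Type*} [AddCommGroup V] [Module Kᵐᵒᵖ V]

/-- Two distinct lines of a plane are spanned by the members of a basis. -/
theorem exists_basis_of_lines {c l : Gr K V 1} {p : Gr K V 2} (hc : c.1 ≤ p.1) (hl : l.1 ≤ p.1)
    (hne : l ≠ c) : ∃ e₀ e₁ : V, e₀ ≠ 0 ∧ e₁ ∉ Submodule.span Kᵐᵒᵖ {e₀} ∧
      c.1 = Submodule.span Kᵐᵒᵖ {e₀} ∧ l.1 = Submodule.span Kᵐᵒᵖ {e₁} ∧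
      p.1 = Submodule.span Kᵐᵒᵖ {e₀, e₁} ∧ e₀ ∈ c.1 ∧ e₁ ∈ l.1 := by
  obtain ⟨e₀, h0, hc0⟩ := exists_eq_span_singleton c.2
  obtain ⟨e₁, h1, hl1⟩ := exists_eq_span_singleton l.2
  have m0 : e₀ ∈ c.1 := hc0 ▸ Submodule.mem_span_singleton_self e₀
  have m1 : e₁ ∈ l.1 := hl1 ▸ Submodule.mem_span_singleton_self e₁
  have hi : e₁ ∉ Submodule.span Kᵐᵒᵖ {e₀} := fun h => hne (Subtype.ext (by
    rw [hl1, hc0, span_singleton_eq_of_mem h h1]))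
  exact ⟨e₀, e₁, h0, hi, hc0, hl1, eq_span_pair p.2 (hc m0) (hl m1) h0 hi, m0, m1⟩

theorem notMem_span_smul {u w : V} {x : K} (hx : x ≠ 0) (h : w ∉ Submodule.span Kᵐᵒᵖ {u}) :
    w <• x ∉ Submodule.span Kᵐᵒᵖ {u} := fun h' => h (by
  have := Submodule.smul_mem _ (MulOpposite.op x⁻¹) h'
  rwa [smul_inv_cancel_right hx] at this)

variable [TopologicalSpace V] {q : HermitianForm σ V}

theorem continuous_config {X : Type*} [TopologicalSpace X] {l₀ l₁ l₂ l₃ : X → Gr K V 1}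
    {p₀ p₁ p₂ p₃ : X → Gr K V 2} (h0 : Continuous l₀ := by fun_prop)
    (h1 : Continuous l₁ := by fun_prop) (h2 : Continuous l₂ := by fun_prop)
    (h3 : Continuous l₃ := by fun_prop) (k0 : Continuous p₀ := by fun_prop)
    (k1 : Continuous p₁ := by fun_prop) (k2 : Continuous p₂ := by fun_prop)
    (k3 : Continuous p₃ := by fun_prop) : Continuous fun x : X =>
      ((![l₀ x, l₁ x, l₂ x, l₃ x], ![p₀ x, p₁ x, p₂ x, p₃ x]) : Config K V) := by
  refine Continuous.prodMk (continuous_pi fun i => ?_) (continuous_pi fun i => ?_) <;>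
  fin_cases i <;> assumption

/-- Limits of limits of apartments are limits of apartments. -/
theorem mem_closure_apartments_of_map {X : Type*} [TopologicalSpace X] {Φ : X → Config K V}
    (hΦ : Continuous Φ) {y : X} {N : Set X} (hy : y ∈ closure N)
    (h : ∀ z ∈ N, Φ z ∈ closure (apartments q)) : Φ y ∈ closure (apartments q) := by
  rw [← closure_closure]
  exact map_mem_closure hΦ hy h

variable [TopologicalSpace K] [IsTopologicalRing K] [IsTopologicalAddGroup V]
  [ContinuousSMul Kᵐᵒᵖ V] [FiniteDimensional Kᵐᵒᵖ V]

theorem IsAmbient.fold_line_of_ne (hA : IsAmbient q) {c l l' : Gr K V 1} {p p' : Gr K V 2}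
    (hp : q.IsTotallyIsotropic p.1) (hp' : q.IsTotallyIsotropic p'.1) (hc : c.1 ≤ p.1)
    (hl : l.1 ≤ p.1) (hc' : c.1 ≤ p'.1) (hl' : l'.1 ≤ p'.1) (h1 : l ≠ c) (h2 : l' ≠ c)
    (h3 : p' ≠ p) : ((![c, l, c, l'], ![p, p, p', p']) : Config K V) ∈ closure (apartments q) := by
  obtain ⟨e₀, e₁, h0, hi, hce, hle, hpe, m0, m1⟩ := exists_basis_of_lines hc hl h1
  obtain ⟨w, hw0, hwl⟩ := exists_eq_span_singleton l'.2
  have mw : w ∈ l'.1 := hwl ▸ Submodule.mem_span_singleton_self w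
  have hwi : w ∉ Submodule.span Kᵐᵒᵖ {e₀} := fun h => h2 (Subtype.ext (by
    rw [hwl, hce, span_singleton_eq_of_mem h hw0]))
  have hne := hA.witt.ne_zero_of_planes_ne hp hp' p.2 p'.2 (fun h => h3 (Subtype.ext h.symm)) h0
    (hc m0) (hc' m0) (hl m1) (hl' mw) hi hwi
  have hinv := inv_ne_zero hne
  set e₃ := w <• (q e₁ w)⁻¹ with he₃
  have m3 : e₃ ∈ l'.1 := l'.1.smul_mem _ mw
  have h13 : q e₁ e₃ = 1 := by simp [he₃, mul_inv_cancel₀ hne]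
  have h00 := hp _ (hc m0) _ (hc m0)
  have h01 := hp _ (hc m0) _ (hl m1)
  have h11 := hp _ (hl m1) _ (hl m1)
  have h03 := hp' _ (hc' m0) _ (hl' m3)
  have h33 := hp' _ (hl' m3) _ (hl' m3)
  obtain ⟨e₂, h22, h02, h12, h32⟩ :=
    hA.nondegenerate.exists_fourth hA.two_ne_zero h0 h00 h01 h03 h11 h33 h13
  have hp'e := eq_span_pair p'.2 (hc' m0) (hl' m3) h0 (notMem_span_smul hinv hwi)
  exact hA.fold_line_of_frame (Frame.mk' h00 h11 h22 h33 h01 h03 h12 h32 h02 h13)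
    hce hle hce (hwl.trans (span_singleton_smul hinv w).symm) hpe hpe hp'e hp'e

/-- Galleries folded at two opposite lines are limits of apartments. -/
theorem IsAmbient.fold_line (hA : IsAmbient q) {c l l' : Gr K V 1} {p p' : Gr K V 2}
    (hp : q.IsTotallyIsotropic p.1) (hp' : q.IsTotallyIsotropic p'.1) (hc : c.1 ≤ p.1)
    (hl : l.1 ≤ p.1) (hc' : c.1 ≤ p'.1) (hl' : l'.1 ≤ p'.1) :
    ((![c, l, c, l'], ![p, p, p', p']) : Config K V) ∈ closure (apartments q) := by
  have step1 : ∀ l l' : Gr K V 1, l.1 ≤ p.1 → l'.1 ≤ p'.1 → l ≠ c → l' ≠ c →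
      ((![c, l, c, l'], ![p, p, p', p']) : Config K V) ∈ closure (apartments q) := by
    intro l l' hl hl' h1 h2
    by_cases h3 : p' = p
    · subst h3
      refine mem_closure_apartments_of_map (y := (l', p'))
        (Φ := fun z : Gr K V 1 × Gr K V 2 => (![c, l, c, z.1], ![p', p', z.2, z.2]))
        continuous_config (Gr.mem_closure_planes_through hA.accumulates hA.nondegenerate hA.witt
          hA.two_ne_zero hA.five_le hp hp hc hc hl' h2) fun z hz => ?_
      exact hA.fold_line_of_ne hp hz.1 hc hl hz.2.1 hz.2.2.1 h1 hz.2.2.2.1 hz.2.2.2.2.1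
    · exact hA.fold_line_of_ne hp hp' hc hl hc' hl' h1 h2 h3
  have step2 : ∀ l l' : Gr K V 1, l.1 ≤ p.1 → l'.1 ≤ p'.1 → l ≠ c →
      ((![c, l, c, l'], ![p, p, p', p']) : Config K V) ∈ closure (apartments q) := by
    intro l l' hl hl' h1
    by_cases h2 : l' = c
    · refine mem_closure_apartments_of_map (Φ := fun z => (![c, l, c, z], ![p, p, p', p']))
        continuous_config (Gr.mem_closure_lines hA.accumulates hl' hc') fun z hz => ?_
      exact step1 l z hl hz.1 h1 hz.2.2
    · exact step1 l l' hl hl' h1 h2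
  by_cases h1 : l = c
  · refine mem_closure_apartments_of_map (Φ := fun z => (![c, z, c, l'], ![p, p, p', p']))
      continuous_config (Gr.mem_closure_lines hA.accumulates hl hc) fun z hz => ?_
    exact step2 z l' hz.1 hl' hz.2.2
  · exact step2 l l' hl hl' h1

omit [IsTopologicalRing K] in
theorem IsAmbient.fold_plane_of_ne (hA : IsAmbient q) {c p p' : Gr K V 2} {y z : Gr K V 1}
    (hc : q.IsTotallyIsotropic c.1) (hp : q.IsTotallyIsotropic p.1)
    (hp' : q.IsTotallyIsotropic p'.1) (hyc : y.1 ≤ c.1) (hzc : z.1 ≤ c.1) (hyp : y.1 ≤ p.1)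
    (hzp : z.1 ≤ p'.1) (h1 : p ≠ c) (h2 : p' ≠ c) (h3 : z ≠ y) :
    ((![z, y, y, z], ![c, p, c, p']) : Config K V) ∈ closure (apartments q) := by
  obtain ⟨e₀, e₁, h0, hi, hye, hze, hce, m0, m1⟩ := exists_basis_of_lines hyc hzc h3
  have hi' : e₀ ∉ Submodule.span Kᵐᵒᵖ {e₁} := fun h => hi (by
    rw [← span_singleton_eq_of_mem h h0]
    exact Submodule.mem_span_singleton_self e₁)
  have h1' : e₁ ≠ 0 := fun h => hi (h ▸ Submodule.zero_mem _)
  obtain ⟨w, hw, hwy⟩ := exists_mem_notMem y.2 p.2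
  obtain ⟨w', hw', hwz⟩ := exists_mem_notMem z.2 p'.2
  rw [hye] at hwy
  rw [hze] at hwz
  have hne := hA.witt.ne_zero_of_planes_ne hc hp c.2 p.2 (fun h => h1 (Subtype.ext h.symm)) h0
    (hyc m0) (hyp m0) (hzc m1) hw hi hwy
  have hne' := hA.witt.ne_zero_of_planes_ne hc hp' c.2 p'.2 (fun h => h2 (Subtype.ext h.symm)) h1'
    (hzc m1) (hzp m1) (hyc m0) hw' hi' hwz
  have hinv := inv_ne_zero hne
  have hinv' := inv_ne_zero hne'
  set e₃ := w <• (q e₁ w)⁻¹ with he₃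
  have m3 : e₃ ∈ p.1 := p.1.smul_mem _ hw
  have h13 : q e₁ e₃ = 1 := by simp [he₃, mul_inv_cancel₀ hne]
  have h31 : q e₃ e₁ = 1 := by rw [q.hermitian e₁ e₃, h13, σ.map_one]
  set w'' := w' <• (q e₀ w')⁻¹ with hw''
  have mw'' : w'' ∈ p'.1 := p'.1.smul_mem _ hw'
  set e₂ := w'' - e₁ <• q e₃ w'' with he₂
  have m2 : e₂ ∈ p'.1 := p'.1.sub_mem mw'' (p'.1.smul_mem _ (hzp m1))
  have h00 := hc _ (hyc m0) _ (hyc m0)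
  have h01 := hc _ (hyc m0) _ (hzc m1)
  have h11 := hc _ (hzc m1) _ (hzc m1)
  have h03 := hp _ (hyp m0) _ m3
  have h33 := hp _ m3 _ m3
  have h12 := hp' _ (hzp m1) _ m2
  have h22 := hp' _ m2 _ m2
  have h02 : q e₀ e₂ = 1 := by simp [he₂, h01, hw'', mul_inv_cancel₀ hne']
  have h32 : q e₃ e₂ = 0 := by simp [he₂, h31]
  have hw''i := notMem_span_smul hinv' hwz
  have h2i : e₂ ∉ Submodule.span Kᵐᵒᵖ {e₁} := fun h => hw''i (by
    have := Submodule.add_mem _ h (Submodule.smul_mem _ (MulOpposite.op (q e₃ w''))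
      (Submodule.mem_span_singleton_self e₁))
    rwa [he₂, sub_add_cancel] at this)
  exact hA.fold_plane_of_frame (Frame.mk' h00 h11 h22 h33 h01 h03 h12 h32 h02 h13)
    hze hye hye hze hce (eq_span_pair p.2 (hyp m0) m3 h0 (notMem_span_smul hinv hwy)) hce
    (eq_span_pair p'.2 (hzp m1) m2 h1' h2i)

/-- Galleries folded at two opposite planes are limits of apartments. -/
theorem IsAmbient.fold_plane (hA : IsAmbient q) {c p p' : Gr K V 2} {y z : Gr K V 1}
    (hc : q.IsTotallyIsotropic c.1) (hp : q.IsTotallyIsotropic p.1)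
    (hp' : q.IsTotallyIsotropic p'.1) (hyc : y.1 ≤ c.1) (hzc : z.1 ≤ c.1) (hyp : y.1 ≤ p.1)
    (hzp : z.1 ≤ p'.1) :
    ((![z, y, y, z], ![c, p, c, p']) : Config K V) ∈ closure (apartments q) := by
  have step1 : ∀ p p' : Gr K V 2, q.IsTotallyIsotropic p.1 → q.IsTotallyIsotropic p'.1 →
      y.1 ≤ p.1 → z.1 ≤ p'.1 → p ≠ c → p' ≠ c →
      ((![z, y, y, z], ![c, p, c, p']) : Config K V) ∈ closure (apartments q) := by
    intro p p' hp hp' hyp hzp h1 h2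
    by_cases h3 : z = y
    · subst h3
      refine mem_closure_apartments_of_map (y := (z, p))
        (Φ := fun x : Gr K V 1 × Gr K V 2 => (![z, x.1, x.1, z], ![c, x.2, c, p']))
        continuous_config (Gr.mem_closure_flags_along hA.accumulates hA.nondegenerate hA.witt
          hA.two_ne_zero hc hp hyc hyp h1) fun x hx => ?_
      exact hA.fold_plane_of_ne hc hx.1 hp' hx.2.1 hzc hx.2.2.1 hzp hx.2.2.2.2 h2
        hx.2.2.2.1.symm
    · exact hA.fold_plane_of_ne hc hp hp' hyc hzc hyp hzp h1 h2 h3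
  have step2 : ∀ p p' : Gr K V 2, q.IsTotallyIsotropic p.1 → q.IsTotallyIsotropic p'.1 →
      y.1 ≤ p.1 → z.1 ≤ p'.1 → p ≠ c →
      ((![z, y, y, z], ![c, p, c, p']) : Config K V) ∈ closure (apartments q) := by
    intro p p' hp hp' hyp hzp h1
    by_cases h2 : p' = c
    · refine mem_closure_apartments_of_map (Φ := fun x => (![z, y, y, z], ![c, p, c, x]))
        continuous_config (Gr.mem_closure_planes hA.accumulates hA.nondegenerate hA.witt
          hA.two_ne_zero hA.five_le hp' hc hzp hzc) fun x hx => ?_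
      exact step1 p x hp hx.1 hyp hx.2.1 h1 hx.2.2.2
    · exact step1 p p' hp hp' hyp hzp h1 h2
  by_cases h1 : p = c
  · refine mem_closure_apartments_of_map (Φ := fun x => (![z, y, y, z], ![c, x, c, p']))
      continuous_config (Gr.mem_closure_planes hA.accumulates hA.nondegenerate hA.witt
        hA.two_ne_zero hA.five_le hp hc hyp hyc) fun x hx => ?_
    exact step2 x p' hx.1 hp' hx.2.1 hzp hx.2.2.2
  · exact step2 p p' hp hp' hyp hzp h1

theorem IsAmbient.fork_line_of_ne (hA : IsAmbient q) {c l : Gr K V 1} {p p₂ p₃ : Gr K V 2}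
    (hp : q.IsTotallyIsotropic p.1) (hp₂ : q.IsTotallyIsotropic p₂.1)
    (hp₃ : q.IsTotallyIsotropic p₃.1) (hcp : c.1 ≤ p.1) (hc₂ : c.1 ≤ p₂.1) (hc₃ : c.1 ≤ p₃.1)
    (hlp : l.1 ≤ p.1) (h1 : l ≠ c) (h2 : p₂ ≠ p) (h3 : p₃ ≠ p) (h4 : p₂ ≠ p₃) :
    ((![c, l, c, c], ![p, p, p₂, p₃]) : Config K V) ∈ closure (apartments q) := by
  obtain ⟨e₀, e₁, h0, hi, hce, hle, hpe, m0, m1⟩ := exists_basis_of_lines hcp hlp h1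
  -- both further planes are normalised against `e₁`
  have key : ∀ p' : Gr K V 2, q.IsTotallyIsotropic p'.1 → c.1 ≤ p'.1 → p' ≠ p →
      ∃ w ∈ p'.1, q e₁ w = 1 ∧ w ∉ Submodule.span Kᵐᵒᵖ {e₀} := by
    intro p' hp' hc' hne
    obtain ⟨w, hw, hwc⟩ := exists_mem_notMem c.2 p'.2
    rw [hce] at hwc
    have hne := hA.witt.ne_zero_of_planes_ne hp hp' p.2 p'.2 (fun h => hne (Subtype.ext h.symm)) h0
      (hcp m0) (hc' m0) (hlp m1) hw hi hwc
    exact ⟨w <• (q e₁ w)⁻¹, p'.1.smul_mem _ hw, by simp [mul_inv_cancel₀ hne],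
      notMem_span_smul (inv_ne_zero hne) hwc⟩
  obtain ⟨e₃, m3, h13, h3i⟩ := key p₃ hp₃ hc₃ h3
  obtain ⟨u, mu, h1u, hui⟩ := key p₂ hp₂ hc₂ h2
  have h00 := hp _ (hcp m0) _ (hcp m0)
  have h01 := hp _ (hcp m0) _ (hlp m1)
  have h11 := hp _ (hlp m1) _ (hlp m1)
  have h03 := hp₃ _ (hc₃ m0) _ m3
  have h33 := hp₃ _ m3 _ m3
  obtain ⟨e₂, h22, h02, h12, h32⟩ :=
    hA.nondegenerate.exists_fourth hA.two_ne_zero h0 h00 h01 h03 h11 h33 h13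
  have h20 : q e₂ e₀ = 1 := by rw [q.hermitian e₀ e₂, h02, σ.map_one]
  set w := u - e₀ <• q e₂ u with hw
  have mw : w ∈ p₂.1 := p₂.1.sub_mem mu (p₂.1.smul_mem _ (hc₂ m0))
  have hwi : w ∉ Submodule.span Kᵐᵒᵖ {e₀} := fun h => hui (by
    have := Submodule.add_mem _ h (Submodule.smul_mem _ (MulOpposite.op (q e₂ u))
      (Submodule.mem_span_singleton_self e₀))
    rwa [hw, sub_add_cancel] at this)
  have h3w := hA.witt.ne_zero_of_planes_ne hp₃ hp₂ p₃.2 p₂.2 (fun h => h4 (Subtype.ext h.symm)) h0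
      (hc₃ m0) (hc₂ m0) m3 mw h3i hwi
  exact hA.fork_line_of_frame (Frame.mk' h00 h11 h22 h33 h01 h03 h12 h32 h02 h13) (w := w)
    (hp₂ _ mw _ mw) (hp₂ _ (hc₂ m0) _ mw)
    (show q e₁ w = 1 by simp [hw, h1u, q.swap_eq_zero h01])
    (show q e₂ w = 0 by simp [hw, h20]) h3w
    hce hle hce hce hpe hpe (eq_span_pair p₂.2 (hc₂ m0) mw h0 hwi)
    (eq_span_pair p₃.2 (hc₃ m0) m3 h0 h3i)

/-- Galleries that visit a line three times and turn back once are limits of apartments. -/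
theorem IsAmbient.fork_line (hA : IsAmbient q) {c l : Gr K V 1} {p p₂ p₃ : Gr K V 2}
    (hp : q.IsTotallyIsotropic p.1) (hp₂ : q.IsTotallyIsotropic p₂.1)
    (hp₃ : q.IsTotallyIsotropic p₃.1) (hcp : c.1 ≤ p.1) (hc₂ : c.1 ≤ p₂.1) (hc₃ : c.1 ≤ p₃.1)
    (hlp : l.1 ≤ p.1) :
    ((![c, l, c, c], ![p, p, p₂, p₃]) : Config K V) ∈ closure (apartments q) := by
  have move : ∀ {P M : Gr K V 2}, q.IsTotallyIsotropic P.1 → q.IsTotallyIsotropic M.1 →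
      c.1 ≤ P.1 → c.1 ≤ M.1 → P ∈ closure {P' : Gr K V 2 | q.IsTotallyIsotropic P'.1 ∧
        c.1 ≤ P'.1 ∧ P' ≠ P ∧ P' ≠ M} := fun hP hM hcP hcM =>
    Gr.mem_closure_planes hA.accumulates hA.nondegenerate hA.witt hA.two_ne_zero hA.five_le
      hP hM hcP hcM
  have step1 : ∀ (l : Gr K V 1) (p₂ p₃ : Gr K V 2), l.1 ≤ p.1 → q.IsTotallyIsotropic p₂.1 →
      q.IsTotallyIsotropic p₃.1 → c.1 ≤ p₂.1 → c.1 ≤ p₃.1 → l ≠ c → p₂ ≠ p → p₃ ≠ p →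
      ((![c, l, c, c], ![p, p, p₂, p₃]) : Config K V) ∈ closure (apartments q) := by
    intro l p₂ p₃ hlp hp₂ hp₃ hc₂ hc₃ h1 h2 h3
    by_cases h4 : p₂ = p₃
    · refine mem_closure_apartments_of_map (Φ := fun x => (![c, l, c, c], ![p, p, x, p₃]))
        continuous_config (move hp₂ hp hc₂ hcp) fun x hx => ?_
      exact hA.fork_line_of_ne hp hx.1 hp₃ hcp hx.2.1 hc₃ hlp h1 hx.2.2.2 h3 (h4 ▸ hx.2.2.1)
    · exact hA.fork_line_of_ne hp hp₂ hp₃ hcp hc₂ hc₃ hlp h1 h2 h3 h4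
  have step2 : ∀ (l : Gr K V 1) (p₂ p₃ : Gr K V 2), l.1 ≤ p.1 → q.IsTotallyIsotropic p₂.1 →
      q.IsTotallyIsotropic p₃.1 → c.1 ≤ p₂.1 → c.1 ≤ p₃.1 → l ≠ c → p₂ ≠ p →
      ((![c, l, c, c], ![p, p, p₂, p₃]) : Config K V) ∈ closure (apartments q) := by
    intro l p₂ p₃ hlp hp₂ hp₃ hc₂ hc₃ h1 h2
    by_cases h3 : p₃ = p
    · refine mem_closure_apartments_of_map (Φ := fun x => (![c, l, c, c], ![p, p, p₂, x]))
        continuous_config (move hp₃ hp hc₃ hcp) fun x hx => ?_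
      exact step1 l p₂ x hlp hp₂ hx.1 hc₂ hx.2.1 h1 h2 hx.2.2.2
    · exact step1 l p₂ p₃ hlp hp₂ hp₃ hc₂ hc₃ h1 h2 h3
  have step3 : ∀ l : Gr K V 1, l.1 ≤ p.1 → l ≠ c →
      ((![c, l, c, c], ![p, p, p₂, p₃]) : Config K V) ∈ closure (apartments q) := by
    intro l hlp h1
    by_cases h2 : p₂ = p
    · refine mem_closure_apartments_of_map (Φ := fun x => (![c, l, c, c], ![p, p, x, p₃]))
        continuous_config (move hp₂ hp hc₂ hcp) fun x hx => ?_
      exact step2 l x p₃ hlp hx.1 hp₃ hx.2.1 hc₃ h1 hx.2.2.2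
    · exact step2 l p₂ p₃ hlp hp₂ hp₃ hc₂ hc₃ h1 h2
  by_cases h1 : l = c
  · refine mem_closure_apartments_of_map (Φ := fun x => (![c, x, c, c], ![p, p, p₂, p₃]))
      continuous_config (Gr.mem_closure_lines hA.accumulates hlp hcp) fun x hx => ?_
    exact step3 x hx.1 hx.2.2
  · exact step3 l hlp h1

theorem IsAmbient.fork_plane_of_ne (hA : IsAmbient q) {c p : Gr K V 2} {y z₁ z₃ : Gr K V 1}
    (hc : q.IsTotallyIsotropic c.1) (hp : q.IsTotallyIsotropic p.1) (hyc : y.1 ≤ c.1)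
    (hyp : y.1 ≤ p.1) (hz₁ : z₁.1 ≤ c.1) (hz₃ : z₃.1 ≤ c.1) (h1 : p ≠ c) (h2 : z₁ ≠ y)
    (h3 : z₃ ≠ y) (h4 : z₃ ≠ z₁) :
    ((![z₃, y, y, z₁], ![c, p, c, c]) : Config K V) ∈ closure (apartments q) := by
  obtain ⟨u₀, u₁, -, -, hyu, hzu, hcu, -, -⟩ := exists_basis_of_lines hyc hz₁ h2
  obtain ⟨u, hu0, hu⟩ := exists_eq_span_singleton z₃.2
  have mu : u ∈ z₃.1 := hu ▸ Submodule.mem_span_singleton_self u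
  have huc := hz₃ mu
  rw [hcu, mem_span_pair_iff] at huc
  obtain ⟨α, β, rfl⟩ := huc
  -- scale the basis vectors so that the third line is spanned by their sum
  have hα : α ≠ 0 := by
    rintro rfl
    refine h4 (Subtype.ext ?_)
    have hβ : β ≠ 0 := by
      rintro rfl
      simp at hu0
    rw [hu, hzu, MulOpposite.op_zero, zero_smul, zero_add, span_singleton_smul hβ]
  have hβ : β ≠ 0 := by
    rintro rfl
    refine h3 (Subtype.ext ?_)
    rw [hu, hyu, MulOpposite.op_zero, zero_smul, add_zero, span_singleton_smul hα]
  set e₀ := u₀ <• α with he₀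
  set e₁ := u₁ <• β with he₁
  have hye : y.1 = Submodule.span Kᵐᵒᵖ {e₀} := hyu.trans (span_singleton_smul hα u₀).symm
  have hze : z₁.1 = Submodule.span Kᵐᵒᵖ {e₁} := hzu.trans (span_singleton_smul hβ u₁).symm
  have hce : c.1 = Submodule.span Kᵐᵒᵖ {e₀, e₁} := hcu.trans (span_pair_smul hα hβ u₀ u₁).symm
  have m0 : e₀ ∈ y.1 := hye ▸ Submodule.mem_span_singleton_self e₀
  have m1 : e₁ ∈ z₁.1 := hze ▸ Submodule.mem_span_singleton_self e₁
  have h0 : e₀ ≠ 0 := by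
    intro h
    have := y.2
    rw [hye, h, Submodule.span_zero_singleton, finrank_bot] at this
    exact zero_ne_one this
  have h1' : e₁ ≠ 0 := by
    intro h
    have := z₁.2
    rw [hze, h, Submodule.span_zero_singleton, finrank_bot] at this
    exact zero_ne_one this
  have hi : e₁ ∉ Submodule.span Kᵐᵒᵖ {e₀} := fun h => h2 (Subtype.ext (by
    rw [hze, hye, span_singleton_eq_of_mem h h1']))
  obtain ⟨w, hw, hwy⟩ := exists_mem_notMem y.2 p.2
  rw [hye] at hwy
  have hne := hA.witt.ne_zero_of_planes_ne hc hp c.2 p.2 (fun h => h1 (Subtype.ext h.symm)) h0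
    (hyc m0) (hyp m0) (hz₁ m1) hw hi hwy
  have hinv := inv_ne_zero hne
  set e₃ := w <• (q e₁ w)⁻¹ with he₃
  have m3 : e₃ ∈ p.1 := p.1.smul_mem _ hw
  have h13 : q e₁ e₃ = 1 := by simp [he₃, mul_inv_cancel₀ hne]
  have h00 := hc _ (hyc m0) _ (hyc m0)
  have h01 := hc _ (hyc m0) _ (hz₁ m1)
  have h11 := hc _ (hz₁ m1) _ (hz₁ m1)
  have h03 := hp _ (hyp m0) _ m3
  have h33 := hp _ m3 _ m3
  obtain ⟨e₂, h22, h02, h12, h32⟩ :=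
    hA.nondegenerate.exists_fourth hA.two_ne_zero h0 h00 h01 h03 h11 h33 h13
  exact hA.fork_plane_of_frame (Frame.mk' h00 h11 h22 h33 h01 h03 h12 h32 h02 h13)
    (show z₃.1 = Submodule.span Kᵐᵒᵖ {e₁ + e₀} by rw [hu, add_comm]) hye hye hze hce
    (eq_span_pair p.2 (hyp m0) m3 h0 (notMem_span_smul hinv hwy)) hce hce

/-- Galleries that visit a plane three times and turn back once are limits of apartments. -/
theorem IsAmbient.fork_plane (hA : IsAmbient q) {c p : Gr K V 2} {y z₁ z₃ : Gr K V 1}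
    (hc : q.IsTotallyIsotropic c.1) (hp : q.IsTotallyIsotropic p.1) (hyc : y.1 ≤ c.1)
    (hyp : y.1 ≤ p.1) (hz₁ : z₁.1 ≤ c.1) (hz₃ : z₃.1 ≤ c.1) :
    ((![z₃, y, y, z₁], ![c, p, c, c]) : Config K V) ∈ closure (apartments q) := by
  have step1 : ∀ (p : Gr K V 2) (z₁ z₃ : Gr K V 1), q.IsTotallyIsotropic p.1 → y.1 ≤ p.1 →
      z₁.1 ≤ c.1 → z₃.1 ≤ c.1 → p ≠ c → z₁ ≠ y → z₃ ≠ y →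
      ((![z₃, y, y, z₁], ![c, p, c, c]) : Config K V) ∈ closure (apartments q) := by
    intro p z₁ z₃ hp hyp hz₁ hz₃ h1 h2 h3
    by_cases h4 : z₃ = z₁
    · refine mem_closure_apartments_of_map (Φ := fun x => (![x, y, y, z₁], ![c, p, c, c]))
        continuous_config (Gr.mem_closure_lines hA.accumulates hz₃ hyc) fun x hx => ?_
      exact hA.fork_plane_of_ne hc hp hyc hyp hz₁ hx.1 h1 h2 hx.2.2 (h4 ▸ hx.2.1)
    · exact hA.fork_plane_of_ne hc hp hyc hyp hz₁ hz₃ h1 h2 h3 h4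
  have step2 : ∀ (p : Gr K V 2) (z₁ z₃ : Gr K V 1), q.IsTotallyIsotropic p.1 → y.1 ≤ p.1 →
      z₁.1 ≤ c.1 → z₃.1 ≤ c.1 → p ≠ c → z₁ ≠ y →
      ((![z₃, y, y, z₁], ![c, p, c, c]) : Config K V) ∈ closure (apartments q) := by
    intro p z₁ z₃ hp hyp hz₁ hz₃ h1 h2
    by_cases h3 : z₃ = y
    · refine mem_closure_apartments_of_map (Φ := fun x => (![x, y, y, z₁], ![c, p, c, c]))
        continuous_config (Gr.mem_closure_lines hA.accumulates hz₃ hyc) fun x hx => ?_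
      exact step1 p z₁ x hp hyp hz₁ hx.1 h1 h2 hx.2.2
    · exact step1 p z₁ z₃ hp hyp hz₁ hz₃ h1 h2 h3
  have step3 : ∀ p : Gr K V 2, q.IsTotallyIsotropic p.1 → y.1 ≤ p.1 → p ≠ c →
      ((![z₃, y, y, z₁], ![c, p, c, c]) : Config K V) ∈ closure (apartments q) := by
    intro p hp hyp h1
    by_cases h2 : z₁ = y
    · refine mem_closure_apartments_of_map (Φ := fun x => (![z₃, y, y, x], ![c, p, c, c]))
        continuous_config (Gr.mem_closure_lines hA.accumulates hz₁ hyc) fun x hx => ?_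
      exact step2 p x z₃ hp hyp hx.1 hz₃ h1 hx.2.2
    · exact step2 p z₁ z₃ hp hyp hz₁ hz₃ h1 h2
  by_cases h1 : p = c
  · refine mem_closure_apartments_of_map (Φ := fun x => (![z₃, y, y, z₁], ![c, x, c, c]))
      continuous_config (Gr.mem_closure_planes hA.accumulates hA.nondegenerate hA.witt
        hA.two_ne_zero hA.five_le hp hc hyp hyc) fun x hx => ?_
    exact step3 x hx.1 hx.2.1 hx.2.2.2
  · exact step3 p hp hyp h1

end Form

section Form

variable {K : Type*} [DivisionRing K] {σ : AntiInvolution K}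
  {V : Type*} [AddCommGroup V] [Module Kᵐᵒᵖ V]

/-- The gallery visits four distinct planes through one line. -/
def IsLineStar (x : Config K V) : Prop := (∀ i, x.1 i = x.1 0) ∧ Function.Injective x.2

/-- The gallery visits four distinct lines of one plane. -/
def IsPlaneStar (x : Config K V) : Prop := (∀ i, x.2 i = x.2 0) ∧ Function.Injective x.1

theorem injective_of_fin_four {X : Type*} {g : Fin 4 → X} (h1 : ∀ i, g i ≠ g (i + 1))
    (h02 : g 0 ≠ g 2) (h13 : g 1 ≠ g 3) : Function.Injective g := by
  have h2 : ∀ i, g i ≠ g (i + 2) := by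
    intro i
    fin_cases i
    exacts [h02, h13, h02.symm, h13.symm]
  intro i j hij
  have : i = j ∨ j = i + 1 ∨ j = i + 2 ∨ i = j + 1 := by
    clear * -
    revert i j
    decide
  rcases this with h | rfl | rfl | rfl
  exacts [h, absurd hij (h1 i), absurd hij (h2 i), absurd hij.symm (h1 j)]

theorem exists_eq_of_not_injective {X : Type*} {g : Fin 4 → X} (h : ¬ Function.Injective g) :
    (∃ i, g i = g (i + 1)) ∨ g 0 = g 2 ∨ g 1 = g 3 := by
  by_contra! h'
  exact h (injective_of_fin_four h'.1 h'.2.1 h'.2.2)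

theorem Gr.plane_eq_of_lines {L L' : Gr K V 1} {P P' : Gr K V 2} (h : L' ≠ L) (h1 : L.1 ≤ P.1)
    (h2 : L'.1 ≤ P.1) (h1' : L.1 ≤ P'.1) (h2' : L'.1 ≤ P'.1) : P = P' := by
  obtain ⟨e₀, e₁, -, -, h0, h1, hP, -⟩ := exists_basis_of_lines h1 h2 h
  obtain ⟨u₀, u₁, h0', hi', hL, hL', hP', m0, m1⟩ := exists_basis_of_lines h1' h2' h
  refine Subtype.ext ((eq_span_pair P.2 ?_ ?_ h0' hi').trans hP'.symm)
  exacts [‹L.1 ≤ P.1› m0, h2 m1]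

theorem Config.eq_of_components {x : Config K V} {l₀ l₁ l₂ l₃ : Gr K V 1} {p₀ p₁ p₂ p₃ : Gr K V 2}
    (h0 : x.1 0 = l₀) (h1 : x.1 1 = l₁) (h2 : x.1 2 = l₂) (h3 : x.1 3 = l₃) (k0 : x.2 0 = p₀)
    (k1 : x.2 1 = p₁) (k2 : x.2 2 = p₂) (k3 : x.2 3 = p₃) :
    x = (![l₀, l₁, l₂, l₃], ![p₀, p₁, p₂, p₃]) := by
  refine Prod.ext (funext fun i => ?_) (funext fun i => ?_) <;> fin_cases i <;> assumption

section Walk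

variable [FiniteDimensional Kᵐᵒᵖ V] {q : HermitianForm σ V}

/-- There are no triangles in the building. -/
theorem Gr.plane_eq_of_triangle (hW : q.HasWittIndexTwo) {A B C : Gr K V 1} {P Q R : Gr K V 2}
    (hP : q.IsTotallyIsotropic P.1) (hQ : q.IsTotallyIsotropic Q.1)
    (hR : q.IsTotallyIsotropic R.1) (hAP : A.1 ≤ P.1) (hBP : B.1 ≤ P.1) (hAR : A.1 ≤ R.1)
    (hCR : C.1 ≤ R.1) (hBQ : B.1 ≤ Q.1) (hCQ : C.1 ≤ Q.1) (hAB : B ≠ A) (hAC : C ≠ A) :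
    P = R := by
  by_contra hne
  obtain ⟨a, b, ha, hb, hA, -, -, ma, mb⟩ := exists_basis_of_lines hAP hBP hAB
  obtain ⟨a', c, -, hc, hA', -, -, -, mc⟩ := exists_basis_of_lines hAR hCR hAC
  rw [← hA', hA] at hc
  exact hW.ne_zero_of_planes_ne hP hR P.2 R.2 (fun h => hne (Subtype.ext h)) ha (hAP ma) (hAR ma)
    (hBP mb) (hCR mc) hb hc (hQ _ (hBQ mb) _ (hCQ mc))

/-- A closed gallery with repetitions passes through the same vertex at two opposite times. -/
theorem IsWalk.exists_opposite_eq (hW : q.HasWittIndexTwo) {x : Config K V} (hx : IsWalk q x)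
    (hn : x ∉ apartments q) :
    x.1 0 = x.1 2 ∨ x.1 1 = x.1 3 ∨ x.2 0 = x.2 2 ∨ x.2 1 = x.2 3 := by
  by_contra! h
  obtain ⟨l02, l13, p02, p13⟩ := h
  have hl2 : ∀ i, x.1 i ≠ x.1 (i + 2) := by
    intro i
    fin_cases i
    exacts [l02, l13, l02.symm, l13.symm]
  have hp2 : ∀ i, x.2 i ≠ x.2 (i + 2) := by
    intro i
    fin_cases i
    exacts [p02, p13, p02.symm, p13.symm]
  have hl : ∀ i, x.1 i ≠ x.1 (i + 1) := by
    intro i h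
    have e3 : i + 1 + 2 = i + 3 := by rw [add_assoc]; rfl
    have e4 : i + 3 + 1 = i := by rw [add_assoc]; exact add_zero i
    have e2 : i + 2 + 1 = i + 3 := by rw [add_assoc]; rfl
    have e1 : i + 1 + 1 = i + 2 := by rw [add_assoc]; rfl
    have h3 : x.1 (i + 3) ≠ x.1 i := by
      rw [h, ← e3]
      exact (hl2 (i + 1)).symm
    have := Gr.plane_eq_of_triangle hW (hx.isotropic (i + 1)) (hx.isotropic (i + 2))
      (hx.isotropic (i + 3)) (A := x.1 i) (B := x.1 (i + 2)) (C := x.1 (i + 3))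
      (by rw [h]; exact hx.le _) (by rw [← e1]; exact hx.succ_le _)
      (by conv_lhs => rw [← e4]
          exact hx.succ_le (i + 3)) (hx.le _) (hx.le _)
      (by rw [← e2]; exact hx.succ_le _) (hl2 i).symm h3
    rw [← e3] at this
    exact hp2 _ this
  have hp : ∀ i, x.2 i ≠ x.2 (i + 1) := by
    intro i h
    have e3 : i + 1 + 2 = i + 3 := by rw [add_assoc]; rfl
    have e4 : i + 3 + 1 = i := by rw [add_assoc]; exact add_zero i
    have e2 : i + 2 + 1 = i + 3 := by rw [add_assoc]; rfl
    have e1 : i + 1 + 1 = i + 2 := by rw [add_assoc]; rfl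
    have := Gr.plane_eq_of_triangle hW (hx.isotropic i) (hx.isotropic (i + 2))
      (hx.isotropic (i + 3)) (A := x.1 i) (B := x.1 (i + 2)) (C := x.1 (i + 3))
      (hx.le i) (by rw [h, ← e1]; exact hx.succ_le _)
      (by conv_lhs => rw [← e4]
          exact hx.succ_le (i + 3)) (hx.le _) (hx.le _)
      (by rw [← e2]; exact hx.succ_le _) (hl2 i).symm
      (by conv_rhs => rw [← e4]
          exact hl (i + 3))
    rw [h, ← e3] at this
    exact hp2 _ this
  exact hn ⟨hx, injective_of_fin_four hl l02 l13, injective_of_fin_four hp p02 p13⟩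

end Walk

variable [TopologicalSpace V] [TopologicalSpace K] [IsTopologicalRing K]
  [IsTopologicalAddGroup V] [ContinuousSMul Kᵐᵒᵖ V] [FiniteDimensional Kᵐᵒᵖ V]
  {q : HermitianForm σ V}

theorem IsAmbient.mem_closure_of_fold_line (hA : IsAmbient q) {x : Config K V} (hx : IsWalk q x)
    (h02 : x.1 2 = x.1 0) (h01 : x.2 1 = x.2 0) (h23 : x.2 3 = x.2 2) :
    x ∈ closure (apartments q) := by
  rw [Config.eq_of_components rfl rfl h02 rfl rfl h01 rfl h23]
  exact hA.fold_line (hx.isotropic 0) (hx.isotropic 2) (hx.le 0) (hx.succ_le 0)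
    (by rw [← h02]; exact hx.le 2) (by rw [← h23]; exact hx.le 3)

theorem IsAmbient.mem_closure_of_fold_plane (hA : IsAmbient q) {x : Config K V} (hx : IsWalk q x)
    (h02 : x.2 2 = x.2 0) (h12 : x.1 2 = x.1 1) (h30 : x.1 3 = x.1 0) :
    x ∈ closure (apartments q) := by
  rw [Config.eq_of_components rfl rfl h12 h30 rfl rfl h02 rfl]
  exact hA.fold_plane (hx.isotropic 0) (hx.isotropic 1) (hx.isotropic 3) (hx.succ_le 0)
    (hx.le 0) (hx.le 1) (hx.succ_le 3)

theorem IsAmbient.mem_closure_of_fork_line (hA : IsAmbient q) {x : Config K V} (hx : IsWalk q x)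
    (h02 : x.1 2 = x.1 0) (h03 : x.1 3 = x.1 0) (h01 : x.2 1 = x.2 0) :
    x ∈ closure (apartments q) := by
  rw [Config.eq_of_components rfl rfl h02 h03 rfl h01 rfl rfl]
  exact hA.fork_line (hx.isotropic 0) (hx.isotropic 2) (hx.isotropic 3) (hx.le 0)
    (by rw [← h02]; exact hx.le 2) (hx.succ_le 3) (hx.succ_le 0)

theorem IsAmbient.mem_closure_of_fork_plane (hA : IsAmbient q) {x : Config K V} (hx : IsWalk q x)
    (h02 : x.2 2 = x.2 0) (h03 : x.2 3 = x.2 0) (h12 : x.1 2 = x.1 1) :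
    x ∈ closure (apartments q) := by
  rw [Config.eq_of_components rfl rfl h12 rfl rfl rfl h02 h03]
  exact hA.fork_plane (hx.isotropic 0) (hx.isotropic 1) (hx.succ_le 0) (hx.le 1)
    (by rw [← h03]; exact hx.le 3) (hx.le 0)

/-- A star of lines or planes with less than four leaves is a limit of apartments. -/
theorem IsAmbient.mem_closure_of_constant_line (hA : IsAmbient q) {x : Config K V}
    (hx : IsWalk q x) (hl : ∀ i, x.1 i = x.1 0) (hp : ¬ Function.Injective x.2) :
    x ∈ closure (apartments q) := by
  have hll : ∀ i j, x.1 i = x.1 j := fun i j => (hl i).trans (hl j).symm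
  rcases exists_eq_of_not_injective hp with ⟨i, hi⟩ | h | h
  · fin_cases i
    · exact hA.mem_closure_of_fork_line hx (hll _ _) (hll _ _) hi.symm
    · refine mem_closure_of_rotate ?_
      exact hA.mem_closure_of_fork_line hx.rotate (hll _ _) (hll _ _) hi.symm
    · refine mem_closure_of_rotate (mem_closure_of_rotate ?_)
      exact hA.mem_closure_of_fork_line hx.rotate.rotate (hll _ _) (hll _ _) hi.symm
    · refine mem_closure_of_rotate (mem_closure_of_rotate (mem_closure_of_rotate ?_))
      exact hA.mem_closure_of_fork_line hx.rotate.rotate.rotate (hll _ _) (hll _ _) hi.symm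
  · exact hA.mem_closure_of_fold_plane hx h.symm (hll _ _) (hll _ _)
  · refine mem_closure_of_rotate ?_
    exact hA.mem_closure_of_fold_plane hx.rotate h.symm (hll _ _) (hll _ _)

theorem IsAmbient.mem_closure_of_constant_plane (hA : IsAmbient q) {x : Config K V}
    (hx : IsWalk q x) (hp : ∀ i, x.2 i = x.2 0) (hl : ¬ Function.Injective x.1) :
    x ∈ closure (apartments q) := by
  have hpp : ∀ i j, x.2 i = x.2 j := fun i j => (hp i).trans (hp j).symm
  rcases exists_eq_of_not_injective hl with ⟨i, hi⟩ | h | h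
  · fin_cases i
    · refine mem_closure_of_rotate (mem_closure_of_rotate (mem_closure_of_rotate ?_))
      exact hA.mem_closure_of_fork_plane hx.rotate.rotate.rotate (hpp _ _) (hpp _ _) hi.symm
    · exact hA.mem_closure_of_fork_plane hx (hpp _ _) (hpp _ _) hi.symm
    · refine mem_closure_of_rotate ?_
      exact hA.mem_closure_of_fork_plane hx.rotate (hpp _ _) (hpp _ _) hi.symm
    · refine mem_closure_of_rotate (mem_closure_of_rotate ?_)
      exact hA.mem_closure_of_fork_plane hx.rotate.rotate (hpp _ _) (hpp _ _) hi.symm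
  · exact hA.mem_closure_of_fold_line hx h.symm (hpp _ _) (hpp _ _)
  · refine mem_closure_of_rotate ?_
    exact hA.mem_closure_of_fold_line hx.rotate h.symm (hpp _ _) (hpp _ _)

theorem IsAmbient.mem_closure_of_lines_eq (hA : IsAmbient q) {x : Config K V}
    (hx : IsWalk q x) (hs : ¬ IsLineStar x) (h02 : x.1 2 = x.1 0) :
    x ∈ closure (apartments q) := by
  have h1 : x.2 1 = x.2 0 ∨ x.1 1 = x.1 0 := by
    by_contra! h
    exact h.1 (Gr.plane_eq_of_lines h.2 (by rw [← h02]; exact hx.succ_le 1) (hx.le 1) (hx.le 0)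
      (hx.succ_le 0))
  have h2 : x.2 3 = x.2 2 ∨ x.1 3 = x.1 0 := by
    by_contra! h
    exact h.1 (Gr.plane_eq_of_lines h.2 (hx.succ_le 3) (hx.le 3) (by rw [← h02]; exact hx.le 2)
      (hx.succ_le 2))
  rcases h1 with h1 | h1 <;> rcases h2 with h2 | h2
  · exact hA.mem_closure_of_fold_line hx h02 h1 h2
  · exact hA.mem_closure_of_fork_line hx h02 h2 h1
  · refine mem_closure_of_rotate (mem_closure_of_rotate ?_)
    exact hA.mem_closure_of_fork_line hx.rotate.rotate h02.symm (h1.trans h02.symm) h2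
  · have hl : ∀ i, x.1 i = x.1 0 := by
      intro i
      fin_cases i
      exacts [rfl, h1, h02, h2]
    exact hA.mem_closure_of_constant_line hx hl fun h => hs ⟨hl, h⟩

theorem IsAmbient.mem_closure_of_planes_eq (hA : IsAmbient q) {x : Config K V}
    (hx : IsWalk q x) (hs : ¬ IsPlaneStar x) (h02 : x.2 2 = x.2 0) :
    x ∈ closure (apartments q) := by
  have h1 : x.1 2 = x.1 1 ∨ x.2 1 = x.2 0 := by
    by_contra! h
    exact h.2 (Gr.plane_eq_of_lines h.1 (hx.le 1) (hx.succ_le 1) (hx.succ_le 0)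
      (by rw [← h02]; exact hx.le 2))
  have h2 : x.1 3 = x.1 0 ∨ x.2 3 = x.2 0 := by
    by_contra! h
    exact h.2 (Gr.plane_eq_of_lines h.1 (hx.succ_le 3) (hx.le 3) (hx.le 0)
      (by rw [← h02]; exact hx.succ_le 2))
  rcases h1 with h1 | h1 <;> rcases h2 with h2 | h2
  · exact hA.mem_closure_of_fold_plane hx h02 h1 h2
  · exact hA.mem_closure_of_fork_plane hx h02 h2 h1
  · refine mem_closure_of_rotate (mem_closure_of_rotate ?_)
    exact hA.mem_closure_of_fork_plane hx.rotate.rotate h02.symm (h1.trans h02.symm) h2.symm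
  · have hp : ∀ i, x.2 i = x.2 0 := by
      intro i
      fin_cases i
      exacts [rfl, h1, h02, h2]
    exact hA.mem_closure_of_constant_plane hx hp fun h => hs ⟨hp, h⟩

/-- Every closed gallery that is not a star with four leaves is a limit of apartments. -/
theorem IsAmbient.mem_closure_of_not_star (hA : IsAmbient q) {x : Config K V}
    (hx : IsWalk q x) (hl : ¬ IsLineStar x) (hp : ¬ IsPlaneStar x) :
    x ∈ closure (apartments q) := by
  have const : ∀ {X : Type _} {g : Fin 4 → X}, (∀ i, g (i + 1) = g (0 + 1)) → ∀ i, g i = g 0 := by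
    intro X g h i
    have := fun j => (h j).trans (h 3).symm
    simpa using this (i - 1)
  have inj : ∀ {X : Type _} {g : Fin 4 → X}, (Function.Injective fun i => g (i + 1)) →
      Function.Injective g := by
    intro X g h i j hij
    have := h (a₁ := i - 1) (a₂ := j - 1) (by simpa using hij)
    simpa using this
  by_cases hn : x ∈ apartments q
  · exact subset_closure hn
  rcases hx.exists_opposite_eq hA.witt hn with h | h | h | h
  · exact hA.mem_closure_of_lines_eq hx hl h.symm
  · refine mem_closure_of_rotate (hA.mem_closure_of_lines_eq hx.rotate ?_ h.symm)
    exact fun h => hl ⟨const h.1, inj h.2⟩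
  · exact hA.mem_closure_of_planes_eq hx hp h.symm
  · refine mem_closure_of_rotate (hA.mem_closure_of_planes_eq hx.rotate ?_ h.symm)
    exact fun h => hp ⟨const h.1, inj h.2⟩

omit [TopologicalSpace V] [TopologicalSpace K] [IsTopologicalRing K]
  [IsTopologicalAddGroup V] [ContinuousSMul Kᵐᵒᵖ V] [FiniteDimensional Kᵐᵒᵖ V]

/-! ### Quadripods -/

theorem ncard_range_fin_four_iff {X : Type*} {g : Fin 4 → X} :
    (Set.range g).ncard = 4 ↔ Function.Injective g := by
  classical
  rw [← Set.image_univ, ← Finset.coe_univ, ← Finset.coe_image, Set.ncard_coe_finset]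
  have h := Finset.card_image_iff (f := g) (s := Finset.univ)
  rwa [Finset.card_univ (α := Fin 4), Fintype.card_fin, Finset.coe_univ, Set.injOn_univ] at h

namespace Mor

variable {E : Frame q}

theorem exists_chamber_eq (f : Mor E) (C : E.Chamber) :
    ∃ i j, f.chamber C = (f.config.1 i, f.config.2 j) := by
  obtain ⟨i, hi⟩ := C.exists_line
  obtain ⟨j, hj⟩ := C.exists_plane
  exact ⟨i, j, f.chamber_eq hi hj⟩

theorem chamber_chamber (f : Mor E) (i : Fin 4) :
    f.chamber (E.chamber i) = (f.config.1 i, f.config.2 i) := f.chamber_eq rfl rfl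

theorem ncard_of_constant_line {f : Mor E} (h : ∀ i, f.config.1 i = f.config.1 0) :
    (Set.range f.chamber).ncard = 4 ↔ Function.Injective f.config.2 := by
  have hr : Set.range f.chamber = Set.range fun i => (f.config.1 0, f.config.2 i) := by
    apply Set.Subset.antisymm
    · rintro _ ⟨C, rfl⟩
      obtain ⟨i, j, hC⟩ := f.exists_chamber_eq C
      exact ⟨j, by rw [hC, h i]⟩
    · rintro _ ⟨i, rfl⟩
      exact ⟨E.chamber i, by rw [f.chamber_chamber, h i]⟩
  rw [hr, ncard_range_fin_four_iff]
  exact ⟨fun hi i j hij => hi (Prod.ext rfl hij), fun hi i j hij => hi (Prod.ext_iff.1 hij).2⟩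

theorem ncard_of_constant_plane {f : Mor E} (h : ∀ i, f.config.2 i = f.config.2 0) :
    (Set.range f.chamber).ncard = 4 ↔ Function.Injective f.config.1 := by
  have hr : Set.range f.chamber = Set.range fun i => (f.config.1 i, f.config.2 0) := by
    apply Set.Subset.antisymm
    · rintro _ ⟨C, rfl⟩
      obtain ⟨i, j, hC⟩ := f.exists_chamber_eq C
      exact ⟨i, by rw [hC, h j]⟩
    · rintro _ ⟨i, rfl⟩
      exact ⟨E.chamber i, by rw [f.chamber_chamber, h i]⟩
  rw [hr, ncard_range_fin_four_iff]
  exact ⟨fun hi i j hij => hi (Prod.ext hij rfl), fun hi i j hij => hi (Prod.ext_iff.1 hij).1⟩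

theorem IsLineTypeQuadripod.isLineStar {f : Mor E} (h : f.IsLineTypeQuadripod) :
    IsLineStar f.config := by
  have hl : ∀ i, f.config.1 i = f.config.1 0 := fun i => by
    have := h.2 (E.chamber i) (E.chamber 0)
    rwa [f.chamber_chamber, f.chamber_chamber] at this
  exact ⟨hl, (ncard_of_constant_line hl).1 h.1.1⟩

theorem IsPlaneTypeQuadripod.isPlaneStar {f : Mor E} (h : f.IsPlaneTypeQuadripod) :
    IsPlaneStar f.config := by
  have hp : ∀ i, f.config.2 i = f.config.2 0 := fun i => by
    have := h.2 (E.chamber i) (E.chamber 0)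
    rwa [f.chamber_chamber, f.chamber_chamber] at this
  exact ⟨hp, (ncard_of_constant_plane hp).1 h.1.1⟩

theorem isQuadripod_of_isLineStar {f : Mor E} (h : IsLineStar f.config) : f.IsQuadripod := by
  refine ⟨(ncard_of_constant_line h.1).2 h.2, fun C D => Or.inl ?_⟩
  obtain ⟨i, j, hC⟩ := f.exists_chamber_eq C
  obtain ⟨k, l, hD⟩ := f.exists_chamber_eq D
  rw [hC, hD]
  exact (h.1 i).trans (h.1 k).symm

theorem isQuadripod_of_isPlaneStar {f : Mor E} (h : IsPlaneStar f.config) : f.IsQuadripod := by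
  refine ⟨(ncard_of_constant_plane h.1).2 h.2, fun C D => Or.inr ?_⟩
  obtain ⟨i, j, hC⟩ := f.exists_chamber_eq C
  obtain ⟨k, l, hD⟩ := f.exists_chamber_eq D
  rw [hC, hD]
  exact (h.1 j).trans (h.1 l).symm

/-- Pairwise intersecting edges of a graph without triangles have a common vertex. -/
theorem IsQuadripod.line_or_plane {f : Mor E} (h : f.IsQuadripod) :
    f.IsLineTypeQuadripod ∨ f.IsPlaneTypeQuadripod := by
  by_cases hl : ∀ C D, (f.chamber C).1 = (f.chamber D).1
  · exact Or.inl ⟨h, hl⟩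
  · refine Or.inr ⟨h, ?_⟩
    push Not at hl
    obtain ⟨C, D, hCD⟩ := hl
    have hp := (h.2 C D).resolve_left hCD
    have key : ∀ X, (f.chamber X).2 = (f.chamber C).2 := by
      intro X
      rcases h.2 X C with h1 | h1
      · rcases h.2 X D with h2 | h2
        · exact absurd (h1.symm.trans h2) hCD
        · exact h2.trans hp.symm
      · exact h1
    exact fun X Y => (key X).trans (key Y).symm

theorem mem_closure_of_not_isQuadripod [TopologicalSpace V] [TopologicalSpace K]
    [IsTopologicalRing K] [IsTopologicalAddGroup V] [ContinuousSMul Kᵐᵒᵖ V]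
    [FiniteDimensional Kᵐᵒᵖ V] (hA : IsAmbient q) {f : Mor E} (hf : ¬ f.IsQuadripod) :
    f ∈ closure (inj E) := by
  rw [mem_closure_iff]
  exact hA.mem_closure_of_not_star f.isWalk_config (fun h => hf (isQuadripod_of_isLineStar h))
    fun h => hf (isQuadripod_of_isPlaneStar h)

end Mor

end Form

section Form

variable {K : Type*} [DivisionRing K] {σ : AntiInvolution K}
  {V : Type*} [AddCommGroup V] [Module Kᵐᵒᵖ V] {q : HermitianForm σ V}

/-! ### Quadripods of line-type -/

/-- Symmetry of a star of four planes through a line, in terms of vectors of the planes. -/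
def IsSymmetricStar (q : HermitianForm σ V) (x : Config K V) : Prop :=
  ∃ v : Fin 4 → V, (∀ i, v i ∈ (x.2 i).1 ∧ v i ∉ (x.1 0).1) ∧
    v 0 + v 1 + v 2 + v 3 = 0 ∧ q (v 1) (v 2) = q (v 0) (v 3)

theorem IsWalk.le_star {x : Config K V} (hx : IsWalk q x) (hs : IsLineStar x) (i : Fin 4) :
    (x.1 0).1 ≤ (x.2 i).1 := by
  rw [← hs.1 i]
  exact hx.le i

/-- For four vectors whose sum is orthogonal to each of them, the two symmetry conditions
`q u₁ u₂ = q u₀ u₃` and `q u₀ u₁ = q u₃ u₂` are equivalent. -/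
theorem HermitianForm.symm_relation {u₀ u₁ u₂ u₃ : V} (h00 : q u₀ u₀ = 0) (h22 : q u₂ u₂ = 0)
    (h0 : q u₀ (u₀ + u₁ + u₂ + u₃) = 0) (h2 : q (u₀ + u₁ + u₂ + u₃) u₂ = 0)
    (h : q u₁ u₂ = q u₀ u₃) : q u₀ u₁ = q u₃ u₂ := by
  simp only [map_add_left, map_add_right, h00, h22] at h0 h2
  rw [h] at h2
  rw [← sub_eq_zero]
  calc q u₀ u₁ - q u₃ u₂ = (0 + q u₀ u₁ + q u₀ u₂ + q u₀ u₃) -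
        (q u₀ u₂ + q u₀ u₃ + 0 + q u₃ u₂) := by abel
    _ = 0 := by rw [h0, h2, sub_zero]

section Witt

variable [FiniteDimensional Kᵐᵒᵖ V]

theorem IsWalk.star_ne_zero (hW : q.HasWittIndexTwo) {x : Config K V} (hx : IsWalk q x)
    (hs : IsLineStar x) {i j : Fin 4} (hij : i ≠ j) {v w : V} (hv : v ∈ (x.2 i).1)
    (hw : w ∈ (x.2 j).1) (hvl : v ∉ (x.1 0).1) (hwl : w ∉ (x.1 0).1) : q v w ≠ 0 := by
  obtain ⟨a, ha, hl⟩ := exists_eq_span_singleton (x.1 0).2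
  have ma : a ∈ (x.1 0).1 := hl ▸ Submodule.mem_span_singleton_self a
  rw [hl] at hvl hwl
  exact hW.ne_zero_of_planes_ne (hx.isotropic i) (hx.isotropic j) (x.2 i).2 (x.2 j).2
    (fun h => hij (hs.2 (Subtype.ext h))) ha (hx.le_star hs i ma) (hx.le_star hs j ma) hv hw hvl hwl

/-- A nontrivial relation between vectors of the four planes that satisfies the quadratic symmetry
condition has no vanishing coefficient, so that it makes the star symmetric. -/
theorem IsWalk.isSymmetricStar_of_relation (hW : q.HasWittIndexTwo) {x : Config K V}
    (hx : IsWalk q x) (hs : IsLineStar x) {v : Fin 4 → V}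
    (hv : ∀ i, v i ∈ (x.2 i).1 ∧ v i ∉ (x.1 0).1) {c : Fin 4 → K} (hc : c ≠ 0)
    (hsum : v 0 <• c 0 + v 1 <• c 1 + v 2 <• c 2 + v 3 <• c 3 ∈ (x.1 0).1)
    (hrel : q (v 1 <• c 1) (v 2 <• c 2) = q (v 0 <• c 0) (v 3 <• c 3)) :
    IsSymmetricStar q x := by
  set u : Fin 4 → V := fun i => v i <• c i with hu
  set s := u 0 + u 1 + u 2 + u 3 with hs'
  change s ∈ (x.1 0).1 at hsum
  change q (u 1) (u 2) = q (u 0) (u 3) at hrel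
  have mu : ∀ i, u i ∈ (x.2 i).1 := fun i => (x.2 i).1.smul_mem _ (hv i).1
  have ms : ∀ i, s ∈ (x.2 i).1 := fun i => hx.le_star hs i hsum
  have hus : ∀ i, q (u i) s = 0 := fun i => hx.isotropic i _ (mu i) _ (ms i)
  have huu : ∀ i, q (u i) (u i) = 0 := fun i => hx.isotropic i _ (mu i) _ (mu i)
  have hrel' : q (u 0) (u 1) = q (u 3) (u 2) :=
    HermitianForm.symm_relation (huu 0) (huu 2) (hus 0) (q.swap_eq_zero (hus 2)) hrel
  have hul : ∀ i, c i ≠ 0 → u i ∉ (x.1 0).1 := fun i hi h => (hv i).2 (by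
    have := (x.1 0).1.smul_mem (MulOpposite.op (c i)⁻¹) h
    rwa [smul_inv_cancel_right hi] at this)
  have hz : ∀ i, c i = 0 → u i = 0 := fun i hi => by simp [hu, hi]
  have hne : ∀ i j, i ≠ j → c i ≠ 0 → c j ≠ 0 → q (u i) (u j) ≠ 0 := fun i j hij hi hj =>
    hx.star_ne_zero hW hs hij (mu i) (mu j) (hul i hi) (hul j hj)
  -- a relation between the vectors of two planes only is trivial
  have two : ∀ i j, i ≠ j → s = u i + u j → c i = 0 ∧ c j = 0 := by
    intro i j hij h
    have h0 : q (u i) (u j) = 0 := by simpa [h, huu] using hus i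
    have : c i = 0 ∨ c j = 0 := by
      by_contra! h'
      exact hne i j hij h'.1 h'.2 h0
    rcases this with h1 | h1
    · refine ⟨h1, by_contra fun h2 => hul j h2 ?_⟩
      rwa [h, hz i h1, zero_add] at hsum
    · refine ⟨by_contra fun h2 => hul i h2 ?_, h1⟩
      rwa [h, hz j h1, add_zero] at hsum
  have all : (c 0 = 0 ∧ c 2 = 0) ∨ (c 1 = 0 ∧ c 3 = 0) → False := by
    rintro (⟨h0, h2⟩ | ⟨h1, h3⟩)
    · obtain ⟨h1, h3⟩ := two 1 3 (by decide) (by rw [hs', hz 0 h0, hz 2 h2, zero_add, add_zero])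
      exact hc (funext fun i => by fin_cases i <;> assumption)
    · obtain ⟨h0, h2⟩ := two 0 2 (by decide) (by rw [hs', hz 1 h1, hz 3 h3, add_zero, add_zero])
      exact hc (funext fun i => by fin_cases i <;> assumption)
  have c0 : c 0 ≠ 0 := by
    intro h0
    have h12 : c 1 = 0 ∨ c 2 = 0 := by
      by_contra! h'
      exact hne 1 2 (by decide) h'.1 h'.2 (by rw [hrel, hz 0 h0, q.map_zero_left])
    have h32 : c 3 = 0 ∨ c 2 = 0 := by
      by_contra! h'
      exact hne 3 2 (by decide) h'.1 h'.2 (by rw [← hrel', hz 0 h0, q.map_zero_left])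
    tauto
  have c2 : c 2 ≠ 0 := by
    intro h2
    have h03 : c 0 = 0 ∨ c 3 = 0 := by
      by_contra! h'
      exact hne 0 3 (by decide) h'.1 h'.2 (by rw [← hrel, hz 2 h2, q.map_zero_right])
    have h01 : c 0 = 0 ∨ c 1 = 0 := by
      by_contra! h'
      exact hne 0 1 (by decide) h'.1 h'.2 (by rw [hrel', hz 2 h2, q.map_zero_right])
    tauto
  have c1 : c 1 ≠ 0 := by
    intro h1
    have h03 : c 0 = 0 ∨ c 3 = 0 := by
      by_contra! h'
      exact hne 0 3 (by decide) h'.1 h'.2 (by rw [← hrel, hz 1 h1, q.map_zero_left])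
    tauto
  have c3 : c 3 ≠ 0 := by
    intro h3
    have h12 : c 1 = 0 ∨ c 2 = 0 := by
      by_contra! h'
      exact hne 1 2 (by decide) h'.1 h'.2 (by rw [hrel, hz 3 h3, q.map_zero_right])
    tauto
  have m0 : u 0 - s ∉ (x.1 0).1 := fun h => hul 0 c0 (by
    have := (x.1 0).1.add_mem h hsum
    rwa [sub_add_cancel] at this)
  refine ⟨![u 0 - s, u 1, u 2, u 3], fun i => ?_, ?_, ?_⟩
  · fin_cases i
    exacts [⟨(x.2 0).1.sub_mem (mu 0) (ms 0), m0⟩, ⟨mu 1, hul 1 c1⟩, ⟨mu 2, hul 2 c2⟩,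
      ⟨mu 3, hul 3 c3⟩]
  · change u 0 - s + u 1 + u 2 + u 3 = 0
    rw [hs']
    abel
  · change q (u 1) (u 2) = q (u 0 - s) (u 3)
    rw [q.map_sub_left, q.swap_eq_zero (hus 3), sub_zero, hrel]

end Witt

/-- The vectors of a symmetric star may be taken orthogonal to any vector `b` with `q b a = 1`, where
`a` spans the central line. -/
theorem IsSymmetricStar.exists_orthogonal {x : Config K V} (hx : IsWalk q x) (hs : IsLineStar x)
    (h : IsSymmetricStar q x) {a b : V} (hl : (x.1 0).1 = Submodule.span Kᵐᵒᵖ {a})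
    (hba : q b a = 1) : ∃ v : Fin 4 → V, (∀ i, v i ∈ (x.2 i).1 ∧ v i ∉ (x.1 0).1) ∧
      (∀ i, q b (v i) = 0) ∧ (∀ i, q a (v i) = 0) ∧ v 0 + v 1 + v 2 + v 3 = 0 ∧
      q (v 1) (v 2) = q (v 0) (v 3) ∧ q (v 0) (v 1) = q (v 3) (v 2) := by
  obtain ⟨w, hw, hsum, hrel⟩ := h
  have ma : a ∈ (x.1 0).1 := hl ▸ Submodule.mem_span_singleton_self a
  have haw : ∀ i, q a (w i) = 0 := fun i => hx.isotropic i _ (hx.le_star hs i ma) _ (hw i).1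
  have hwa := fun i => q.swap_eq_zero (haw i)
  have haa : q a a = 0 := hx.isotropic 0 _ (hx.le 0 ma) _ (hx.le 0 ma)
  set v : Fin 4 → V := fun i => w i - a <• q b (w i) with hv
  have hvv : ∀ i j, q (v i) (v j) = q (w i) (w j) := fun i j => by simp [hv, haw, hwa, haa]
  have hvs : v 0 + v 1 + v 2 + v 3 = 0 := by
    have : v 0 + v 1 + v 2 + v 3 = (w 0 + w 1 + w 2 + w 3) -
        a <• q b (w 0 + w 1 + w 2 + w 3) := by
      simp only [hv, HermitianForm.map_add_right, MulOpposite.op_add, add_smul]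
      abel
    rw [this, hsum, q.map_zero_right, MulOpposite.op_zero, zero_smul, sub_zero]
  have mv : ∀ i, v i ∈ (x.2 i).1 := fun i =>
    (x.2 i).1.sub_mem (hw i).1 ((x.2 i).1.smul_mem _ (hx.le_star hs i ma))
  refine ⟨v, fun i => ⟨mv i, fun h => (hw i).2 ?_⟩, fun i => by simp [hv, hba],
    fun i => by simp [hv, haw, haa], hvs, by rw [hvv, hvv, hrel], ?_⟩
  · have := (x.1 0).1.add_mem h ((x.1 0).1.smul_mem (MulOpposite.op (q b (w i))) ma)
    rwa [hv, sub_add_cancel] at this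
  · refine HermitianForm.symm_relation (hx.isotropic 0 _ (mv 0) _ (mv 0))
      (hx.isotropic 2 _ (mv 2) _ (mv 2)) ?_ ?_ (by rw [hvv, hvv, hrel])
    · rw [hvs, q.map_zero_right]
    · rw [hvs, q.map_zero_left]

variable [TopologicalSpace V] [TopologicalSpace K] [IsTopologicalRing K]
  [IsTopologicalAddGroup V] [ContinuousSMul Kᵐᵒᵖ V] [FiniteDimensional Kᵐᵒᵖ V]

/-- A symmetric star is a limit of apartments: start from a generator `a` of the central line, and
add successively small multiples of the four vectors; since their sum is `0`, the polygon closes up,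
and a correction of second order makes it isotropic. -/
theorem IsAmbient.mem_closure_of_isSymmetricStar (hA : IsAmbient q) {x : Config K V}
    (hx : IsWalk q x) (hs : IsLineStar x) (h : IsSymmetricStar q x) :
    x ∈ closure (apartments q) := by
  obtain ⟨a, ha, hl⟩ := exists_eq_span_singleton (x.1 0).2
  have ma : a ∈ (x.1 0).1 := hl ▸ Submodule.mem_span_singleton_self a
  have haa : q a a = 0 := hx.isotropic 0 _ (hx.le 0 ma) _ (hx.le 0 ma)
  obtain ⟨b, hbb, hab⟩ := hA.nondegenerate.exists_partner hA.two_ne_zero ha haa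
  have hba : q b a = 1 := by rw [q.hermitian a b, hab, σ.map_one]
  obtain ⟨v, hv, hbv, hav, hsum, hrel, hrel'⟩ := h.exists_orthogonal hx hs hl hba
  have hva := fun i => q.swap_eq_zero (hav i)
  have hvb := fun i => q.swap_eq_zero (hbv i)
  have hvv : ∀ i, q (v i) (v i) = 0 := fun i => hx.isotropic i _ (hv i).1 _ (hv i).1
  set h := q (v 0) (v 1) with hh
  have h10 : q (v 1) (v 0) = σ h := q.hermitian _ _
  have h0 : h ≠ 0 := hx.star_ne_zero hA.witt hs (by decide) (hv 0).1 (hv 1).1 (hv 0).2 (hv 1).2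
  have h03 : q (v 0) (v 3) ≠ 0 :=
    hx.star_ne_zero hA.witt hs (by decide) (hv 0).1 (hv 3).1 (hv 0).2 (hv 3).2
  have h013 : q (v 0) (v 3) + q (v 1) (v 3) = - σ h := by
    have : v 0 + v 1 = -(v 2 + v 3) := by
      rw [eq_neg_iff_add_eq_zero, ← hsum]
      abel
    rw [← q.map_add_left, this, q.map_neg_left, q.map_add_left, hvv, add_zero, hrel',
      q.hermitian (v 3) (v 2)]
  have hP : ∀ i, (x.2 i).1 = Submodule.span Kᵐᵒᵖ {a, v i} := fun i =>
    eq_span_pair (x.2 i).2 (hx.le_star hs i ma) (hv i).1 ha (hl ▸ (hv i).2)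
  have hL : ∀ i, (x.1 i).1 = Submodule.span Kᵐᵒᵖ {a} := fun i => (hs.1 i).symm ▸ hl
  refine mem_closure_of_four_curves hA.accumulates (fun _ => a) (fun t => a + v 0 <• t)
    (fun t => a + (v 0 + v 1) <• t - b <• (h * (t * t))) (fun t => a - v 3 <• t)
    (fun _ => a) (fun _ => v 0)
    (fun t => a + v 0 <• t) (fun t => v 1 - b <• (h * t))
    (fun t => a - v 3 <• t) (fun t => v 2 + b <• (h * t))
    (fun _ => a) (fun _ => v 3)
    (by simpa using hL 0) (by simpa using hL 1) (by simpa using hL 2) (by simpa using hL 3)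
    (by simpa using hP 0) (by simpa using hP 1) (by simpa using hP 2) (by simpa using hP 3)
    ?_ ?_ ?_ ?_ ?_
  · rintro t ⟨ht0, hσt, htc⟩
    have c1 : ∀ y, t * (y * t) = y * (t * t) := fun y => by rw [← mul_assoc, htc, mul_assoc]
    have c2 : ∀ y, t * (t * y) = y * (t * t) := fun y => by rw [htc y, c1]
    apply IsMarked.of_vectors
    · exact haa
    · simp [haa, hav, hva, hvv]
    · simp only [HermitianForm.map_add_left, HermitianForm.map_add_right,
        HermitianForm.map_sub_left, HermitianForm.map_sub_right, HermitianForm.map_smul_left,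
        HermitianForm.map_smul_right, MulOpposite.unop_op, haa, hav, hva, hab, hba, hbb, hbv, hvb,
        hvv, ← hh, h10, σ.map_mul, hσt, mul_assoc, add_mul, mul_add]
      simp
      rw [mul_assoc t (σ h), mul_assoc t h, c1, c1, c2]
      abel
    · simp [haa, hav, hva, hvv]
    · simp [haa, hav]
    · simp [haa, hab, hav, hva, hvv, hvb, hσt, mul_assoc, c1, ← hh]
    · have : (t * q (v 0) (v 3) + t * q (v 1) (v 3)) * t = - (σ h * (t * t)) := by
        rw [← mul_add, h013, mul_assoc, neg_mul, mul_neg, c1]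
      simp only [HermitianForm.map_add_left, HermitianForm.map_sub_right,
        HermitianForm.map_sub_left, HermitianForm.map_smul_left, HermitianForm.map_smul_right,
        MulOpposite.unop_op, haa, hav, hva, hba, hbv, σ.map_mul, hσt, mul_assoc, c2 (σ h), mul_add,
        mul_one, mul_zero, zero_add, sub_zero]
      simp only [← mul_add, ← mul_assoc] at this ⊢
      rw [this]
      simp
    · simp [haa, hav]
    · simpa [haa, hav, hab] using ⟨h0, ht0⟩
    · simpa [haa, hav, hva, hσt] using ⟨⟨ht0, h03⟩, ht0⟩
  · intro t ht
    exact span_pair_eq (x := 1) ht.1 (by simp)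
  · intro t ht
    refine span_pair_eq (x := 1) ht.1 ?_
    simp only [MulOpposite.op_one, one_smul, smul_sub, smul_add, op_smul_op_smul, mul_assoc]
    abel
  · intro t ht
    rw [Set.pair_comm (a + (v 0 + v 1) <• t - b <• (h * (t * t)))]
    refine span_pair_eq (x := 1) (y := -t) (neg_ne_zero.2 ht.1) ?_
    have : v 2 = -(v 0 + v 1 + v 3) := by
      rw [eq_neg_iff_add_eq_zero, ← hsum]
      abel
    simp only [this, MulOpposite.op_one, one_smul, MulOpposite.op_neg, smul_add, neg_smul, smul_neg,
      op_smul_op_smul, mul_assoc]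
    abel
  · intro t ht
    rw [Set.pair_comm (_ - _)]
    refine span_pair_eq (x := 1) (y := -t) (neg_ne_zero.2 ht.1) ?_
    simp [sub_eq_add_neg]

omit [IsTopologicalRing K] [FiniteDimensional Kᵐᵒᵖ V] in
/-- Limits of closed polygons. The coefficients `c` are only defined up to a common factor, so they
may be taken in a compact set, which makes the set of solutions `v` closed. -/
theorem isClosed_relations [IsTopologicalRing K] [T2Space V] [T2Space K]
    (hqc : Continuous fun p : V × V => q p.1 p.2)
    {S : Set (Fin 4 → K)} (hS : IsCompact S) :
    IsClosed {v : Fin 4 → V | ∃ c ∈ S,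
      v 0 <• c 0 + v 1 <• c 1 + v 2 <• c 2 + v 3 <• c 3 = 0 ∧
      q (v 1 <• c 1) (v 2 <• c 2) = q (v 0 <• c 0) (v 3 <• c 3)} := by
  have : CompactSpace S := isCompact_iff_compactSpace.1 hS
  have hZ : IsClosed {p : (Fin 4 → V) × S |
      p.1 0 <• p.2.1 0 + p.1 1 <• p.2.1 1 + p.1 2 <• p.2.1 2 + p.1 3 <• p.2.1 3 = 0 ∧
      q (p.1 1 <• p.2.1 1) (p.1 2 <• p.2.1 2) = q (p.1 0 <• p.2.1 0) (p.1 3 <• p.2.1 3)} := by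
    have hc (i : Fin 4) : Continuous fun p : (Fin 4 → V) × S => p.2.1 i :=
      (continuous_apply i).comp (continuous_subtype_val.comp continuous_snd)
    have hu (i : Fin 4) : Continuous fun p : (Fin 4 → V) × S => p.1 i <• p.2.1 i :=
      (MulOpposite.continuous_op.comp (hc i)).smul ((continuous_apply i).comp continuous_fst)
    exact (isClosed_eq ((((hu 0).add (hu 1)).add (hu 2)).add (hu 3)) continuous_const).inter
      (isClosed_eq (hqc.comp ((hu 1).prodMk (hu 2))) (hqc.comp ((hu 0).prodMk (hu 3))))
  convert isClosedMap_fst_of_compactSpace _ hZ using 1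
  ext v
  constructor
  · rintro ⟨c, hc, h⟩
    exact ⟨(v, ⟨c, hc⟩), h, rfl⟩
  · rintro ⟨⟨v, c⟩, h, rfl⟩
    exact ⟨c.1, c.2, h⟩

/-- A star that is a limit of apartments is symmetric: generators `a i` of the lines of an
apartment, normalised by `q b (a i) = 1`, have differences `a (i + 1) - a i` in the planes; they add
up to `0` and satisfy the quadratic relation. -/
theorem IsAmbient.isSymmetricStar_of_mem_closure [T2Space V] [T2Space K] [ContinuousInv₀ K]
    (hA : IsAmbient q) (hqc : Continuous fun p : V × V => q p.1 p.2)
    {S : Set (Fin 4 → K)} (hS : IsCompact S) (hS0 : 0 ∉ S)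
    (hSc : ∀ c : Fin 4 → K, c ≠ 0 → ∃ z : K, (fun i => c i * z) ∈ S) {x : Config K V}
    (hx : IsWalk q x) (hs : IsLineStar x) (h : x ∈ closure (apartments q)) :
    IsSymmetricStar q x := by
  obtain ⟨a, ha, hl⟩ := exists_eq_span_singleton (x.1 0).2
  have ma : a ∈ (x.1 0).1 := hl ▸ Submodule.mem_span_singleton_self a
  have haa : q a a = 0 := hx.isotropic 0 _ (hx.le 0 ma) _ (hx.le 0 ma)
  obtain ⟨b, hbb, hab⟩ := hA.nondegenerate.exists_partner hA.two_ne_zero ha haa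
  have hba : q b a = 1 := by rw [q.hermitian a b, hab, σ.map_one]
  have hex : ∀ i, ∃ w ∈ (x.2 i).1, w ∉ (x.1 0).1 ∧ q b w = 0 := by
    intro i
    obtain ⟨w, hw, hwl⟩ := exists_mem_notMem (x.1 0).2 (x.2 i).2
    refine ⟨w - a <• q b w, (x.2 i).1.sub_mem hw ((x.2 i).1.smul_mem _ (hx.le_star hs i ma)),
      fun h => hwl ?_, by simp [hba]⟩
    have := (x.1 0).1.add_mem h ((x.1 0).1.smul_mem (MulOpposite.op (q b w)) ma)
    rwa [sub_add_cancel] at this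
  choose v hv hvl hbv using hex
  have hL : ∀ i, (x.1 i).1 = Submodule.span Kᵐᵒᵖ {a} := fun i => (hs.1 i).symm ▸ hl
  have hP : ∀ i, (x.2 i).1 = Submodule.span Kᵐᵒᵖ {a, v i} := fun i =>
    eq_span_pair (x.2 i).2 (hx.le_star hs i ma) (hv i) ha (hl ▸ hvl i)
  have hlift := mem_closure_lifts h (a := fun _ => a) (b := fun i => ![a, v i]) hL hP
  set M := {p : (Fin 4 → V) × (Fin 4 → Fin 2 → V) | ∃ y ∈ apartments q,
      (∀ i, (y.1 i).1 = Submodule.span Kᵐᵒᵖ {p.1 i}) ∧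
        ∀ i, (y.2 i).1 = Submodule.span Kᵐᵒᵖ {p.2 i 0, p.2 i 1}} with hM
  have hqb : Continuous fun w : V => q b w :=
    hqc.comp (f := fun w : V => (b, w)) (by fun_prop)
  -- near the limit the generators can be normalised
  set N := {p : (Fin 4 → V) × (Fin 4 → Fin 2 → V) |
      (∀ i, q b (p.1 i) ≠ 0) ∧ ∀ i, q b (p.2 i 0) ≠ 0} with hN
  have hNo : IsOpen N := by
    have h1 : N = (⋂ i, {p | q b (p.1 i) ≠ 0}) ∩ ⋂ i, {p | q b (p.2 i 0) ≠ 0} := by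
      ext p
      simp [hN]
    rw [h1]
    refine (isOpen_iInter_of_finite fun i => ?_).inter (isOpen_iInter_of_finite fun i => ?_)
    · exact isOpen_ne_fun (hqb.comp (by fun_prop)) continuous_const
    · exact isOpen_ne_fun (hqb.comp (by fun_prop)) continuous_const
  let ψ : (Fin 4 → V) × (Fin 4 → Fin 2 → V) → Fin 4 → V := fun p i =>
    p.2 i 1 - p.2 i 0 <• ((q b (p.2 i 0))⁻¹ * q b (p.2 i 1))
  have hψ : ContinuousAt ψ (fun _ => a, fun i => ![a, v i]) := by
    refine continuousAt_pi.2 fun i => ?_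
    have h0 : ContinuousAt (fun p : (Fin 4 → V) × (Fin 4 → Fin 2 → V) => p.2 i 0)
        (fun _ => a, fun i => ![a, v i]) := by fun_prop
    have h1 : ContinuousAt (fun p : (Fin 4 → V) × (Fin 4 → Fin 2 → V) => p.2 i 1)
        (fun _ => a, fun i => ![a, v i]) := by fun_prop
    have h2 := (hqb.continuousAt.comp h0).inv₀ (by simp [hba])
    have h3 := hqb.continuousAt.comp h1
    exact h1.sub ((MulOpposite.continuous_op.continuousAt.comp (h2.mul h3)).smul h0)
  have hψv : ψ (fun _ => a, fun i => ![a, v i]) = v := by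
    funext i
    simp [ψ, hbv]
  have hcl := mem_closure_image hψ (hNo.inter_closure ⟨by simp [hN, hba], hlift⟩)
  rw [hψv] at hcl
  have hsub : ψ '' (N ∩ M) ⊆ {v : Fin 4 → V | ∃ c ∈ S,
      v 0 <• c 0 + v 1 <• c 1 + v 2 <• c 2 + v 3 <• c 3 = 0 ∧
      q (v 1 <• c 1) (v 2 <• c 2) = q (v 0 <• c 0) (v 3 <• c 3)} := by
    rintro _ ⟨p, ⟨⟨hp1, hp2⟩, y, ⟨hy, hyl, -⟩, hy1, hy2⟩, rfl⟩
    set g : Fin 4 → V := fun i => p.1 i <• (q b (p.1 i))⁻¹ with hg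
    have hbg : ∀ i, q b (g i) = 1 := fun i => by simp [hg, hp1]
    have hgl : ∀ i, (y.1 i).1 = Submodule.span Kᵐᵒᵖ {g i} := fun i => by
      rw [hy1, hg, span_singleton_smul (inv_ne_zero (hp1 i))]
    have mg : ∀ i, g i ∈ (y.1 i).1 := fun i => hgl i ▸ Submodule.mem_span_singleton_self _
    have hgg : ∀ i, q (g i) (g i) = 0 := fun i =>
      hy.isotropic i _ (hy.le i (mg i)) _ (hy.le i (mg i))
    have hgs : ∀ i, q (g i) (g (i + 1)) = 0 := fun i =>
      hy.isotropic i _ (hy.le i (mg i)) _ (hy.succ_le i (mg _))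
    have hex : ∀ i, ∃ c : K, ψ p i <• c = g (i + 1) - g i := by
      intro i
      have hmem := (y.2 i).1.sub_mem (hy.succ_le i (mg _)) (hy.le i (mg i))
      rw [hy2, mem_span_pair_iff] at hmem
      obtain ⟨α, β, hαβ⟩ := hmem
      refine ⟨β, ?_⟩
      have h0 : q b (p.2 i 0) * α + q b (p.2 i 1) * β = 0 := by
        have := congrArg (q b) hαβ
        simpa [hbg] using this
      have hα : α = -((q b (p.2 i 0))⁻¹ * q b (p.2 i 1) * β) := by
        rw [mul_assoc, eq_neg_of_add_eq_zero_right h0, mul_neg, inv_mul_cancel_left₀ (hp2 i),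
          neg_neg]
      rw [← hαβ, hα]
      simp only [ψ, smul_sub, op_smul_op_smul, MulOpposite.op_neg, neg_smul]
      abel
    choose c hc using hex
    have hc0 : c ≠ 0 := by
      intro h0
      have h1 := hc 0
      rw [h0, Pi.zero_apply, MulOpposite.op_zero, zero_smul] at h1
      have h2 : y.1 (0 + 1) = y.1 0 := Subtype.ext (by
        rw [hgl, hgl, sub_eq_zero.1 h1.symm])
      exact absurd (hyl h2) (by decide)
    obtain ⟨z, hz⟩ := hSc c hc0
    have e : ∀ i, ψ p i <• (c i * z) = (g (i + 1) - g i) <• z := fun i => by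
      rw [op_smul_mul, hc]
    refine ⟨_, hz, ?_, ?_⟩
    · rw [e, e, e, e, ← smul_add, ← smul_add, ← smul_add]
      have : g (0 + 1) - g 0 + (g (1 + 1) - g 1) + (g (2 + 1) - g 2) + (g (3 + 1) - g 3) = 0 := by
        change g 1 - g 0 + (g 2 - g 1) + (g 3 - g 2) + (g 0 - g 3) = 0
        abel
      rw [this, smul_zero]
    · rw [e, e, e, e]
      have h01 : q (g 0) (g 1) = 0 := hgs 0
      have h12 : q (g 1) (g 2) = 0 := hgs 1
      have h23 : q (g 2) (g 3) = 0 := hgs 2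
      have h30 : q (g 3) (g 0) = 0 := hgs 3
      have : q (g 2 - g 1) (g 3 - g 2) = q (g 1 - g 0) (g 0 - g 3) := by
        simp [hgg, h12, h23, q.swap_eq_zero h30, q.swap_eq_zero h01]
      simp only [HermitianForm.map_smul_left, HermitianForm.map_smul_right]
      rw [mul_assoc, mul_assoc]
      exact congrArg (fun k => σ z * (k * z)) this
  obtain ⟨c, hcS, hsum, hrel⟩ :=
    closure_minimal hsub (isClosed_relations hqc hS) hcl
  refine hx.isSymmetricStar_of_relation hA.witt hs (fun i => ⟨hv i, hvl i⟩) (c := c) ?_ ?_ hrel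
  · rintro rfl
    exact hS0 hcS
  · rw [hsum]
    exact Submodule.zero_mem _

end Form

section Form

variable {K : Type*} [DivisionRing K] {σ : AntiInvolution K}
  {V : Type*} [AddCommGroup V] [Module Kᵐᵒᵖ V] {q : HermitianForm σ V}

/-! ### Symmetry through a semilinear involution -/

/-- `s` is a `σ`-semilinear involution that preserves `q` up to `σ`. -/
structure IsSemiisometry (q : HermitianForm σ V) (s : V →+ V) : Prop where
  map_smul : ∀ (v : V) (x : K), s (v <• x) = s v <• σ x
  map_form : ∀ v w, q (s v) (s w) = σ (q v w)
  involutive : ∀ v, s (s v) = v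

/-- If all values of `q` on a spanning set are fixed by `σ`, then the conjugation that fixes this
set is a semilinear involution preserving `q`. It fixes every vector whose products with the spanning
set are fixed by `σ`. -/
theorem exists_conjugation [FiniteDimensional Kᵐᵒᵖ V] (hK : ∀ x y : K, x * y = y * x)
    {X : Set V} (hX : Submodule.span Kᵐᵒᵖ X = ⊤) (hfix : ∀ v ∈ X, ∀ w ∈ X, σ (q v w) = q v w)
    (hq : q.Nondegenerate) :
    ∃ s : V →+ V, IsSemiisometry q s ∧ ∀ v ∈ X, s v = v := by
  obtain ⟨Y, hYX, hYs, hYi⟩ := exists_linearIndependent Kᵐᵒᵖ X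
  rw [hX] at hYs
  have : Finite Y := hYi.finite
  have := Fintype.ofFinite Y
  let β : Basis Y Kᵐᵒᵖ V := Basis.mk hYi (by rw [Subtype.range_coe]; exact hYs.ge)
  have hβ : ∀ i, β i = i := fun i => by simp [β]
  let s : V →+ V :=
    { toFun v := ∑ i, β i <• σ (β.repr v i).unop
      map_zero' := by simp
      map_add' v w := by simp [add_smul, Finset.sum_add_distrib] }
  have sdef : ∀ v, s v = ∑ i, β i <• σ (β.repr v i).unop := fun _ => rfl
  have hs : ∀ (v : V) (x : K), s (v <• x) = s v <• σ x := by
    intro v x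
    rw [sdef, sdef, Finset.smul_sum]
    refine Finset.sum_congr rfl fun i _ => ?_
    simp [op_smul_op_smul, hK (σ x)]
  have sβ : ∀ i, s (β i) = β i := by
    intro i
    rw [sdef, Finset.sum_eq_single i]
    · simp
    · intro j _ hj
      simp [hj.symm]
    · simp
  have hYt : ∀ v, v ∈ Submodule.span Kᵐᵒᵖ Y := fun v => hYs ▸ Submodule.mem_top
  have sY : ∀ v ∈ Y, s v = v := fun v hv => by simpa [hβ] using sβ ⟨v, hv⟩
  have h1 : ∀ w ∈ Y, ∀ v, q (s v) w = σ (q v w) := by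
    intro w hw v
    induction hYt v using Submodule.span_induction with
    | mem v hv => rw [sY v hv, hfix v (hYX hv) w (hYX hw)]
    | zero => simp
    | add v v' _ _ h h' => simp [h, h']
    | smul c v _ h =>
      have := hs v c.unop
      rw [MulOpposite.op_unop] at this
      rw [this, q.map_smul_left, h, q.map_smul_left, MulOpposite.unop_op, σ.map_mul, hK]
  have h2 : ∀ v w, q (s v) (s w) = σ (q v w) := by
    intro v w
    induction hYt w using Submodule.span_induction with
    | mem w hw => rw [sY w hw, h1 w hw]
    | zero => simp
    | add w w' _ _ h h' => simp [h, h']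
    | smul c w _ h =>
      have := hs w c.unop
      rw [MulOpposite.op_unop] at this
      rw [this, q.map_smul_right, h, q.map_smul_right, MulOpposite.unop_op, σ.map_mul, hK]
  have h3 : ∀ v, s (s v) = v := by
    intro v
    induction hYt v using Submodule.span_induction with
    | mem v hv => rw [sY v hv, sY v hv]
    | zero => simp
    | add v v' _ _ h h' => simp [h, h']
    | smul c v _ h =>
      rw [← MulOpposite.op_unop c, hs, hs, h, σ.involutive]
  refine ⟨s, ⟨hs, h2, h3⟩, fun v hv => sub_eq_zero.1 (hq _ fun w => ?_)⟩
  have : ∀ w ∈ Y, q (s v - v) w = 0 := fun w hw => by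
    rw [q.map_sub_left, h1 w hw, hfix v hv w (hYX hw), sub_self]
  exact q.eq_zero_of_mem_span this (hYt w)

theorem finite_op_self : Module.Finite Kᵐᵒᵖ K :=
  .equiv (MulOpposite.opLinearEquiv Kᵐᵒᵖ : K ≃ₗ[Kᵐᵒᵖ] Kᵐᵒᵖ).symm

theorem finrank_op_self : finrank Kᵐᵒᵖ K = 1 := by
  rw [(MulOpposite.opLinearEquiv Kᵐᵒᵖ : K ≃ₗ[Kᵐᵒᵖ] Kᵐᵒᵖ).finrank_eq, finrank_self]

/-- A family of vectors with `σ`-fixed products extends to a spanning one, provided that all larger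
families span nondegenerate subspaces: to a family that does not span one may add any vector of the
orthogonal complement. -/
theorem exists_spanning_fixed [FiniteDimensional Kᵐᵒᵖ V] {X : Set V}
    (hfix : ∀ v ∈ X, ∀ w ∈ X, σ (q v w) = q v w)
    (hX : ∀ Y : Set V, X ⊆ Y → ∀ d ∈ Submodule.span Kᵐᵒᵖ Y, (∀ w ∈ Y, q d w = 0) → d = 0) :
    ∃ Y : Set V, X ⊆ Y ∧ Submodule.span Kᵐᵒᵖ Y = ⊤ ∧
      ∀ v ∈ Y, ∀ w ∈ Y, σ (q v w) = q v w := by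
  obtain ⟨Y, hXY, hY⟩ := zorn_subset_nonempty {Y : Set V | ∀ v ∈ Y, ∀ w ∈ Y, σ (q v w) = q v w}
    (by
      intro C hC hchain _
      refine ⟨⋃₀ C, ?_, fun Y hY => Set.subset_sUnion_of_mem hY⟩
      rintro v ⟨Y, hY, hv⟩ w ⟨Z, hZ, hw⟩
      rcases hchain.total hY hZ with h | h
      · exact hC hZ v (h hv) w hw
      · exact hC hY v hv w (h hw)) X hfix
  refine ⟨Y, hXY, by_contra fun hne => ?_, hY.1⟩
  set U := Submodule.span Kᵐᵒᵖ Y with hU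
  -- a nonzero vector orthogonal to `U` contradicts maximality
  obtain ⟨d, hd0, hd⟩ : ∃ d : V, d ≠ 0 ∧ ∀ w ∈ Y, q d w = 0 := by
    obtain ⟨Z, hZY, hZs, hZi⟩ := exists_linearIndependent Kᵐᵒᵖ Y
    have : Finite Z := hZi.finite
    have := Fintype.ofFinite Z
    have := finite_op_self (K := K)
    let g : V →ₗ[Kᵐᵒᵖ] (Z → K) := LinearMap.pi fun z => q.toLinear z.1
    have hcard : finrank Kᵐᵒᵖ (Z → K) < finrank Kᵐᵒᵖ V := by
      have h1 : finrank Kᵐᵒᵖ U = Fintype.card Z := by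
        rw [hU, ← hZs, ← finrank_span_eq_card hZi, Subtype.range_coe]
      have h2 := Submodule.finrank_lt hne
      rw [finrank_pi_fintype]
      simp only [finrank_op_self, Finset.sum_const, Finset.card_univ, smul_eq_mul, mul_one]
      omega
    obtain ⟨d, hd, hd0⟩ := Submodule.exists_mem_ne_zero_of_ne_bot
      (LinearMap.ker_ne_bot_of_finrank_lt (f := g) hcard)
    refine ⟨d, hd0, fun w hw => ?_⟩
    have hz : ∀ z ∈ Z, q d z = 0 := fun z hz => q.swap_eq_zero (congrFun hd ⟨z, hz⟩)
    exact q.eq_zero_of_mem_span hz (hZs ▸ Submodule.subset_span hw)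
  have hdY : d ∈ Y := hY.mem_of_prop_insert (by
    rintro v (rfl | hv) w (rfl | hw)
    · exact q.map_self _
    · rw [hd w hw, σ.map_zero]
    · rw [q.swap_eq_zero (hd v hv), σ.map_zero]
    · exact hY.1 v hv w hw)
  exact hd0 (hX Y hXY d (Submodule.subset_span hdY) hd)

section Witt

variable [FiniteDimensional Kᵐᵒᵖ V]

/-- If the four planes lie in a space of dimension at most `4`, they contain the sides of a closed
polygon modulo the central line. -/
theorem exists_relation_of_finrank_le {W : Submodule Kᵐᵒᵖ V} (hW : finrank Kᵐᵒᵖ W ≤ 4) {a : V}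
    (ha : a ≠ 0) (haW : a ∈ W) {v : Fin 4 → V} (hv : ∀ i, v i ∈ W) :
    ∃ c : Fin 4 → K, c ≠ 0 ∧
      v 0 <• c 0 + v 1 <• c 1 + v 2 <• c 2 + v 3 <• c 3 ∈ Submodule.span Kᵐᵒᵖ {a} := by
  have hdep : ¬ LinearIndependent Kᵐᵒᵖ (Fin.cons a v : Fin 5 → V) := by
    intro h
    have h1 := finrank_span_eq_card h
    have h2 : Submodule.span Kᵐᵒᵖ (Set.range (Fin.cons a v : Fin 5 → V)) ≤ W := by
      rw [Submodule.span_le]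
      rintro _ ⟨i, rfl⟩
      refine Fin.cases ?_ (fun i => ?_) i
      exacts [haW, hv i]
    have := Submodule.finrank_mono h2
    rw [h1, Fintype.card_fin] at this
    omega
  obtain ⟨g, hg, hg0⟩ := Fintype.not_linearIndependent_iff.1 hdep
  rw [Fin.sum_univ_succ, Fin.sum_univ_four] at hg
  simp only [Fin.cons_zero, Fin.cons_succ] at hg
  refine ⟨fun i => (g i.succ).unop, fun h0 => ?_, mem_span_singleton_iff.2 ⟨-(g 0).unop, ?_⟩⟩
  · have hz : ∀ i : Fin 4, g i.succ = 0 := fun i =>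
      MulOpposite.unop_injective (congrFun h0 i)
    have hz0 : g 0 = 0 := by
      simp only [hz, zero_smul, add_zero] at hg
      exact (smul_eq_zero.1 hg).resolve_right ha
    obtain ⟨i, hi⟩ := hg0
    exact hi (Fin.cases hz0 hz i)
  · simp only [MulOpposite.op_neg, MulOpposite.op_unop, neg_smul]
    exact (eq_neg_of_add_eq_zero_right hg).symm

/-- In dimension `5`, with `σ = id`, every star of planes is symmetric. -/
theorem IsAmbient.isSymmetricStar_of_finrank_eq_five [TopologicalSpace K] (hA : IsAmbient q)
    (hσ : σ.IsTrivial) (h5 : finrank Kᵐᵒᵖ V = 5) {x : Config K V} (hx : IsWalk q x)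
    (hs : IsLineStar x) : IsSymmetricStar q x := by
  obtain ⟨a, ha, hl⟩ := exists_eq_span_singleton (x.1 0).2
  have ma : a ∈ (x.1 0).1 := hl ▸ Submodule.mem_span_singleton_self a
  have hex := fun i => exists_mem_notMem (x.1 0).2 (x.2 i).2
  choose v hv hvl using hex
  -- all the planes lie in the orthogonal hyperplane of the central line
  obtain ⟨w, hw⟩ := hA.nondegenerate.exists_eq_one ha
  have hker : finrank Kᵐᵒᵖ (LinearMap.ker (q.toLinear a)) ≤ 4 := by
    have := Submodule.finrank_lt (s := LinearMap.ker (q.toLinear a)) (fun h => by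
      have h1 : w ∈ LinearMap.ker (q.toLinear a) := h ▸ Submodule.mem_top
      have h2 : q a w = 0 := h1
      exact one_ne_zero (hw.symm.trans h2))
    omega
  have hmem : ∀ i, ∀ u ∈ (x.2 i).1, u ∈ LinearMap.ker (q.toLinear a) := fun i u hu =>
    hx.isotropic i a (hx.le_star hs i ma) u hu
  obtain ⟨c, hc, hsum⟩ := exists_relation_of_finrank_le hker ha (hmem 0 _ (hx.le_star hs 0 ma))
    (fun i => hmem i _ (hv i))
  rw [← hl] at hsum
  refine hx.isSymmetricStar_of_relation hA.witt hs (fun i => ⟨hv i, hvl i⟩) hc hsum ?_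
  have mu : ∀ i, v i <• c i ∈ (x.2 i).1 := fun i => (x.2 i).1.smul_mem _ (hv i)
  have hsymm : ∀ u w : V, q u w = q w u := fun u w => by rw [q.hermitian w u, hσ]
  have ms := fun i => hx.le_star hs i hsum
  have hus := fun i => hx.isotropic i _ (mu i) _ (ms i)
  have huu := fun i => hx.isotropic i _ (mu i) _ (mu i)
  have h0 := hus 0
  have h1 := hus 1
  have h2 := hus 2
  have h3 := hus 3
  simp only [q.map_add_right, huu] at h0 h1 h2 h3
  rw [hsymm (v 1 <• c 1) (v 0 <• c 0)] at h1
  rw [hsymm (v 2 <• c 2) (v 0 <• c 0), hsymm (v 2 <• c 2) (v 1 <• c 1)] at h2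
  rw [hsymm (v 3 <• c 3) (v 0 <• c 0), hsymm (v 3 <• c 3) (v 1 <• c 1),
    hsymm (v 3 <• c 3) (v 2 <• c 2)] at h3
  have key : ∀ p₀₁ p₀₂ p₀₃ p₁₂ p₁₃ p₂₃ : K, 0 + p₀₁ + p₀₂ + p₀₃ = 0 → p₀₁ + 0 + p₁₂ + p₁₃ = 0 →
      p₀₂ + p₁₂ + 0 + p₂₃ = 0 → p₀₃ + p₁₃ + p₂₃ + 0 = 0 → 2 * (p₁₂ - p₀₃) = 0 := by
    intro p₀₁ p₀₂ p₀₃ p₁₂ p₁₃ p₂₃ h0 h1 h2 h3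
    calc 2 * (p₁₂ - p₀₃) = (p₀₁ + 0 + p₁₂ + p₁₃) + (p₀₂ + p₁₂ + 0 + p₂₃) -
          (0 + p₀₁ + p₀₂ + p₀₃) - (p₀₃ + p₁₃ + p₂₃ + 0) := by rw [two_mul]; abel
      _ = 0 := by rw [h0, h1, h2, h3]; simp
  exact sub_eq_zero.1 ((mul_eq_zero.1 (key _ _ _ _ _ _ h0 h1 h2 h3)).resolve_left hA.two_ne_zero)

/-- In a star with an involution exchanging opposite planes, the images of the sides of a closed
polygon are the sides of another one. Their sum, or the polygon itself, is symmetric. -/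
theorem IsWalk.isSymmetricStar_of_semiisometry (hK : ∀ x y : K, x * y = y * x)
    (hW : q.HasWittIndexTwo) {x : Config K V} (hx : IsWalk q x) (hs : IsLineStar x)
    (h4 : finrank Kᵐᵒᵖ (⨆ i, (x.2 i).1 : Submodule Kᵐᵒᵖ V) ≤ 4) {s : V →+ V}
    (h : IsSemiisometry q s) (hl : ∀ v ∈ (x.1 0).1, s v ∈ (x.1 0).1)
    (hp : ∀ i, ∀ v ∈ (x.2 i).1, s v ∈ (x.2 (i + 2)).1) : IsSymmetricStar q x := by
  obtain ⟨a, ha, hla⟩ := exists_eq_span_singleton (x.1 0).2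
  have ma : a ∈ (x.1 0).1 := hla ▸ Submodule.mem_span_singleton_self a
  obtain ⟨v₀, m0, n0⟩ := exists_mem_notMem (x.1 0).2 (x.2 0).2
  obtain ⟨v₁, m1, n1⟩ := exists_mem_notMem (x.1 0).2 (x.2 1).2
  have hsl : ∀ v, v ∉ (x.1 0).1 → s v ∉ (x.1 0).1 := fun v hv hsv => hv (by
    simpa [h.involutive] using hl _ hsv)
  set v : Fin 4 → V := ![v₀, v₁, s v₀, s v₁] with hv'
  have hv : ∀ i, v i ∈ (x.2 i).1 ∧ v i ∉ (x.1 0).1 := by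
    intro i
    fin_cases i
    exacts [⟨m0, n0⟩, ⟨m1, n1⟩, ⟨hp 0 _ m0, hsl _ n0⟩, ⟨hp 1 _ m1, hsl _ n1⟩]
  have hle : ∀ i, (x.2 i).1 ≤ ⨆ i, (x.2 i).1 := le_iSup fun i => (x.2 i).1
  obtain ⟨c, hc, hsum⟩ := exists_relation_of_finrank_le h4 ha (hle 0 (hx.le_star hs 0 ma))
    (fun i => hle i (hv i).1)
  rw [← hla] at hsum
  have hq : q v₁ (s v₀) = q v₀ (s v₁) := by
    rw [q.hermitian (s v₁) v₀, ← h.map_form, h.involutive]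
  have hsum' : v 0 <• σ (c 2) + v 1 <• σ (c 3) + v 2 <• σ (c 0) + v 3 <• σ (c 1) ∈ (x.1 0).1 := by
    have := hl _ hsum
    simp only [map_add, h.map_smul] at this
    convert this using 1
    simp only [hv', Matrix.cons_val, h.involutive]
    abel
  by_cases hcc : ∀ i, c i = - σ (c (i + 2))
  · refine hx.isSymmetricStar_of_relation hW hs hv hc hsum ?_
    have e2 : c 2 = - σ (c 0) := hcc 2
    have e3 : c 3 = - σ (c 1) := hcc 3
    change q (v₁ <• c 1) (s v₀ <• c 2) = q (v₀ <• c 0) (s v₁ <• c 3)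
    simp only [q.map_smul_left, q.map_smul_right, MulOpposite.unop_op, e2, e3, hq, mul_neg]
    rw [hK (σ (c 1)), hK (q v₀ _) (σ (c 0)), mul_assoc]
  · refine hx.isSymmetricStar_of_relation hW hs hv (c := fun i => c i + σ (c (i + 2))) ?_ ?_ ?_
    · exact fun h0 => hcc fun i => eq_neg_of_add_eq_zero_left (congrFun h0 i)
    · convert (x.1 0).1.add_mem hsum hsum' using 1
      change v 0 <• (c 0 + σ (c 2)) + v 1 <• (c 1 + σ (c 3)) + v 2 <• (c 2 + σ (c 0)) +
        v 3 <• (c 3 + σ (c 1)) = _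
      simp only [MulOpposite.op_add, add_smul]
      abel
    · change q (v 1 <• (c 1 + σ (c 3))) (v 2 <• (c 2 + σ (c 0))) =
        q (v 0 <• (c 0 + σ (c 2))) (v 3 <• (c 3 + σ (c 1)))
      have e2 : c 2 + σ (c 0) = σ (c 0 + σ (c 2)) := by simp [add_comm]
      have e3 : c 3 + σ (c 1) = σ (c 1 + σ (c 3)) := by simp [add_comm]
      rw [e2, e3]
      generalize c 0 + σ (c 2) = y, c 1 + σ (c 3) = z
      change q (v₁ <• z) (s v₀ <• σ y) = q (v₀ <• y) (s v₁ <• σ z)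
      simp only [q.map_smul_left, q.map_smul_right, MulOpposite.unop_op, hq]
      rw [hK (σ z), hK (q v₀ _) (σ y), mul_assoc]

omit [FiniteDimensional Kᵐᵒᵖ V] in
theorem finrank_iSup_le_four {x : Config K V} {a : V} {v : Fin 4 → V}
    (hP : ∀ i, (x.2 i).1 = Submodule.span Kᵐᵒᵖ {a, v i}) (hsum : v 0 + v 1 + v 2 + v 3 = 0) :
    finrank Kᵐᵒᵖ (⨆ i, (x.2 i).1 : Submodule Kᵐᵒᵖ V) ≤ 4 := by
  classical
  have hle : (⨆ i, (x.2 i).1) ≤ Submodule.span Kᵐᵒᵖ (({a, v 0, v 1, v 2} : Finset V) : Set V) := by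
    have m : ∀ w ∈ ({a, v 0, v 1, v 2} : Finset V),
        w ∈ Submodule.span Kᵐᵒᵖ (({a, v 0, v 1, v 2} : Finset V) : Set V) :=
      fun w hw => Submodule.subset_span hw
    have h3 : v 3 = -(v 0 + v 1 + v 2) := (neg_eq_of_add_eq_zero_right hsum).symm
    refine iSup_le fun i => ?_
    rw [hP, Submodule.span_le]
    rintro w (rfl | rfl)
    · exact m _ (by simp)
    · fin_cases i
      · exact m _ (by simp)
      · exact m _ (by simp)
      · exact m _ (by simp)
      · change v 3 ∈ _
        rw [h3]
        exact Submodule.neg_mem _ (Submodule.add_mem _ (Submodule.add_mem _ (m _ (by simp))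
          (m _ (by simp))) (m _ (by simp)))
  exact (Submodule.finrank_mono hle).trans ((finrank_span_finset_le_card _).trans
    Finset.card_le_four)

omit [FiniteDimensional Kᵐᵒᵖ V] in
/-- The opposite of the reflection in `m`: it fixes `m` and inverts its orthogonal complement. -/
theorem exists_neg_reflection (hσ : σ.IsTrivial) {m : V} (hm : q m m ≠ 0) :
    ∃ s : V →+ V, IsSemiisometry q s ∧
      ∀ v, s v = m <• (2 * (q m m)⁻¹ * q m v) - v := by
  have hK := hσ.mul_comm
  obtain ⟨c, hc⟩ : ∃ c, c = 2 * (q m m)⁻¹ := ⟨_, rfl⟩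
  have hcm : q m m * c = 2 := by rw [hK, hc, mul_assoc, inv_mul_cancel₀ hm, mul_one]
  rw [← hc]
  let s : V →+ V :=
    { toFun v := m <• (c * q m v) - v
      map_zero' := by simp
      map_add' v w := by
        simp only [q.map_add_right, mul_add, MulOpposite.op_add, add_smul]
        abel }
  have sdef : ∀ v, s v = m <• (c * q m v) - v := fun _ => rfl
  refine ⟨s, ⟨fun v x => ?_, fun v w => ?_, fun v => ?_⟩, sdef⟩
  · rw [sdef, sdef, hσ, q.map_smul_right, smul_sub, op_smul_op_smul, mul_assoc, MulOpposite.unop_op]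
  · have hvm : q v m = q m v := by rw [q.hermitian m v, hσ]
    have e : c * q m v * (q m m * (c * q m w)) = c * q m v * q m w + c * q m v * q m w := by
      rw [← mul_assoc (q m m), hcm, two_mul, mul_add]
    have e' : q m v * (c * q m w) = c * q m v * q m w := by rw [← mul_assoc, hK c]
    simp only [sdef, q.map_sub_left, q.map_sub_right, q.map_smul_left, q.map_smul_right,
      MulOpposite.unop_op, hσ _, hvm, e, e']
    abel
  · have : q m (s v) = q m v := by
      rw [sdef, q.map_sub_right, q.map_smul_right, MulOpposite.unop_op, ← mul_assoc, hcm, two_mul,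
        add_sub_cancel_right]
    rw [sdef, this, sdef, sub_sub_cancel]

/-- In a symmetric star, there is an involution that exchanges opposite sides of the polygon. -/
theorem IsSymmetricStar.exists_semiisometry [TopologicalSpace K] (hA : IsAmbient q)
    (hK : ∀ x y : K, x * y = y * x)
    {x : Config K V} (hx : IsWalk q x) (hs : IsLineStar x)
    (h : IsSymmetricStar q x) :
    finrank Kᵐᵒᵖ (⨆ i, (x.2 i).1 : Submodule Kᵐᵒᵖ V) ≤ 4 ∧ ∃ s : V →+ V, IsSemiisometry q s ∧
      (∀ v ∈ (x.1 0).1, s v ∈ (x.1 0).1) ∧ ∀ i, ∀ v ∈ (x.2 i).1, s v ∈ (x.2 (i + 2)).1 := by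
  obtain ⟨a, ha, hl⟩ := exists_eq_span_singleton (x.1 0).2
  have ma : a ∈ (x.1 0).1 := hl ▸ Submodule.mem_span_singleton_self a
  have haa : q a a = 0 := hx.isotropic 0 _ (hx.le 0 ma) _ (hx.le 0 ma)
  obtain ⟨b, hbb, hab⟩ := hA.nondegenerate.exists_partner hA.two_ne_zero ha haa
  have hba : q b a = 1 := by rw [q.hermitian a b, hab, σ.map_one]
  obtain ⟨v, hv, hbv, hav, hsum, hrel, hrel'⟩ := h.exists_orthogonal hx hs hl hba
  have hP : ∀ i, (x.2 i).1 = Submodule.span Kᵐᵒᵖ {a, v i} := fun i =>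
    eq_span_pair (x.2 i).2 (hx.le_star hs i ma) (hv i).1 ha (hl ▸ (hv i).2)
  have hvv : ∀ i, q (v i) (v i) = 0 := fun i => hx.isotropic i _ (hv i).1 _ (hv i).1
  have hne : ∀ i j, i ≠ j → q (v i) (v j) ≠ 0 := fun i j hij =>
    hx.star_ne_zero hA.witt hs hij (hv i).1 (hv j).1 (hv i).2 (hv j).2
  refine ⟨finrank_iSup_le_four hP hsum, ?_⟩
  -- it suffices to exchange the sides and to preserve the central line
  suffices H : ∃ s : V →+ V, IsSemiisometry q s ∧ s a ∈ (x.1 0).1 ∧ s (v 0) = v 2 ∧ s (v 1) = v 3 by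
    obtain ⟨s, hs', hsa, h0, h1⟩ := H
    have hl' : ∀ w ∈ (x.1 0).1, s w ∈ (x.1 0).1 := by
      intro w hw
      obtain ⟨y, rfl⟩ := mem_span_singleton_iff.1 (hl ▸ hw)
      rw [hs'.map_smul]
      exact (x.1 0).1.smul_mem _ hsa
    have hsv : ∀ i, s (v i) = v (i + 2) := by
      intro i
      fin_cases i
      exacts [h0, h1, h0 ▸ hs'.involutive _, h1 ▸ hs'.involutive _]
    refine ⟨s, hs', hl', fun i w hw => ?_⟩
    obtain ⟨y, z, rfl⟩ := mem_span_pair_iff.1 (hP i ▸ hw)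
    rw [map_add, hs'.map_smul, hs'.map_smul, hsv]
    exact (x.2 _).1.add_mem ((x.2 _).1.smul_mem _ (hx.le_star hs _ hsa))
      ((x.2 _).1.smul_mem _ (hv _).1)
  have h13 : v 1 + v 3 = -(v 0 + v 2) := by
    rw [eq_neg_iff_add_eq_zero, ← hsum]
    abel
  by_cases hσ : σ.IsTrivial
  · have hsymm : ∀ u w : V, q u w = q w u := fun u w => by rw [q.hermitian w u, hσ]
    have hmm : q (v 0 + v 2) (v 0 + v 2) = 2 * q (v 0) (v 2) := by
      simp [hvv, hsymm (v 2) (v 0), two_mul]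
    have hmm' : q (v 0 + v 2) (v 0 + v 2) = 2 * q (v 1) (v 3) := by
      rw [← neg_neg (v 0 + v 2), ← h13]
      simp [hvv, hsymm (v 3) (v 1), two_mul]
    have hm0 : q (v 0 + v 2) (v 0 + v 2) ≠ 0 := by
      rw [hmm]
      exact mul_ne_zero hA.two_ne_zero (hne 0 2 (by decide))
    obtain ⟨s, hs', hsv⟩ := exists_neg_reflection hσ hm0
    refine ⟨s, hs', ?_, ?_, ?_⟩
    · have : q (v 0 + v 2) a = 0 := q.swap_eq_zero (by simp [hav])
      rw [hsv, this]
      simpa using ma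
    · have : q (v 0 + v 2) (v 0) = q (v 0) (v 2) := by simp [hvv, hsymm (v 2) (v 0)]
      rw [hsv, this, hK 2, mul_assoc, ← hmm, inv_mul_cancel₀ hm0]
      simp
    · have : q (v 0 + v 2) (v 1) = - q (v 1) (v 3) := by
        rw [← neg_neg (v 0 + v 2), ← h13]
        simp [hvv, hsymm (v 3) (v 1)]
      rw [hsv, this, mul_neg, hK 2, mul_assoc, ← hmm', inv_mul_cancel₀ hm0]
      simp only [MulOpposite.op_neg, MulOpposite.op_one, neg_smul, one_smul, ← h13]
      abel
  · obtain ⟨z, hz⟩ : ∃ z, σ z ≠ z := by simpa [AntiInvolution.IsTrivial] using hσ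
    -- the sums of opposite sides are to be fixed, and the differences to be inverted, so that their
    -- products by a skew scalar are to be fixed
    obtain ⟨ε, hε0, hε⟩ : ∃ ε, ε ≠ 0 ∧ σ ε = -ε :=
      ⟨z - σ z, sub_ne_zero.2 hz.symm, by simp⟩
    set m := v 0 + v 2 with hm
    set n₀ := (v 0 - v 2) <• ε with hn₀
    set n₁ := (v 1 - v 3) <• ε with hn₁
    have hva := fun i => q.swap_eq_zero (hav i)
    have hvb := fun i => q.swap_eq_zero (hbv i)
    have e0 : v 0 = (m + n₀ <• ε⁻¹) <• (2⁻¹ : K) := by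
      rw [hn₀, smul_inv_cancel_right hε0, hm]
      have : v 0 + v 2 + (v 0 - v 2) = v 0 <• (2 : K) := by
        rw [← one_add_one_eq_two, MulOpposite.op_add, add_smul, MulOpposite.op_one, one_smul]
        abel
      rw [this, smul_inv_cancel_right hA.two_ne_zero]
    have e1 : v 1 = (n₁ <• ε⁻¹ - m) <• (2⁻¹ : K) := by
      rw [hn₁, smul_inv_cancel_right hε0, sub_eq_add_neg, ← h13]
      have : v 1 - v 3 + (v 1 + v 3) = v 1 <• (2 : K) := by
        rw [← one_add_one_eq_two, MulOpposite.op_add, add_smul, MulOpposite.op_one, one_smul]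
        abel
      rw [this, smul_inv_cancel_right hA.two_ne_zero]
    obtain ⟨Y, hXY, hYs, hY⟩ := exists_spanning_fixed (q := q) (X := {a, b, m, n₀, n₁}) (by
        have symm : ∀ u w, σ (q u w) = q u w → σ (q w u) = q w u := fun u w h => by
          rw [q.hermitian u w, h, h]
        have r32 : q (v 2) (v 3) = σ (q (v 0) (v 1)) := by rw [hrel', q.hermitian (v 3)]
        have r21 : q (v 2) (v 1) = σ (q (v 0) (v 3)) := by rw [← hrel, q.hermitian (v 1)]
        have f0 : σ (q m n₀) = q m n₀ := by
          have : q m n₀ = (σ (q (v 0) (v 2)) - q (v 0) (v 2)) * ε := by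
            simp only [hm, hn₀, q.map_add_left, q.map_smul_right, q.map_sub_right, hvv,
              q.hermitian (v 0) (v 2), MulOpposite.unop_op]
            simp [sub_eq_add_neg, add_comm, add_mul]
          rw [this, σ.map_mul, σ.map_sub, σ.involutive, hε, hK, ← neg_sub, neg_mul_neg]
        have f1 : σ (q m n₁) = q m n₁ := by
          have : q m n₁ = (q (v 1) (v 3) - σ (q (v 1) (v 3))) * ε := by
            rw [← neg_neg m, ← h13]
            simp only [hn₁, q.map_neg_left, q.map_add_left, q.map_smul_right, q.map_sub_right, hvv,
              q.hermitian (v 1) (v 3), MulOpposite.unop_op]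
            simp [sub_eq_add_neg, add_comm, add_mul]
          rw [this, σ.map_mul, σ.map_sub, σ.involutive, hε, hK, ← neg_sub, neg_mul_neg]
        have f01 : σ (q n₀ n₁) = q n₀ n₁ := by
          have : q n₀ n₁ = -(ε * (q (v 0) (v 1) + σ (q (v 0) (v 1)) -
              (q (v 0) (v 3) + σ (q (v 0) (v 3)))) * ε) := by
            simp only [hn₀, hn₁, q.map_sub_left, q.map_smul_right, q.map_smul_left, q.map_sub_right,
              r32, r21, hε, MulOpposite.unop_op, neg_mul]
            congr 3
            abel
          simp [this, hε, add_comm, mul_assoc]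
        have za : ∀ w ∈ ({m, n₀, n₁} : Set V), q a w = 0 := by
          simp [hm, hn₀, hn₁, hav]
        have zb : ∀ w ∈ ({m, n₀, n₁} : Set V), q b w = 0 := by
          simp [hm, hn₀, hn₁, hbv]
        have fa : ∀ w ∈ ({m, n₀, n₁} : Set V), σ (q a w) = q a w := fun w hw => by
          rw [za w hw, σ.map_zero]
        have fb : ∀ w ∈ ({m, n₀, n₁} : Set V), σ (q b w) = q b w := fun w hw => by
          rw [zb w hw, σ.map_zero]
        simp only [Set.mem_insert_iff, Set.mem_singleton_iff, forall_eq_or_imp, forall_eq] at fa fb ⊢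
        have fab : σ (q a b) = q a b := by rw [hab, σ.map_one]
        obtain ⟨fam, fa0, fa1⟩ := fa
        obtain ⟨fbm, fb0, fb1⟩ := fb
        exact ⟨⟨q.map_self _, fab, fam, fa0, fa1⟩, ⟨symm _ _ fab, q.map_self _, fbm, fb0, fb1⟩,
          ⟨symm _ _ fam, symm _ _ fbm, q.map_self _, f0, f1⟩,
          ⟨symm _ _ fa0, symm _ _ fb0, symm _ _ f0, q.map_self _, f01⟩,
          ⟨symm _ _ fa1, symm _ _ fb1, symm _ _ f1, symm _ _ f01, q.map_self _⟩⟩)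
      (by
        intro Y hXY d hd hdY
        have md : ∀ w ∈ Submodule.span Kᵐᵒᵖ Y, q d w = 0 := fun w hw =>
          q.eq_zero_of_mem_span hdY hw
        have mY : ∀ w ∈ ({a, b, m, n₀, n₁} : Set V), w ∈ Submodule.span Kᵐᵒᵖ Y := fun w hw =>
          Submodule.subset_span (hXY hw)
        have da : q a d = 0 := q.swap_eq_zero (md a (mY a (by simp)))
        have db : q b d = 0 := q.swap_eq_zero (md b (mY b (by simp)))
        have d0 : q (v 0) d = 0 := q.swap_eq_zero (md _ (by
          rw [e0]
          exact Submodule.smul_mem _ _ (Submodule.add_mem _ (mY m (by simp))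
            (Submodule.smul_mem _ _ (mY n₀ (by simp))))))
        have d1 : q (v 1) d = 0 := q.swap_eq_zero (md _ (by
          rw [e1]
          exact Submodule.smul_mem _ _ (Submodule.sub_mem _
            (Submodule.smul_mem _ _ (mY n₁ (by simp))) (mY m (by simp)))))
        have hdP : d ∈ (x.2 0).1 := by
          refine hA.witt.mem_of_isotropic (hx.isotropic 0) (x.2 0).2 (md d hd) fun w hw => ?_
          obtain ⟨y, z, rfl⟩ := mem_span_pair_iff.1 (hP 0 ▸ hw)
          simp [da, d0]
        obtain ⟨y, z, rfl⟩ := mem_span_pair_iff.1 (hP 0 ▸ hdP)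
        have hy : y = 0 := by simpa [hba, hbv] using db
        have hz : z = 0 := by simpa [hva, hne 1 0 (by decide)] using d1
        simp [hy, hz])
    obtain ⟨s, hs', hsY⟩ := exists_conjugation hK hYs hY hA.nondegenerate
    have sm : s m = m := hsY m (hXY (by simp))
    have sn₀ : s n₀ = n₀ := hsY n₀ (hXY (by simp))
    have sn₁ : s n₁ = n₁ := hsY n₁ (hXY (by simp))
    refine ⟨s, hs', ?_, ?_, ?_⟩
    · rw [hsY a (hXY (by simp))]
      exact ma
    · rw [e0, hs'.map_smul, map_add, hs'.map_smul, sm, sn₀, σ.map_inv, σ.map_inv, hε, σ.map_two,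
        hn₀, inv_neg, MulOpposite.op_neg, neg_smul, smul_inv_cancel_right hε0, hm]
      have : v 0 + v 2 + -(v 0 - v 2) = v 2 <• (2 : K) := by
        rw [← one_add_one_eq_two, MulOpposite.op_add, add_smul, MulOpposite.op_one, one_smul]
        abel
      rw [this, smul_inv_cancel_right hA.two_ne_zero]
    · rw [e1, hs'.map_smul, map_sub, hs'.map_smul, sm, sn₁, σ.map_inv, σ.map_inv, hε, σ.map_two,
        hn₁, inv_neg, MulOpposite.op_neg, neg_smul, smul_inv_cancel_right hε0, sub_eq_add_neg, ← h13]
      have : -(v 1 - v 3) + (v 1 + v 3) = v 3 <• (2 : K) := by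
        rw [← one_add_one_eq_two, MulOpposite.op_add, add_smul, MulOpposite.op_one, one_smul]
        abel
      rw [this, smul_inv_cancel_right hA.two_ne_zero]

end Witt

end Form

section Form

variable {K : Type*} [DivisionRing K] {σ : AntiInvolution K}
  {V : Type*} [AddCommGroup V] [Module Kᵐᵒᵖ V] {q : HermitianForm σ V}

/-! ### Frames adapted to a plane -/

namespace Frame

/-- The orthogonal projection preserves the form on the orthogonal complement of a plane of the
apartment, since this plane is the radical of its complement. -/
theorem map_proj (E : Frame q) {v : V} {i : Fin 4} (h : q (E.e i) v = 0)
    (h' : q (E.e (i + 1)) v = 0) : q (E.proj v) (E.proj v) = q v v := by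
  have hs := q.swap_eq_zero h
  have hs' := q.swap_eq_zero h'
  fin_cases i <;> simp only [Fin.zero_eta, Fin.mk_one, Fin.reduceFinMk, Fin.isValue, zero_add,
    Fin.reduceAdd] at h h' hs hs' <;> simp [proj, Fin.sum_univ_four, E.gram, h, h', hs, hs']

theorem notMem_span_of_pairing {w y z : V} (hwy : q w y = 0)
    (hwz : q w z = 1) : z ∉ Submodule.span Kᵐᵒᵖ {y} := by
  intro hz
  obtain ⟨x, rfl⟩ := mem_span_singleton_iff.1 hz
  simp [hwy] at hwz

/-- Some plane of the apartment is opposite to a given totally isotropic plane. -/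
theorem exists_plane_disjoint (E : Frame q) {P : Submodule Kᵐᵒᵖ V} (hP : q.IsTotallyIsotropic P)
    (h2 : finrank Kᵐᵒᵖ P = 2) : ∃ i, ∀ v ∈ P, v ∈ (E.plane i).1.1 → v = 0 := by
  by_contra! H
  choose u huP hu hu0 using H
  have hform : ∀ i, ∃ x y : K, E.e i <• x + E.e (i + 1) <• y = u i := fun i =>
    mem_span_pair_iff.1 (hu i)
  obtain ⟨α, β, h0⟩ := hform 0
  obtain ⟨γ, δ, h2'⟩ := hform 2
  replace h0 : E.e 0 <• α + E.e 1 <• β = u 0 := h0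
  replace h2' : E.e 2 <• γ + E.e 3 <• δ = u 2 := h2'
  have hPs : P = Submodule.span Kᵐᵒᵖ {u 0, u 2} := by
    refine eq_span_pair h2 (huP 0) (huP 2) (hu0 0) fun hm => hu0 2 ?_
    obtain ⟨x, hx⟩ := mem_span_singleton_iff.1 hm
    rw [← h0] at hx
    have hγ : γ = 0 := by
      have := congrArg (q (E.e 0)) (hx.trans h2'.symm)
      simpa [E.gram, eq_comm] using this
    have hδ : δ = 0 := by
      have := congrArg (q (E.e 1)) (hx.trans h2'.symm)
      simpa [E.gram, eq_comm] using this
    rw [← h2', hγ, hδ]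
    simp
  have hαβ : σ α * γ + σ β * δ = 0 := by
    have := hP _ (huP 0) _ (huP 2)
    rw [← h0, ← h2'] at this
    simpa [E.gram] using this
  -- the vectors of `P` in the two other planes
  obtain ⟨x, y, h1⟩ := mem_span_pair_iff.1 (hPs ▸ huP 1)
  obtain ⟨x', y', h3⟩ := mem_span_pair_iff.1 (hPs ▸ huP 3)
  obtain ⟨a, b, h1'⟩ := hform 1
  obtain ⟨a', b', h3'⟩ := hform 3
  replace h1' : E.e 1 <• a + E.e 2 <• b = u 1 := h1'
  replace h3' : E.e 3 <• a' + E.e 0 <• b' = u 3 := h3'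
  have r1 := h1.trans h1'.symm
  have r3 := h3.trans h3'.symm
  rw [← h0, ← h2'] at r1 r3
  have hαx : α * x = 0 := by simpa [E.gram] using congrArg (q (E.e 2)) r1
  have hδy : δ * y = 0 := by simpa [E.gram] using congrArg (q (E.e 1)) r1
  have hβx : β * x' = 0 := by simpa [E.gram] using congrArg (q (E.e 3)) r3
  have hγy : γ * y' = 0 := by simpa [E.gram] using congrArg (q (E.e 0)) r3
  have n0 : ¬ (α = 0 ∧ β = 0) := fun h => hu0 0 (by rw [← h0, h.1, h.2]; simp)
  have n2 : ¬ (γ = 0 ∧ δ = 0) := fun h => hu0 2 (by rw [← h2', h.1, h.2]; simp)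
  have n1 : ¬ (x = 0 ∧ y = 0) := fun h => hu0 1 (by rw [← h1, h.1, h.2]; simp)
  have n3 : ¬ (x' = 0 ∧ y' = 0) := fun h => hu0 3 (by rw [← h3, h.1, h.2]; simp)
  by_cases hα : α = 0
  · have hβ : β ≠ 0 := fun h => n0 ⟨hα, h⟩
    have hδ : δ = 0 := by simpa [hα, hβ] using hαβ
    have hγ : γ ≠ 0 := fun h => n2 ⟨h, hδ⟩
    exact n3 ⟨by simpa [hβ] using hβx, by simpa [hγ] using hγy⟩
  · have hx : x = 0 := by simpa [hα] using hαx
    have hδ : δ = 0 := (mul_eq_zero.1 hδy).resolve_right fun h => n1 ⟨hx, h⟩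
    have hγ : γ ≠ 0 := fun h => n2 ⟨h, hδ⟩
    simp [hδ, hα, hγ] at hαβ

variable [FiniteDimensional Kᵐᵒᵖ V]

/-- Any basis of a totally isotropic plane is part of a frame whose orthogonal complement takes the
same values as that of a given frame. -/
theorem exists_adapted (E : Frame q) (hW : q.HasWittIndexTwo) {u w : V} (hu0 : u ≠ 0)
    (hw0 : w ∉ Submodule.span Kᵐᵒᵖ {u}) (hu : q u u = 0) (hw : q w w = 0) (huw : q u w = 0) :
    ∃ E' : Frame q, E'.e 0 = u ∧ E'.e 1 = w ∧
      (∀ v ∈ E.perp, ∃ v' ∈ E'.perp, q v' v' = q v v) ∧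
      ∀ v ∈ E'.perp, ∃ v' ∈ E.perp, q v' v' = q v v := by
  have hP := q.isTotallyIsotropic_span_pair hu hw huw
  have h2 := finrank_span_pair hu0 hw0
  obtain ⟨i, hi⟩ := E.exists_plane_disjoint hP h2
  have hPi : q.IsTotallyIsotropic (E.plane i).1.1 := (E.plane i).1.2.2
  have := finite_op_self (K := K)
  have hfin : FiniteDimensional Kᵐᵒᵖ (E.plane i).1.1 := inferInstance
  -- the plane of the frame is dual to the given one
  let g : (E.plane i).1.1 →ₗ[Kᵐᵒᵖ] K × K :=
    ((q.toLinear u).prod (q.toLinear w)).comp (Submodule.subtype _)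
  have hg : Function.Injective g := by
    rw [← LinearMap.ker_eq_bot, LinearMap.ker_eq_bot']
    intro v hv
    have h1 : q u v.1 = 0 := congrArg Prod.fst hv
    have h3 : q w v.1 = 0 := congrArg Prod.snd hv
    refine Subtype.ext (hi _ (hW.mem_of_isotropic hP h2 (hPi _ v.2 _ v.2) fun z hz => ?_) v.2)
    obtain ⟨x, y, rfl⟩ := mem_span_pair_iff.1 hz
    simp [h1, h3]
  have hdim : finrank Kᵐᵒᵖ (E.plane i).1.1 = finrank Kᵐᵒᵖ (K × K) := by
    rw [finrank_prod, finrank_op_self, E.finrank_plane]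
  have hsurj := (LinearMap.injective_iff_surjective_of_finrank_eq_finrank hdim).1 hg
  obtain ⟨y, hy⟩ := hsurj (1, 0)
  obtain ⟨z, hz⟩ := hsurj (0, 1)
  have huy : q u y = 1 := congrArg Prod.fst hy
  have hwy : q w y = 0 := congrArg Prod.snd hy
  have huz : q u z = 0 := congrArg Prod.fst hz
  have hwz : q w z = 1 := congrArg Prod.snd hz
  have hy0 : y.1 ≠ 0 := by
    intro h
    rw [h] at huy
    simp at huy
  have hspan := eq_span_pair (E.finrank_plane i) y.2 z.2 hy0 (notMem_span_of_pairing hwy hwz)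
  let E' : Frame q := Frame.mk' hu hw (hPi _ y.2 _ y.2) (hPi _ z.2 _ z.2) huw huz hwy
    (hPi _ z.2 _ y.2) huy hwz
  refine ⟨E', rfl, rfl, fun v hv => ⟨E'.proj v, E'.proj_mem v, ?_⟩,
    fun v hv => ⟨E.proj v, E.proj_mem v, ?_⟩⟩
  · have hz : ∀ z ∈ (E.plane i).1.1, q z v = 0 := fun z hz => by
      obtain ⟨a, b, rfl⟩ := mem_span_pair_iff.1 hz
      simp [hv i, hv (i + 1)]
    exact E'.map_proj (i := 2) (hz _ y.2) (hz _ z.2)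
  · have hyv : q y v = 0 := hv 2
    have hzv : q z v = 0 := hv 3
    have hz : ∀ a ∈ (E.plane i).1.1, q a v = 0 := fun a ha => by
      obtain ⟨b, c, rfl⟩ := mem_span_pair_iff.1 (hspan ▸ ha)
      simp [hyv, hzv]
    exact E.map_proj (i := i) (hz _ (E.e_mem_plane i)) (hz _ (E.e_succ_mem_plane i))

end Frame

/-! ### Quadripods of plane-type -/

variable [TopologicalSpace V] [TopologicalSpace K] [IsTopologicalRing K]
  [IsTopologicalAddGroup V] [ContinuousSMul Kᵐᵒᵖ V] [FiniteDimensional Kᵐᵒᵖ V]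

omit [FiniteDimensional Kᵐᵒᵖ V] in
/-- A star of lines in a plane is a limit of apartments if some equations can be solved: two of the
four generators are moved out of the plane, by `v t` and `v' t` up to corrections of second order
that lie in an opposite plane. -/
theorem IsAmbient.mem_closure_of_equations (hA : IsAmbient q) (E : Frame q) {x : Config K V}
    (hs : IsPlaneStar x) {c : K} (hc1 : c ≠ 1)
    (h0 : (x.1 0).1 = Submodule.span Kᵐᵒᵖ {E.e 0}) (h1 : (x.1 1).1 = Submodule.span Kᵐᵒᵖ {E.e 1})
    (h2 : (x.1 2).1 = Submodule.span Kᵐᵒᵖ {E.e 0 + E.e 1})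
    (h3 : (x.1 3).1 = Submodule.span Kᵐᵒᵖ {E.e 0 <• c + E.e 1})
    (hP : (x.2 0).1 = Submodule.span Kᵐᵒᵖ {E.e 0, E.e 1})
    {y z : K} {v v' : V} (hy0 : y ≠ 0) (hz0 : z ≠ 0) (hv : v ∈ E.perp) (hv' : v' ∈ E.perp)
    (hy : y + σ y + q v v = 0) (hz : z + σ z + q v' v' = 0) (hyz : z + σ y * c + q v v' = 0) :
    x ∈ closure (apartments q) := by
  have hw := fun i => q.swap_eq_zero (hv i)
  have hw' := fun i => q.swap_eq_zero (hv' i)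
  have hPi : ∀ i, (x.2 i).1 = Submodule.span Kᵐᵒᵖ {E.e 0, E.e 1} := fun i =>
    (congrArg Subtype.val (hs.1 i)).trans hP
  refine mem_closure_of_four_curves hA.accumulates (fun _ => E.e 0) (fun _ => E.e 1)
    (fun t => E.e 0 + E.e 1 + E.e 2 <• (y * (t * t)) + v <• t)
    (fun t => E.e 0 <• c + E.e 1 + E.e 3 <• (z * (t * t)) + v' <• t)
    (fun _ => E.e 0) (fun _ => E.e 1)
    (fun _ => E.e 1) (fun t => E.e 0 + E.e 1 + E.e 2 <• (y * (t * t)) + v <• t)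
    (fun t => E.e 0 + E.e 1 + E.e 2 <• (y * (t * t)) + v <• t)
    (fun t => E.e 0 <• c + E.e 1 + E.e 3 <• (z * (t * t)) + v' <• t)
    (fun t => E.e 0 <• c + E.e 1 + E.e 3 <• (z * (t * t)) + v' <• t) (fun _ => E.e 0)
    (by simpa using h0) (by simpa using h1) (by simpa using h2) (by simpa using h3)
    (hPi 0) ?_ ?_ ?_ ?_ (fun _ _ => rfl) (fun _ _ => rfl) (fun _ _ => rfl) (fun _ _ => rfl)
  · rw [hPi, Set.pair_comm]
    exact span_pair_eq (x := 1) one_ne_zero (by simp [add_comm])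
  · rw [hPi]
    simp only [mul_zero, MulOpposite.op_zero, zero_smul, add_zero]
    rw [span_pair_eq (u := E.e 0) (v := E.e 1) (w := E.e 0 + E.e 1) (x := 1) one_ne_zero (by simp),
      Set.pair_comm]
    refine span_pair_eq (x := 1) (y := c - 1) (sub_ne_zero.2 hc1) ?_
    simp only [MulOpposite.op_sub, MulOpposite.op_one, sub_smul, one_smul]
    abel
  · rw [hPi]
    simp only [mul_zero, MulOpposite.op_zero, zero_smul, add_zero]
    rw [Set.pair_comm (_ + _)]
    exact span_pair_eq (x := c) one_ne_zero (by simp)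
  rintro t ⟨ht0, hσt, htc⟩
  have c1 : ∀ y, t * (y * t) = y * (t * t) := fun y => by rw [← mul_assoc, htc, mul_assoc]
  have c2 : ∀ y, t * (t * y) = y * (t * t) := fun y => by rw [htc y, c1]
  have htt : t * t ≠ 0 := mul_ne_zero ht0 ht0
  apply IsMarked.of_vectors
  · simp [E.gram]
  · simp [E.gram]
  · have : y * (t * t) + σ y * (t * t) + q v v * (t * t) = 0 := by
      rw [← add_mul, ← add_mul, hy, zero_mul]
    simp [E.gram, hv _, hw _, hσt, mul_assoc, c1, c2]
    rw [← this]
    abel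
  · have : z * (t * t) + σ z * (t * t) + q v' v' * (t * t) = 0 := by
      rw [← add_mul, ← add_mul, hz, zero_mul]
    simp [E.gram, hv' _, hw' _, hσt, mul_assoc, c1, c2]
    rw [← this]
    abel
  · simp [E.gram]
  · simp [E.gram, hv _]
  · have : z * (t * t) + σ y * c * (t * t) + q v v' * (t * t) = 0 := by
      rw [← add_mul, ← add_mul, hyz, zero_mul]
    simp [E.gram, hv' _, hw _, hσt, mul_assoc, c1, c2]
    rw [← this]
    simp only [mul_assoc]
    abel
  · simp [E.gram, hv' _]
  · simpa [E.gram, hv _, ht0] using hy0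
  · simpa [E.gram, hv' _, ht0] using hz0

end Form

section Form

variable {K : Type*} [DivisionRing K] {σ : AntiInvolution K}
  {V : Type*} [AddCommGroup V] [Module Kᵐᵒᵖ V] {q : HermitianForm σ V}

/-- The four lines of a star with cross-ratio `c` are distinct. -/
theorem IsPlaneStar.crossRatio_ne {x : Config K V} (hs : IsPlaneStar x) {c : K}
    (hc : IsCrossRatio (fun i => (x.1 i).1) c) : c ≠ 0 ∧ c ≠ 1 := by
  obtain ⟨u, w, -, -, h1, h2, h3⟩ := hc
  constructor
  · rintro rfl
    have : x.1 3 = x.1 1 := Subtype.ext (h3.trans (by simpa using h1.symm))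
    exact absurd (hs.2 this) (by decide)
  · rintro rfl
    have : x.1 3 = x.1 2 := Subtype.ext (h3.trans (by simpa using h2.symm))
    exact absurd (hs.2 this) (by decide)

/-- Vectors in the four lines of a star, completed to a frame adapted to a given one. -/
theorem IsPlaneStar.exists_frame [FiniteDimensional Kᵐᵒᵖ V] (hW : q.HasWittIndexTwo) (E : Frame q)
    {x : Config K V} (hx : IsWalk q x) (hs : IsPlaneStar x) {c : K}
    (hc : IsCrossRatio (fun i => (x.1 i).1) c) :
    ∃ E' : Frame q, (x.1 0).1 = Submodule.span Kᵐᵒᵖ {E'.e 0} ∧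
      (x.1 1).1 = Submodule.span Kᵐᵒᵖ {E'.e 1} ∧
      (x.1 2).1 = Submodule.span Kᵐᵒᵖ {E'.e 0 + E'.e 1} ∧
      (x.1 3).1 = Submodule.span Kᵐᵒᵖ {E'.e 0 <• c + E'.e 1} ∧
      (∀ i, (x.2 i).1 = Submodule.span Kᵐᵒᵖ {E'.e 0, E'.e 1}) ∧
      (∀ v ∈ E.perp, ∃ v' ∈ E'.perp, q v' v' = q v v) ∧
      ∀ v ∈ E'.perp, ∃ v' ∈ E.perp, q v' v' = q v v := by
  obtain ⟨u, w, hi, h0, h1, h2, h3⟩ := hc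
  have mu : u ∈ (x.2 0).1 := hx.le 0 (by
    rw [show (x.1 0).1 = _ from h0]
    exact Submodule.mem_span_singleton_self u)
  have mw : w ∈ (x.2 0).1 := hx.succ_le 0 (by
    rw [show (x.1 (0 + 1)).1 = _ from h1]
    exact Submodule.mem_span_singleton_self w)
  have hu0 : u ≠ 0 := hi.ne_zero 0
  have hw0 : w ∉ Submodule.span Kᵐᵒᵖ {u} := by
    intro h
    obtain ⟨y, rfl⟩ := mem_span_singleton_iff.1 h
    exact (LinearIndependent.pair_iff' hu0).1 hi _ rfl
  have hiso := hx.isotropic 0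
  obtain ⟨E', rfl, rfl, hE, hE'⟩ := E.exists_adapted hW hu0 hw0 (hiso _ mu _ mu) (hiso _ mw _ mw)
    (hiso _ mu _ mw)
  exact ⟨E', h0, h1, h2, h3, fun i => (congrArg Subtype.val (hs.1 i)).trans
    (eq_span_pair (x.2 0).2 mu mw hu0 hw0), hE, hE'⟩

variable [TopologicalSpace V] [TopologicalSpace K] [IsTopologicalRing K]
  [IsTopologicalAddGroup V] [ContinuousSMul Kᵐᵒᵖ V] [FiniteDimensional Kᵐᵒᵖ V]

/-- If `σ` is not trivial, every star of lines is a limit of apartments. The assumption on `σ` makes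
it possible to move the first three vectors inside the sum of the plane and of an opposite one. -/
theorem IsAmbient.mem_closure_of_exists_skew (hA : IsAmbient q) (E : Frame q)
    (hskew : ∀ c g : K, σ g = g → g ≠ 0 →
      ∃ y s : K, y ≠ 0 ∧ σ y = -y ∧ y * c + σ (y * c) + σ s * g * s = 0)
    {x : Config K V} (hx : IsWalk q x) (hs : IsPlaneStar x) {c : K}
    (hc : IsCrossRatio (fun i => (x.1 i).1) c) : x ∈ closure (apartments q) := by
  obtain ⟨hc0, hc1⟩ := hs.crossRatio_ne hc
  obtain ⟨E', h0, h1, h2, h3, hP, -, -⟩ := hs.exists_frame hA.witt E hx hc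
  obtain ⟨v, hv, -, hvv⟩ := hA.exists_perp E'
  obtain ⟨y, s, hy0, hy, hys⟩ := hskew c _ (q.map_self v) hvv
  refine hA.mem_closure_of_equations E' hs hc1 h0 h1 h2 h3 (hP 0) (y := y) (z := y * c) (v := 0)
    (v' := v <• s) hy0 (mul_ne_zero hy0 hc0) (fun i => q.map_zero_right _) (fun i => ?_) ?_ ?_ ?_
  · simp [hv i]
  · simp [hy]
  · simpa [mul_assoc] using hys
  · simp [hy]

/-- For `σ = id`, a star of lines with cross-ratio `c` is a limit of apartments if `1 - c` is a
quotient of values of `q` on the orthogonal complement of a frame. -/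
theorem IsAmbient.mem_closure_of_ratio (hA : IsAmbient q) (E : Frame q) (hσ : σ.IsTrivial)
    {x : Config K V} (hx : IsWalk q x) (hs : IsPlaneStar x) {c : K}
    (hc : IsCrossRatio (fun i => (x.1 i).1) c) {v v' : V} (hv : v ∈ E.perp) (hv' : v' ∈ E.perp)
    (hv0 : v ≠ 0) (hv0' : v' ≠ 0) (h : 1 - c = q v v * (q v' v')⁻¹) :
    x ∈ closure (apartments q) := by
  obtain ⟨-, hc1⟩ := hs.crossRatio_ne hc
  obtain ⟨E', h0, h1, h2, h3, hP, hE, -⟩ := hs.exists_frame hA.witt E hx hc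
  have hvv : q v v ≠ 0 := fun h => hv0 (E.perp_anisotropic hA.witt hv h)
  have hvv' : q v' v' ≠ 0 := fun h => hv0' (E.perp_anisotropic hA.witt hv' h)
  obtain ⟨m, hm, hmv⟩ := hE v' hv'
  obtain ⟨n, hn, hnv⟩ := hE v hv
  rw [← hmv] at hvv' h
  rw [← hnv] at hvv h
  clear hmv hnv hv hv' hv0 hv0'
  have hsymm : ∀ u w : V, q u w = q w u := fun u w => by rw [q.hermitian w u, hσ]
  -- one of `m + n` and `m - n` is not zero
  obtain ⟨n, hn, hvv, h, hmn⟩ : ∃ n ∈ E'.perp, q n n ≠ 0 ∧ 1 - c = q n n * (q m m)⁻¹ ∧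
      m + n ≠ 0 := by
    by_cases hmn : m + n = 0
    · refine ⟨-n, fun i => by simp [hn i], by simpa using hvv, by simpa using h, fun h' => ?_⟩
      have h2m : m <• (2 : K) = 0 := by
        rw [← one_add_one_eq_two, MulOpposite.op_add, add_smul, MulOpposite.op_one, one_smul]
        calc m + m = (m + n) + (m + -n) := by abel
          _ = 0 := by rw [hmn, h', add_zero]
      exact op_smul_ne_zero hA.two_ne_zero (fun h0 => hvv' (by simp [h0])) h2m
    · exact ⟨n, hn, hvv, h, hmn⟩
  have hmn' : m + n ∈ E'.perp := fun i => by simp [hm i, hn i]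
  have hq : q (m + n) (m + n) ≠ 0 := fun h => hmn (E'.perp_anisotropic hA.witt hmn' h)
  have h2' := hA.two_ne_zero
  refine hA.mem_closure_of_equations E' hs hc1 h0 h1 h2 h3 (hP 0) (y := -(q m m * 2⁻¹))
    (z := -(q (m + n) (m + n) * 2⁻¹)) (v := m) (v' := m + n) (neg_ne_zero.2 (mul_ne_zero hvv'
    (inv_ne_zero h2'))) (neg_ne_zero.2 (mul_ne_zero hq (inv_ne_zero h2'))) hm hmn' ?_ ?_ ?_
  · rw [hσ]
    let : Field K := { ‹DivisionRing K› with mul_comm := hσ.mul_comm }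
    field_simp
    ring
  · rw [hσ]
    let : Field K := { ‹DivisionRing K› with mul_comm := hσ.mul_comm }
    field_simp
    ring
  · have hc' : c * q m m = q m m - q n n := by
      have : (1 - c) * q m m = q n n := by rw [h, mul_assoc, inv_mul_cancel₀ hvv', mul_one]
      rw [← this, sub_mul, one_mul, sub_sub_cancel]
    simp only [hσ _, q.map_add_left, q.map_add_right, hsymm n m]
    let : Field K := { ‹DivisionRing K› with mul_comm := hσ.mul_comm }
    field_simp
    linear_combination (-1 : K) * hc'

omit [TopologicalSpace V] [TopologicalSpace K] [IsTopologicalRing K]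
  [IsTopologicalAddGroup V] [ContinuousSMul Kᵐᵒᵖ V] in
/-- Opposite lines of an apartment are not orthogonal. -/
theorem zero_two_ne_zero_of_mem_apartments (hW : q.HasWittIndexTwo) {x : Config K V}
    (hx : x ∈ apartments q) {a : Fin 4 → V} (ha : ∀ i, (x.1 i).1 = Submodule.span Kᵐᵒᵖ {a i}) :
    q (a 0) (a 2) ≠ 0 := by
  obtain ⟨hw, hl, hp⟩ := hx
  have m : ∀ i, a i ∈ (x.1 i).1 := fun i => ha i ▸ Submodule.mem_span_singleton_self _
  have a0 : ∀ i, a i ≠ 0 := fun i h => by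
    have := (x.1 i).2
    rw [ha, h, Submodule.span_zero_singleton, finrank_bot] at this
    exact zero_ne_one this
  have hne : ∀ i, i ≠ 1 → a i ∉ Submodule.span Kᵐᵒᵖ {a 1} := fun i hi h => hi (hl (Subtype.ext (by
    rw [ha, ha, span_singleton_eq_of_mem h (a0 i)])))
  exact hW.ne_zero_of_planes_ne (hw.isotropic 0) (hw.isotropic 1) (x.2 0).2 (x.2 1).2
    (fun h => absurd (hp (Subtype.ext h)) (by decide)) (a0 1) (hw.succ_le 0 (m 1)) (hw.le 1 (m 1))
    (hw.le 0 (m 0)) (hw.succ_le 1 (m 2)) (hne 0 (by decide)) (hne 2 (by decide))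

/-- For `σ = id`, the invariant that survives in the limit: with the brackets
`[i j] = α i * β j - β i * α j` of the coordinates of generators `a i` of the lines of an apartment,
the combinations `a₀ [1 2] + a₁ [2 0] + a₂ [0 1]` and `a₀ [2 3] + a₂ [3 0] + a₃ [0 2]` are orthogonal
to the plane on which the coordinates vanish, and the values of `q` on them have the ratio
`[1 2] [0 1] / [2 3] [3 0]`, which tends to `1 / (1 - c)`. -/
theorem IsAmbient.exists_ratio_of_mem_closure [ContinuousInv₀ K] [T1Space K] (hA : IsAmbient q)
    (E : Frame q)
    (hσ : σ.IsTrivial) (hqc : Continuous fun p : V × V => q p.1 p.2)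
    (hsq : {z : K | IsSquare z} ∈ 𝓝 (1 : K))
    {x : Config K V} (hx : IsWalk q x) (hs : IsPlaneStar x) {c : K}
    (hc : IsCrossRatio (fun i => (x.1 i).1) c) (h : x ∈ closure (apartments q)) :
    ∃ v ∈ E.perp, ∃ v' ∈ E.perp, v ≠ 0 ∧ v' ≠ 0 ∧ 1 - c = q v v * (q v' v')⁻¹ := by
  obtain ⟨-, hc1⟩ := hs.crossRatio_ne hc
  have hc1' : 1 - c ≠ 0 := sub_ne_zero.2 hc1.symm
  obtain ⟨E', h0, h1, h2, h3, hP, -, hE⟩ := hs.exists_frame hA.witt E hx hc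
  have hK := hσ.mul_comm
  have hsymm : ∀ u w : V, q u w = q w u := fun u w => by rw [q.hermitian w u, hσ]
  suffices H : ∃ v ∈ E'.perp, ∃ v' ∈ E'.perp, q v v ≠ 0 ∧ q v' v' ≠ 0 ∧
      1 - c = q v v * (q v' v')⁻¹ by
    obtain ⟨v, hv, v', hv', hvv, hvv', h⟩ := H
    obtain ⟨m, hm, hmv⟩ := hE v hv
    obtain ⟨n, hn, hnv⟩ := hE v' hv'
    refine ⟨m, hm, n, hn, ?_, ?_, by rw [hmv, hnv, h]⟩
    · rintro rfl
      exact hvv (by simpa using hmv.symm)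
    · rintro rfl
      exact hvv' (by simpa using hnv.symm)
  set a₀ : Fin 4 → V := ![E'.e 0, E'.e 1, E'.e 0 + E'.e 1, E'.e 0 <• c + E'.e 1] with ha₀
  have hlift := mem_closure_lifts h (a := a₀) (b := fun _ => ![E'.e 0, E'.e 1])
    (fun i => by fin_cases i; exacts [h0, h1, h2, h3]) hP
  -- the brackets
  let br : Fin 4 → Fin 4 → (Fin 4 → V) → K := fun i j a =>
    q (E'.e 2) (a i) * q (E'.e 3) (a j) - q (E'.e 3) (a i) * q (E'.e 2) (a j)
  have hqb : ∀ b, Continuous fun w : V => q b w := fun b =>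
    hqc.comp (f := fun w : V => (b, w)) (by fun_prop)
  have hbr : ∀ i j, Continuous (br i j) := fun i j =>
    (((hqb _).comp (continuous_apply i)).mul ((hqb _).comp (continuous_apply j))).sub
      (((hqb _).comp (continuous_apply i)).mul ((hqb _).comp (continuous_apply j)))
  have b01 : br 0 1 a₀ = 1 := by simp [br, ha₀, E'.gram]
  have b12 : br 1 2 a₀ = -1 := by simp [br, ha₀, E'.gram]
  have b23 : br 2 3 a₀ = 1 - c := by simp [br, ha₀, E'.gram]
  have b30 : br 3 0 a₀ = -1 := by simp [br, ha₀, E'.gram]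
  have hne : ∀ i j, br i j a₀ ≠ 0 →
      ∀ᶠ p : (Fin 4 → V) × (Fin 4 → Fin 2 → V) in 𝓝 (a₀, fun _ => ![E'.e 0, E'.e 1]),
        br i j p.1 ≠ 0 := fun i j h =>
    ((hbr i j).comp continuous_fst).continuousAt.eventually_ne h
  have hφ : ContinuousAt (fun p : (Fin 4 → V) × (Fin 4 → Fin 2 → V) =>
      br 2 3 p.1 * br 3 0 p.1 * (br 1 2 p.1 * br 0 1 p.1)⁻¹ * (1 - c)⁻¹)
      (a₀, fun _ => ![E'.e 0, E'.e 1]) := by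
    have hc := fun i j => ((hbr i j).comp continuous_fst).continuousAt
      (x := (a₀, fun _ : Fin 4 => ![E'.e 0, E'.e 1]))
    refine (((hc 2 3).mul (hc 3 0)).mul (((hc 1 2).mul (hc 0 1)).inv₀ ?_)).mul continuousAt_const
    simp [b01, b12]
  have hφ1 : br 2 3 a₀ * br 3 0 a₀ * (br 1 2 a₀ * br 0 1 a₀)⁻¹ * (1 - c)⁻¹ = 1 := by
    rw [b01, b12, b23, b30]
    simp [hc1']
  have ht := hφ.tendsto
  beta_reduce at ht
  rw [hφ1] at ht
  have hsq' := ht.eventually (p := IsSquare) hsq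
  obtain ⟨p, ⟨hp, n01, n12, n23, n30⟩, y, hy, hy1, -⟩ := mem_closure_iff_nhds.1 hlift _ (hsq'.and
    ((hne 0 1 (by simp [b01])).and ((hne 1 2 (by simp [b12])).and ((hne 2 3 (by simp [b23, hc1'])).and
      (hne 3 0 (by simp [b30]))))))
  have hr : br 2 3 p.1 * br 3 0 p.1 * (br 1 2 p.1 * br 0 1 p.1)⁻¹ * (1 - c)⁻¹ ≠ 0 :=
    mul_ne_zero (mul_ne_zero (mul_ne_zero n23 n30) (inv_ne_zero (mul_ne_zero n12 n01)))
      (inv_ne_zero hc1')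
  obtain ⟨r, hr'⟩ := hp
  have hr0 : r ≠ 0 := by
    rintro rfl
    exact hr (by rw [hr', mul_zero])
  have h02 := zero_two_ne_zero_of_mem_apartments hA.witt hy hy1
  obtain ⟨hw, -, -⟩ := hy
  have m : ∀ i, p.1 i ∈ (y.1 i).1 := fun i => hy1 i ▸ Submodule.mem_span_singleton_self _
  have hii : ∀ i, q (p.1 i) (p.1 i) = 0 := fun i =>
    hw.isotropic i _ (hw.le i (m i)) _ (hw.le i (m i))
  have hsucc : ∀ i, q (p.1 i) (p.1 (i + 1)) = 0 := fun i =>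
    hw.isotropic i _ (hw.le i (m i)) _ (hw.succ_le i (m _))
  have q01 : q (p.1 0) (p.1 1) = 0 := hsucc 0
  have q12 : q (p.1 1) (p.1 2) = 0 := hsucc 1
  have q23 : q (p.1 2) (p.1 3) = 0 := hsucc 2
  have q30 : q (p.1 3) (p.1 0) = 0 := hsucc 3
  -- a combination of three of the vectors on which both coordinates vanish
  have key : ∀ i j k, q (p.1 i) (p.1 j) = 0 → q (p.1 j) (p.1 k) = 0 → ∃ v ∈ E'.perp,
      q v v = 2 * (br j k p.1 * br i j p.1 * q (p.1 i) (p.1 k)) := by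
    intro i j k hij hjk
    let w := p.1 i <• br j k p.1 + p.1 j <• br k i p.1 + p.1 k <• br i j p.1
    have h2 : q (E'.e 2) w = 0 := by
      let : Field K := { ‹DivisionRing K› with mul_comm := hK }
      simp only [w, br, q.map_add_right, q.map_smul_right, MulOpposite.unop_op]
      ring
    have h3 : q (E'.e (2 + 1)) w = 0 := by
      change q (E'.e 3) w = 0
      let : Field K := { ‹DivisionRing K› with mul_comm := hK }
      simp only [w, br, q.map_add_right, q.map_smul_right, MulOpposite.unop_op]
      ring
    refine ⟨_, E'.proj_mem w, (E'.map_proj h2 h3).trans ?_⟩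
    let : Field K := { ‹DivisionRing K› with mul_comm := hK }
    simp only [w, q.map_add_right, q.map_smul_right, q.map_add_left, q.map_smul_left,
      MulOpposite.unop_op, hii, hij, hjk, q.swap_eq_zero hij, q.swap_eq_zero hjk,
      hsymm (p.1 k) (p.1 i), hσ (br _ _ _)]
    ring
  obtain ⟨v, hv, hvv⟩ := key 0 1 2 q01 q12
  obtain ⟨v', hv', hvv'⟩ : ∃ v ∈ E'.perp,
      q v v = 2 * (br 2 3 p.1 * br 3 0 p.1 * q (p.1 0) (p.1 2)) := by
    obtain ⟨v, hv, hvv⟩ := key 2 3 0 q23 q30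
    exact ⟨v, hv, by rw [hvv, hsymm (p.1 2), hK (br 3 0 _)]⟩
  have h2' := hA.two_ne_zero
  have hvv0 : q v v ≠ 0 := hvv ▸ mul_ne_zero h2' (mul_ne_zero (mul_ne_zero n12 n01) h02)
  refine ⟨v', hv', v <• r, fun i => by simp [hv i], ?_, ?_, ?_⟩
  · exact hvv' ▸ mul_ne_zero h2' (mul_ne_zero (mul_ne_zero n23 n30) h02)
  · simpa [hr0] using hvv0
  · simp only [q.map_smul_left, q.map_smul_right, MulOpposite.unop_op, hσ r, hvv, hvv']
    generalize br 2 3 p.1 = b₁, br 3 0 p.1 = b₂, br 1 2 p.1 = b₃, br 0 1 p.1 = b₄,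
      q (p.1 0) (p.1 2) = k at *
    let : Field K := { ‹DivisionRing K› with mul_comm := hK }
    field_simp at hr' ⊢
    linear_combination (-1 : K) * hr'

end Form

section Scalars

/-! ### The topology of the scalars -/

variable {F : Type*} [NontriviallyNormedField F] [LocallyCompactSpace F] {K : Type*}
  [DivisionRing K] [Algebra F K] {σ : AntiInvolution K}

omit [LocallyCompactSpace F] in
theorem IsClassicalPair.finite [TopologicalSpace K] (h : IsClassicalPair F σ) :
    Module.Finite F K := by
  rcases h with ⟨h, -⟩ | ⟨a, b, ψ, -⟩ | ⟨-, ψ, -⟩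
  · exact .of_surjective (Algebra.linearMap F K) h.2
  · exact .equiv ψ.symm.toLinearEquiv
  · exact .equiv ψ.symm.toLinearEquiv

omit [LocallyCompactSpace F] in
/-- A quaternion algebra has an element that is not fixed by the involution. -/
theorem IsClassicalPair.bijective_of_isTrivial [TopologicalSpace K] (h : IsClassicalPair F σ)
    (h2 : (2 : F) ≠ 0) (hσ : σ.IsTrivial) : Function.Bijective (algebraMap F K) := by
  rcases h with ⟨h, -⟩ | ⟨a, b, ψ, hψ⟩ | ⟨-, ψ, hψ⟩
  · exact h
  · have h1 := congrArg QuaternionAlgebra.imI (hψ (ψ.symm ⟨0, 1, 0, 0⟩))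
    rw [hσ, ψ.apply_symm_apply] at h1
    simp only [QuaternionAlgebra.imI_star] at h1
    exact absurd (by linear_combination h1 : (2 : F) = 0) h2
  · have h1 := congrArg QuaternionAlgebra.imJ (hψ (ψ.symm ⟨0, 0, 1, 0⟩))
    rw [hσ, ψ.apply_symm_apply] at h1
    simp only [hamiltonTau] at h1
    exact absurd (by linear_combination h1 : (2 : F) = 0) h2

variable [TopologicalSpace K] [IsModuleTopology F K]

omit [LocallyCompactSpace F] in
theorem IsClassicalPair.continuous [IsTopologicalRing K] (h : IsClassicalPair F σ) :
    Continuous σ := by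
  have key : (∀ (r : F) (x : K), σ (r • x) = r • σ x) → Continuous σ := fun H =>
    IsModuleTopology.continuous_of_linearMap (R := F)
      ({ toFun := σ, map_add' := σ.map_add, map_smul' := H } : K →ₗ[F] K)
  rcases h with ⟨-, h⟩ | ⟨a, b, ψ, hψ⟩ | ⟨-, ψ, hψ⟩
  · exact h
  · refine key fun r x => ψ.injective ?_
    rw [hψ, map_smul, map_smul, hψ, QuaternionAlgebra.star_smul]
  · refine key fun r x => ψ.injective ?_
    rw [hψ, map_smul, map_smul, hψ]
    ext <;> simp [hamiltonTau]

omit [LocallyCompactSpace F] in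
variable (F K) in
/-- Coordinates of a division ring over `F`. -/
theorem exists_homeomorph [Module.Finite F K] [IsTopologicalRing K] :
    ∃ e : K ≃ₗ[F] (Fin (finrank F K) → F), Continuous e ∧ Continuous e.symm :=
  ⟨(Module.finBasis F K).equivFun, IsModuleTopology.continuous_of_linearMap _,
    IsModuleTopology.continuous_of_linearMap
      ((Module.finBasis F K).equivFun.symm : (Fin (finrank F K) → F) →ₗ[F] K)⟩

omit [LocallyCompactSpace F] in
variable (F K) in
theorem t2Space_of_finite [Module.Finite F K] [IsTopologicalRing K] : T2Space K := by
  obtain ⟨e, he, -⟩ := exists_homeomorph F K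
  exact .of_injective_continuous e.injective he

omit [LocallyCompactSpace F] in
variable (F K) in
/-- The inverse of `x` is obtained from the inverse of the matrix of the multiplication by `x`. -/
theorem continuousInv₀_of_finite [Module.Finite F K] [IsTopologicalRing K] : ContinuousInv₀ K := by
  let b := Module.finBasis F K
  let M := Algebra.leftMulMatrix b
  have hM : Continuous M := IsModuleTopology.continuous_of_linearMap (R := F) M.toLinearMap
  have hb : Continuous b.equivFun.symm := IsModuleTopology.continuous_of_linearMap
    (b.equivFun.symm : (Fin (finrank F K) → F) →ₗ[F] K)
  have hinv : ∀ x : K, x ≠ 0 → M x * M x⁻¹ = 1 := fun x hx => by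
    rw [← map_mul, mul_inv_cancel₀ hx, map_one]
  have hx : ∀ x : K, x⁻¹ = b.equivFun.symm (Matrix.mulVec (M x)⁻¹ (b.equivFun 1)) := by
    intro x
    by_cases hx : x = 0
    · simp [hx]
    · rw [Matrix.inv_eq_right_inv (hinv x hx), LinearEquiv.eq_symm_apply]
      have := Algebra.leftMulMatrix_mulVec_repr b x⁻¹ 1
      rw [mul_one] at this
      exact this.symm
  refine ⟨fun x hx0 => ?_⟩
  rw [show (Inv.inv : K → K) = fun x => _ from funext hx]
  have hdet : (M x).det ≠ 0 := fun h => by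
    have := congrArg Matrix.det (hinv x hx0)
    rw [Matrix.det_mul, h, zero_mul, Matrix.det_one] at this
    exact zero_ne_one this
  have h1 : ContinuousAt (fun x => (M x)⁻¹) x := by
    refine ContinuousAt.comp (g := Inv.inv) (continuousAt_matrix_inv _ ?_) hM.continuousAt
    rw [Ring.inverse_eq_inv']
    exact continuousAt_inv₀ hdet
  refine hb.continuousAt.comp (f := fun x => Matrix.mulVec (M x)⁻¹ (b.equivFun 1)) ?_
  exact (Continuous.matrix_mulVec continuous_id continuous_const).continuousAt.comp
    (f := fun x => (M x)⁻¹) h1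

variable (F K) in
/-- Up to right multiplication by scalars, nonzero vectors can be taken in a compact set that does
not contain `0`. -/
theorem exists_compact_shell [Module.Finite F K] [IsTopologicalRing K] :
    ∃ S : Set (Fin 4 → K), IsCompact S ∧ 0 ∉ S ∧
      ∀ c : Fin 4 → K, c ≠ 0 → ∃ z : K, (fun i => c i * z) ∈ S := by
  obtain ⟨e, he, he'⟩ := exists_homeomorph F K
  have : ProperSpace F := .of_locallyCompactSpace F
  obtain ⟨r, hr⟩ := NormedField.exists_one_lt_norm F
  let N : Set (Fin 4 → Fin (finrank F K) → F) := {y | 1 / ‖r‖ ≤ ‖y‖} ∩ Metric.closedBall 0 1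
  have hN : IsCompact N := (isCompact_closedBall 0 1).inter_left
    (isClosed_le continuous_const continuous_norm)
  let g : (Fin 4 → Fin (finrank F K) → F) → Fin 4 → K := fun y i => e.symm (y i)
  have hg : Continuous g := continuous_pi fun i => he'.comp (continuous_apply i)
  refine ⟨g '' N, hN.image hg, ?_, fun c hc => ?_⟩
  · rintro ⟨y, ⟨hy, -⟩, h0⟩
    have : y = 0 := funext fun i => e.symm.injective
      ((congrFun h0 i).trans (map_zero e.symm).symm)
    rw [this] at hy
    simp only [Set.mem_ofPred_eq, norm_zero] at hy
    exact absurd hy (not_le.2 (by positivity))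
  · have hc' : (fun i => e (c i)) ≠ 0 := fun h => hc (funext fun i => by
      simpa using congrFun h i)
    obtain ⟨d, -, h1, h2, -⟩ := rescale_to_shell hr one_pos hc'
    refine ⟨algebraMap F K d, d • fun i => e (c i), ⟨h2, by simpa using h1.le⟩, ?_⟩
    funext i
    change e.symm (d • e (c i)) = _
    rw [map_smul, e.symm_apply_apply, Algebra.smul_def, Algebra.commutes]

omit [LocallyCompactSpace F] in
/-- The norms `r * σ r` of elements of `F` are arbitrarily small central scalars fixed by `σ`. -/
theorem IsClassicalPair.zero_mem_closure_centralScalars [IsTopologicalRing K]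
    (h : IsClassicalPair F σ) :
    (0 : K) ∈ closure (centralScalars σ) := by
  have hc : Continuous fun r : F => algebraMap F K r * σ (algebraMap F K r) := by
    have h1 : Continuous (algebraMap F K) :=
      IsModuleTopology.continuous_of_linearMap (R := F) (Algebra.linearMap F K)
    exact h1.mul (h.continuous.comp h1)
  have ht : Tendsto (fun r : F => algebraMap F K r * σ (algebraMap F K r)) (𝓝[≠] 0) (𝓝 0) := by
    have := hc.tendsto 0
    simp only [map_zero, zero_mul] at this
    exact this.mono_left nhdsWithin_le_nhds
  refine mem_closure_of_tendsto ht (eventually_nhdsWithin_of_forall fun r hr => ?_)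
  have hr0 : algebraMap F K r ≠ 0 := by simpa using hr
  have hz : ∀ x, algebraMap F K r * x = x * algebraMap F K r := fun x => Algebra.commutes r x
  have hz' : ∀ x, σ (algebraMap F K r) * x = x * σ (algebraMap F K r) := fun x => by
    have := congrArg σ (hz (σ x))
    simpa using this.symm
  refine ⟨mul_ne_zero hr0 (by simpa using hr0), by simp, fun x => ?_⟩
  rw [mul_assoc, hz', ← mul_assoc, hz, mul_assoc]

/-- In characteristic different from `2`, squares form a neighbourhood of `1`. -/
theorem isSquare_mem_nhds_one [IsTopologicalRing K] (h2 : (2 : F) ≠ 0)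
    (h : Function.Bijective (algebraMap F K)) : {z : K | IsSquare z} ∈ 𝓝 (1 : K) := by
  have hF : {z : F | IsSquare z} ∈ 𝓝 (1 : F) := by
    have : ProperSpace F := .of_locallyCompactSpace F
    have hd : HasStrictDerivAt (fun x : F => x * x) (1 * 1 + 1 * 1) 1 :=
      (hasStrictDerivAt_id (1 : F)).mul (hasStrictDerivAt_id 1)
    have := hd.map_nhds_eq (by rwa [mul_one, one_add_one_eq_two])
    rw [mul_one] at this
    rw [← this]
    exact mem_map.2 (univ_mem' fun x => ⟨x, rfl⟩)
  let e : K ≃ₗ[F] F := (LinearEquiv.ofBijective (Algebra.linearMap F K) h).symm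
  have he : Continuous e := IsModuleTopology.continuous_of_linearMap (e : K →ₗ[F] F)
  have hes : ∀ z, algebraMap F K (e z) = z := fun z => e.symm_apply_apply z
  have h1 : e 1 = 1 := h.1 (by rw [hes, map_one])
  have := he.continuousAt (x := 1) |>.preimage_mem_nhds (t := {z | IsSquare z}) (by rwa [h1])
  filter_upwards [this] with z hz
  rw [← hes z]
  exact IsSquare.map (algebraMap F K) hz

end Scalars

section Form

variable {K : Type*} [DivisionRing K] {σ : AntiInvolution K}
  {V : Type*} [AddCommGroup V] [Module Kᵐᵒᵖ V] (q : HermitianForm σ V)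
  [TopologicalSpace V] [TopologicalSpace K] [IsTopologicalRing K] [IsModuleTopology Kᵐᵒᵖ V]
  [FiniteDimensional Kᵐᵒᵖ V]

variable (K V) in
theorem t2Space_module [T2Space K] : T2Space V :=
  .of_injective_continuous (Module.finBasis Kᵐᵒᵖ V).equivFun.injective
    (IsModuleTopology.continuous_of_linearMap
      (Module.finBasis Kᵐᵒᵖ V).equivFun.toLinearMap)

theorem HermitianForm.continuous (hσ : Continuous σ) :
    Continuous fun p : V × V => q p.1 p.2 := by
  have := IsModuleTopology.toContinuousAdd Kᵐᵒᵖ V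
  let b := Module.finBasis Kᵐᵒᵖ V
  have hb : ∀ i, Continuous fun v : V => (b.repr v i).unop := fun i =>
    MulOpposite.continuous_unop.comp
      (IsModuleTopology.continuous_of_linearMap (b.coord i : V →ₗ[Kᵐᵒᵖ] Kᵐᵒᵖ))
  have hq : ∀ v, Continuous fun w : V => q v w := fun v =>
    IsModuleTopology.continuous_of_linearMap (q.toLinear v)
  have : ∀ p : V × V, q p.1 p.2 = ∑ i, σ (b.repr p.1 i).unop * q (b i) p.2 := by
    intro p
    let φ : V →+ K :=
      { toFun := fun v => q v p.2, map_zero' := q.map_zero_left _, map_add' := fun v w => by simp }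
    calc q p.1 p.2 = φ (∑ i, b.repr p.1 i • b i) := by rw [b.sum_repr]; rfl
      _ = ∑ i, φ (b.repr p.1 i • b i) := map_sum _ _ _
      _ = _ := Finset.sum_congr rfl fun i _ => q.map_smul_left _ _ _
  simp only [this]
  exact continuous_finsetSum _ fun i _ => (hσ.comp ((hb i).comp continuous_fst)).mul
    ((hq _).comp continuous_snd)

end Form

section Scalars

/-! ### Skew scalars -/

/-- In terms of `P = j g` and `Q = j h`, which are pure quaternions of the same norm `N`, this says that
conjugation by `s = N - P Q` takes the direction of `P` to that of `Q`: `s̄ P s` is a multiple of `Q`. -/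
theorem hamiltonTau_mul_mul {F : Type*} [Field F] {N g₀ g₁ g₃ h₀ h₁ h₃ : F}
    (hg : g₀ ^ 2 + g₁ ^ 2 + g₃ ^ 2 = N) (hh : h₀ ^ 2 + h₁ ^ 2 + h₃ ^ 2 = N)
    (s : QuaternionAlgebra F (-1) 0 (-1))
    (hs : s = ⟨N + (g₀ * h₀ + g₁ * h₁ + g₃ * h₃), g₀ * h₁ - g₁ * h₀, g₁ * h₃ - g₃ * h₁,
      g₀ * h₃ - g₃ * h₀⟩) :
    hamiltonTau s * ⟨g₀, g₁, 0, g₃⟩ * s =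
      (2 * N * (N + (g₀ * h₀ + g₁ * h₁ + g₃ * h₃))) • ⟨h₀, h₁, 0, h₃⟩ := by
  subst hs
  ext
  · simp [hamiltonTau]
    grind
  · simp [hamiltonTau]
    grind
  · simp [hamiltonTau]
    grind
  · simp [hamiltonTau]
    grind

/-- Nonzero vectors of a real space of dimension `3` have the same norm up to a scalar. -/
theorem exists_ratio_of_ringEquiv_real {F : Type*} [Field F] (r : F ≃+* ℝ) {g₀ g₁ g₃ h₀ h₁ h₃ : F}
    (hg : ¬ (g₀ = 0 ∧ g₁ = 0 ∧ g₃ = 0)) (hh : ¬ (h₀ = 0 ∧ h₁ = 0 ∧ h₃ = 0)) :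
    ∃ l : F, l ≠ 0 ∧ g₀ ^ 2 + g₁ ^ 2 + g₃ ^ 2 ≠ 0 ∧
      (l * h₀) ^ 2 + (l * h₁) ^ 2 + (l * h₃) ^ 2 = g₀ ^ 2 + g₁ ^ 2 + g₃ ^ 2 := by
  have pos : ∀ a b c : F, ¬ (a = 0 ∧ b = 0 ∧ c = 0) → 0 < r (a ^ 2 + b ^ 2 + c ^ 2) := by
    intro a b c h
    simp only [map_add, map_pow]
    by_contra! hle
    have ha : r a = 0 := by nlinarith [sq_nonneg (r a), sq_nonneg (r b), sq_nonneg (r c)]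
    have hb : r b = 0 := by nlinarith [sq_nonneg (r a), sq_nonneg (r b), sq_nonneg (r c)]
    have hc : r c = 0 := by nlinarith [sq_nonneg (r a), sq_nonneg (r b), sq_nonneg (r c)]
    exact h ⟨by simpa using ha, by simpa using hb, by simpa using hc⟩
  have hG := pos _ _ _ hg
  have hH := pos _ _ _ hh
  set G := g₀ ^ 2 + g₁ ^ 2 + g₃ ^ 2
  have hsq := Real.sq_sqrt (div_pos hG hH).le
  obtain ⟨l, hl⟩ : ∃ l : F, l ^ 2 * (h₀ ^ 2 + h₁ ^ 2 + h₃ ^ 2) = G :=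
    ⟨r.symm (√(r G / r (h₀ ^ 2 + h₁ ^ 2 + h₃ ^ 2))), r.injective (by
      rw [map_mul, map_pow, r.apply_symm_apply, hsq, div_mul_cancel₀ _ hH.ne'])⟩
  have hG0 : G ≠ 0 := fun h => hG.ne' (by rw [h, map_zero])
  refine ⟨l, fun h => hG0 ?_, hG0, by rw [← hl]; ring⟩
  rw [← hl, h]
  ring

/-- If `σ` is not trivial, there are enough scalars `y ≠ 0` with `σ y = -y`: for every `c`, the sum
`y c + σ (y c)` can be made opposite to the value `σ s g s` of a one-dimensional hermitian form. For the
standard involution of a quaternion algebra both can be made `0`. For the other involution of the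
Hamilton quaternions, `y` is a multiple of `j`, and the form `σ s g s` takes values in every
direction. -/
theorem IsClassicalPair.exists_skew {F : Type*} [NontriviallyNormedField F] {K : Type*}
    [DivisionRing K] [Algebra F K] {σ : AntiInvolution K} [TopologicalSpace K]
    (h : IsClassicalPair F σ) (h2 : (2 : F) ≠ 0) (hσ : ¬ σ.IsTrivial) (c g : K) (hσg : σ g = g)
    (hg : g ≠ 0) : ∃ y s : K, y ≠ 0 ∧ σ y = -y ∧ y * c + σ (y * c) + σ s * g * s = 0 := by
  rcases h with ⟨h, -⟩ | ⟨a, b, ψ, hψ⟩ | ⟨⟨r, -⟩, ψ, hψ⟩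
  · have hK : ∀ x y : K, x * y = y * x := fun x y => by
      obtain ⟨x, rfl⟩ := h.2 x
      exact Algebra.commutes x y
    obtain ⟨z, hz⟩ : ∃ z, σ z ≠ z := by simpa [AntiInvolution.IsTrivial] using hσ
    by_cases hc : σ c = c
    · refine ⟨z - σ z, 0, sub_ne_zero.2 hz.symm, by simp, ?_⟩
      simp only [σ.map_mul, σ.map_sub, σ.involutive, hc, σ.map_zero, zero_mul, add_zero]
      rw [hK, ← mul_add, sub_add_sub_cancel, sub_self, mul_zero]
    · have hc0 : c - σ c ≠ 0 := sub_ne_zero.2 (Ne.symm hc)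
      have hy : σ (-(g * (c - σ c)⁻¹)) = - -(g * (c - σ c)⁻¹) := by
        rw [σ.map_neg, σ.map_mul, hσg, σ.map_inv, σ.map_sub, σ.involutive, hK, ← neg_sub c, inv_neg,
          mul_neg]
      refine ⟨-(g * (c - σ c)⁻¹), 1, neg_ne_zero.2 (mul_ne_zero hg (inv_ne_zero hc0)), hy, ?_⟩
      rw [σ.map_mul, hy, hK (σ c), neg_mul _ (σ c), ← sub_eq_add_neg, ← mul_sub, neg_mul, mul_assoc,
        inv_mul_cancel₀ hc0]
      simp
  · -- a pure quaternion orthogonal to the conjugate of `c`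
    obtain ⟨x₁, x₂, hx, hre⟩ : ∃ x₁ x₂ : F, ¬ (x₁ = 0 ∧ x₂ = 0) ∧
        a * x₁ * (ψ c).imI + b * x₂ * (ψ c).imJ = 0 := by
      by_cases hac : a * (ψ c).imI = 0
      · exact ⟨1, 0, by simp, by simpa using hac⟩
      · exact ⟨b * (ψ c).imJ, -(a * (ψ c).imI), fun h => hac (neg_eq_zero.1 h.2), by ring⟩
    have hy : ψ (ψ.symm ⟨0, x₁, x₂, 0⟩) = ⟨0, x₁, x₂, 0⟩ := ψ.apply_symm_apply _
    refine ⟨ψ.symm ⟨0, x₁, x₂, 0⟩, 0, fun h0 => hx ?_, ψ.injective ?_, ψ.injective ?_⟩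
    · rw [h0, map_zero] at hy
      exact ⟨congrArg QuaternionAlgebra.imI hy.symm, congrArg QuaternionAlgebra.imJ hy.symm⟩
    · rw [hψ, map_neg, hy]
      ext <;> simp
    · rw [mul_zero, add_zero, map_add, hψ, map_mul, hy, map_zero]
      ext
      · simp
        linear_combination 2 * hre
      · simp
        ring
      · simp
        ring
      · simp
        ring
  · have hg2 : (ψ g).imJ = 0 := by
      have h1 := congrArg QuaternionAlgebra.imJ (hψ g)
      rw [hσg] at h1
      simp only [hamiltonTau] at h1
      exact (mul_eq_zero.1 (by linear_combination h1 : (2 : F) * (ψ g).imJ = 0)).resolve_left h2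
    obtain ⟨g₀, g₁, g₃, hgψ⟩ : ∃ g₀ g₁ g₃, ψ g = ⟨g₀, g₁, 0, g₃⟩ :=
      ⟨(ψ g).re, (ψ g).imI, (ψ g).imK, by ext <;> simp [hg2]⟩
    obtain ⟨c₀, c₁, c₂, c₃, hcψ⟩ : ∃ c₀ c₁ c₂ c₃, ψ c = ⟨c₀, c₁, c₂, c₃⟩ := ⟨_, _, _, _, rfl⟩
    have hg0 : ¬ (g₀ = 0 ∧ g₁ = 0 ∧ g₃ = 0) := by
      rintro ⟨rfl, rfl, rfl⟩
      exact hg (ψ.injective (by rw [hgψ, map_zero]; rfl))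
    -- `σ y = -y` means that `y` is a multiple of `j`
    suffices H : ∃ (t : F) (s : QuaternionAlgebra F (-1) 0 (-1)), t ≠ 0 ∧
        hamiltonTau s * ⟨g₀, g₁, 0, g₃⟩ * s = t • ⟨2 * c₂, -(2 * c₃), 0, 2 * c₁⟩ by
      obtain ⟨t, s, ht, hs⟩ := H
      have hy : ψ (ψ.symm ⟨0, 0, t, 0⟩) = ⟨0, 0, t, 0⟩ := ψ.apply_symm_apply _
      refine ⟨ψ.symm ⟨0, 0, t, 0⟩, ψ.symm s, fun h0 => ht ?_, ψ.injective ?_, ψ.injective ?_⟩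
      · rw [h0, map_zero] at hy
        exact congrArg QuaternionAlgebra.imJ hy.symm
      · rw [hψ, map_neg, hy]
        ext <;> simp [hamiltonTau]
      · rw [map_add, map_add, hψ, map_mul, map_mul, map_mul, hψ, hgψ, hcψ,
          ψ.apply_symm_apply, ψ.apply_symm_apply, hs, map_zero]
        ext <;> simp [hamiltonTau] <;> ring
    by_cases hh : 2 * c₂ = 0 ∧ -(2 * c₃) = 0 ∧ 2 * c₁ = 0
    · refine ⟨1, 0, one_ne_zero, ?_⟩
      rw [hh.1, hh.2.1, hh.2.2, mul_zero, one_smul]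
      rfl
    · obtain ⟨l, hl, hN, hlN⟩ := exists_ratio_of_ringEquiv_real r hg0 hh
      generalize 2 * c₂ = h₀, -(2 * c₃) = h₁, 2 * c₁ = h₃ at *
      have h4 : ∀ l : F, l ≠ 0 → (l * h₀) ^ 2 + (l * h₁) ^ 2 + (l * h₃) ^ 2 =
          g₀ ^ 2 + g₁ ^ 2 + g₃ ^ 2 →
          g₀ ^ 2 + g₁ ^ 2 + g₃ ^ 2 + (g₀ * (l * h₀) + g₁ * (l * h₁) + g₃ * (l * h₃)) ≠ 0 →
          ∃ (t : F) (s : QuaternionAlgebra F (-1) 0 (-1)), t ≠ 0 ∧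
            hamiltonTau s * ⟨g₀, g₁, 0, g₃⟩ * s = t • ⟨h₀, h₁, 0, h₃⟩ := by
        intro l hl hlN hne
        refine ⟨_, _, mul_ne_zero (mul_ne_zero (mul_ne_zero h2 hN) hne) hl,
          (hamiltonTau_mul_mul rfl hlN _ rfl).trans ?_⟩
        rw [mul_smul _ l]
        congr 1
        ext <;> simp
      by_cases hne : g₀ ^ 2 + g₁ ^ 2 + g₃ ^ 2 + (g₀ * (l * h₀) + g₁ * (l * h₁) + g₃ * (l * h₃)) = 0
      · refine h4 (-l) (neg_ne_zero.2 hl) (by rw [← hlN]; ring) fun h => ?_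
        exact mul_ne_zero h2 hN (by linear_combination h + hne)
      · exact h4 l hl hlN hne

end Scalars

section Form

variable {K : Type*} [DivisionRing K] {σ : AntiInvolution K}
  {V : Type*} [AddCommGroup V] [Module Kᵐᵒᵖ V] {q : HermitianForm σ V}

/-! ### Dimension five -/

/-- In dimension `5` the orthogonal complement of a frame is a line. -/
theorem Frame.exists_smul_eq (E : Frame q) (h5 : finrank Kᵐᵒᵖ V = 5) {v v' : V} (hv : v ∈ E.perp)
    (hv' : v' ∈ E.perp) (hv0 : v' ≠ 0) : ∃ y : K, v' <• y = v := by
  have : FiniteDimensional Kᵐᵒᵖ V := .of_finrank_pos (by omega)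
  have := finite_op_self (K := K)
  let g : V →ₗ[Kᵐᵒᵖ] (Fin 4 → K) := LinearMap.pi fun i => q.toLinear (E.e i)
  have hg : LinearMap.range g = ⊤ := LinearMap.range_eq_top.2 fun y => by
    refine ⟨∑ i, E.e (i + 2) <• y i, funext fun j => ?_⟩
    change q (E.e j) (∑ i, E.e (i + 2) <• y i) = y j
    fin_cases j <;> simp [Fin.sum_univ_four, E.gram]
  have hker : finrank Kᵐᵒᵖ (LinearMap.ker g) = 1 := by
    have := LinearMap.finrank_range_add_finrank_ker g
    rw [hg, finrank_top, finrank_pi_fintype, h5] at this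
    simp only [finrank_op_self, Finset.sum_const, Finset.card_univ, Fintype.card_fin,
      smul_eq_mul] at this
    omega
  have mem : ∀ w ∈ E.perp, w ∈ LinearMap.ker g := fun w hw => funext hw
  obtain ⟨y, hy⟩ := exists_smul_eq_of_finrank_eq_one hker (x := ⟨v', mem v' hv'⟩)
    (fun h => hv0 (congrArg Subtype.val h)) ⟨v, mem v hv⟩
  exact ⟨y.unop, congrArg Subtype.val hy⟩

/-- When the orthogonal complement of a frame is a line, the quotients of values of `q` are the
squares. -/
theorem IsAmbient.isSquare_iff [FiniteDimensional Kᵐᵒᵖ V] [TopologicalSpace K] (hA : IsAmbient q)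
    (E : Frame q) (hσ : σ.IsTrivial) (h5 : finrank Kᵐᵒᵖ V = 5) {d : K} (hd : d ≠ 0) :
    IsSquare d ↔ ∃ v ∈ E.perp, ∃ v' ∈ E.perp, v ≠ 0 ∧ v' ≠ 0 ∧ d = q v v * (q v' v')⁻¹ := by
  have hq : ∀ v ∈ E.perp, v ≠ 0 → ∀ y : K, q (v <• y) (v <• y) * (q v v)⁻¹ = y * y := by
    intro v hv hv0 y
    have hvv : q v v ≠ 0 := fun h => hv0 (E.perp_anisotropic hA.witt hv h)
    rw [q.map_smul_left, q.map_smul_right, MulOpposite.unop_op, hσ, hσ.mul_comm (q v v),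
      ← mul_assoc, mul_inv_cancel_right₀ hvv]
  constructor
  · rintro ⟨r, rfl⟩
    have hr : r ≠ 0 := fun h => hd (by simp [h])
    obtain ⟨v, hv, hv0, -⟩ := hA.exists_perp E
    exact ⟨v <• r, fun i => by simp [hv i], v, hv, op_smul_ne_zero hr hv0, hv0, (hq v hv hv0 r).symm⟩
  · rintro ⟨v, hv, v', hv', -, hv0, rfl⟩
    obtain ⟨y, rfl⟩ := E.exists_smul_eq h5 hv hv' hv0
    exact ⟨y, hq v' hv' hv0 y⟩

namespace Mor

variable {E : Frame q}

theorem IsPlaneTypeQuadripod.isCrossRatio {f : Mor E} (hf : f.IsPlaneTypeQuadripod) :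
    IsCrossRatio f.line (crossRatio f.line) := by
  have h : ∃ c, IsCrossRatio f.line c := by
    refine exists_isCrossRatio f.line (fun i j hij => hf.isPlaneStar.2 (Subtype.ext hij))
      (fun i => (f.config.1 i).2) _ (f.config.2 0).2 fun i => ?_
    have := f.isWalk_config.le i
    rwa [hf.isPlaneStar.1 i] at this
  rw [crossRatio, dif_pos h]
  exact h.choose_spec

theorem isSymmetricByInvolution_iff [FiniteDimensional Kᵐᵒᵖ V] [TopologicalSpace K]
    (hA : IsAmbient q) (hK : ∀ x y : K, x * y = y * x) {f : Mor E}
    (hf : f.IsLineTypeQuadripod) : f.IsSymmetricByInvolution ↔ f.IsSymmetric := by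
  constructor
  · rintro ⟨h4, s, h1, h2, h3, hl, hp⟩
    exact f.isWalk_config.isSymmetricStar_of_semiisometry hK hA.witt hf.isLineStar h4 ⟨h1, h2, h3⟩
      (fun v hv => hl.subset ⟨v, hv, rfl⟩) fun i v hv => (hp i).subset ⟨v, hv, rfl⟩
  · intro h
    obtain ⟨h4, s, hs, hl, hp⟩ := IsSymmetricStar.exists_semiisometry hA hK f.isWalk_config
      hf.isLineStar h
    refine ⟨h4, s, hs.map_smul, hs.map_form, hs.involutive, ?_, fun i => ?_⟩
    · refine subset_antisymm ?_ fun v hv => ⟨s v, hl v hv, hs.involutive v⟩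
      rintro _ ⟨v, hv, rfl⟩
      exact hl v hv
    · refine subset_antisymm ?_ fun v hv => ⟨s v, ?_, hs.involutive v⟩
      · rintro _ ⟨v, hv, rfl⟩
        exact hp i v hv
      · have := hp (i + 2) v hv
        rwa [add_assoc, show (2 + 2 : Fin 4) = 0 from rfl, add_zero] at this

end Mor

end Form

end ClassicalC2

end

theorem theorem13
    {F : Type*} [NontriviallyNormedField F] [LocallyCompactSpace F] (h2 : (2 : F) ≠ 0)
    {K : Type*} [DivisionRing K] [Algebra F K] [TopologicalSpace K] [IsModuleTopology F K]
    (σ : ClassicalC2.AntiInvolution K) (hσ : ClassicalC2.IsClassicalPair F σ)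
    {V : Type*} [AddCommGroup V] [Module Kᵐᵒᵖ V] [FiniteDimensional Kᵐᵒᵖ V]
    [TopologicalSpace V] [IsModuleTopology Kᵐᵒᵖ V]
    (hV : 5 ≤ Module.finrank Kᵐᵒᵖ V)
    (q : ClassicalC2.HermitianForm σ V) (hq : q.Nondegenerate) (hW : q.HasWittIndexTwo)
    (E : ClassicalC2.Frame q) :
    -- morphisms that are not quadripods
    (∀ f : ClassicalC2.Mor E, ¬ f.IsQuadripod → f ∈ closure (ClassicalC2.Mor.inj E)) ∧
    -- line-type quadripods
    (∀ f : ClassicalC2.Mor E, f.IsLineTypeQuadripod →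
      (f ∈ closure (ClassicalC2.Mor.inj E) ↔ f.IsSymmetric) ∧
      ((∀ x y : K, x * y = y * x) →
        (f ∈ closure (ClassicalC2.Mor.inj E) ↔ f.IsSymmetricByInvolution))) ∧
    -- plane-type quadripods
    (∀ f : ClassicalC2.Mor E, f.IsPlaneTypeQuadripod →
      (f ∈ closure (ClassicalC2.Mor.inj E) ↔
        (¬ σ.IsTrivial ∨
          (σ.IsTrivial ∧ ∃ v ∈ E.perp, ∃ v' ∈ E.perp, v ≠ 0 ∧ v' ≠ 0 ∧
            1 - ClassicalC2.crossRatio f.line = q v v * (q v' v')⁻¹)))) ∧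
    -- the case `σ = id` and `dim V = 5`
    (σ.IsTrivial → Module.finrank Kᵐᵒᵖ V = 5 →
      (∀ f : ClassicalC2.Mor E, f.IsLineTypeQuadripod →
        f ∈ closure (ClassicalC2.Mor.inj E)) ∧
      (∀ f : ClassicalC2.Mor E, f.IsPlaneTypeQuadripod →
        (f ∈ closure (ClassicalC2.Mor.inj E) ↔ IsSquare (1 - ClassicalC2.crossRatio f.line))) ∧
      (∀ (r : K ≃+* ℝ) (f : ClassicalC2.Mor E), f.IsPlaneTypeQuadripod →
        (f ∈ closure (ClassicalC2.Mor.inj E) ↔ r (ClassicalC2.crossRatio f.line) ≤ 1)) ∧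
      (Nonempty (K ≃+* ℂ) → closure (ClassicalC2.Mor.inj E) = Set.univ)) := by
  open ClassicalC2 in
  have := hσ.finite
  have := IsModuleTopology.isTopologicalRing F K
  have := t2Space_of_finite F K
  have := continuousInv₀_of_finite F K
  have := IsModuleTopology.topologicalAddGroup Kᵐᵒᵖ V
  have := t2Space_module K V
  have hA : IsAmbient q :=
    ⟨hq, hW, fun h => h2 ((algebraMap F K).injective (by rw [map_ofNat, h, map_zero])), hV,
      hσ.zero_mem_closure_centralScalars⟩
  have hqc := q.continuous hσ.continuous
  obtain ⟨S, hS, hS0, hSc⟩ := exists_compact_shell F K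
  have nonquad : ∀ f : Mor E, ¬ f.IsQuadripod → f ∈ closure (Mor.inj E) := fun f hf =>
    f.mem_closure_of_not_isQuadripod hA hf
  have line : ∀ f : Mor E, f.IsLineTypeQuadripod → (f ∈ closure (Mor.inj E) ↔ f.IsSymmetric) := by
    intro f hf
    rw [f.mem_closure_iff]
    exact ⟨hA.isSymmetricStar_of_mem_closure hqc hS hS0 hSc f.isWalk_config hf.isLineStar,
      hA.mem_closure_of_isSymmetricStar f.isWalk_config hf.isLineStar⟩
  have plane : ∀ f : Mor E, f.IsPlaneTypeQuadripod → (f ∈ closure (Mor.inj E) ↔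
      (¬ σ.IsTrivial ∨ (σ.IsTrivial ∧ ∃ v ∈ E.perp, ∃ v' ∈ E.perp, v ≠ 0 ∧ v' ≠ 0 ∧
        1 - crossRatio f.line = q v v * (q v' v')⁻¹))) := by
    intro f hf
    rw [f.mem_closure_iff]
    constructor
    · intro h
      by_cases hσ' : σ.IsTrivial
      · exact Or.inr ⟨hσ', hA.exists_ratio_of_mem_closure E hσ' hqc
          (isSquare_mem_nhds_one h2 (hσ.bijective_of_isTrivial h2 hσ')) f.isWalk_config
          hf.isPlaneStar hf.isCrossRatio h⟩
      · exact Or.inl hσ'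
    · rintro (hσ' | ⟨hσ', v, hv, v', hv', hv0, hv0', h⟩)
      · exact hA.mem_closure_of_exists_skew E (hσ.exists_skew h2 hσ') f.isWalk_config
          hf.isPlaneStar hf.isCrossRatio
      · exact hA.mem_closure_of_ratio E hσ' f.isWalk_config hf.isPlaneStar hf.isCrossRatio hv hv'
          hv0 hv0' h
  refine ⟨nonquad, fun f hf => ⟨line f hf, fun hK => (line f hf).trans
    (Mor.isSymmetricByInvolution_iff hA hK hf).symm⟩, plane, fun hσ' h5 => ?_⟩
  have line5 : ∀ f : Mor E, f.IsLineTypeQuadripod → f ∈ closure (Mor.inj E) := fun f hf =>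
    (line f hf).2 (hA.isSymmetricStar_of_finrank_eq_five hσ' h5 f.isWalk_config hf.isLineStar)
  have plane5 : ∀ f : Mor E, f.IsPlaneTypeQuadripod →
      (f ∈ closure (Mor.inj E) ↔ IsSquare (1 - crossRatio f.line)) := by
    intro f hf
    have hc := (hf.isPlaneStar.crossRatio_ne hf.isCrossRatio).2
    rw [plane f hf, hA.isSquare_iff E hσ' h5 (sub_ne_zero.2 hc.symm)]
    simp [hσ']
  refine ⟨line5, plane5, fun r f hf => ?_, fun ⟨r⟩ => Set.eq_univ_of_forall fun f => ?_⟩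
  · rw [plane5 f hf, ← sub_nonneg, ← map_one r, ← map_sub]
    constructor
    · rintro ⟨y, hy⟩
      rw [hy, map_mul]
      exact mul_self_nonneg _
    · intro h
      refine ⟨r.symm √(r (1 - crossRatio f.line)), r.injective ?_⟩
      rw [map_mul, r.apply_symm_apply, Real.mul_self_sqrt h]
  · by_cases hf : f.IsQuadripod
    · rcases hf.line_or_plane with hf | hf
      · exact line5 f hf
      · obtain ⟨y, hy⟩ := IsAlgClosed.exists_eq_mul_self (r (1 - crossRatio f.line))
        exact (plane5 f hf).2 ⟨r.symm y, r.injective (by simp [hy])⟩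
    · exact nonquad f hf
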